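/- All graphs are finite, undirected and simple; $n$ and $m$ denote the numbers of vertices and edges of $G=(V,E)$. A set $D\subseteq V$ is an efficient dominating set (e.d.) of $G$ if every vertex of $G$ is equal or adjacent to exactly one vertex of $D$. The Weighted Efficient Domination problem (WED) asks, for a graph $G$ and vertex weights $\omega:V\to\mathbb N$, to find an e.d. of $G$ of minimum total weight, or to determine that $G$ has no e.d. Let $P_k$ be the chordless path on $k$ vertices and $P_i+P_j$ the disjoint union of $P_i$ and $P_j$; a graph is $F$-free if it has no induced subgraph isomorphic to $F$. Running times are measured on a unit-cost random access machine with addition and truncated subtraction of natural numbers, where the graph is given by adjacency lists. **Theorem.** WED can be solved robustly on $(P_2+P_4)$-free graphs in time $O(nm)$: there is an algorithm that, on every graph $G$ with vertex weights $\omega:V\to\mathbb N$ (whether $G$ is $(P_2+P_4)$-free or not), either solves WED on $(G,\omega)$ correctly or correctly reports that $G$ is not $(P_2+P_4)$-free, and that takes at most $C\,nm$ steps if $m\ge 1$ and at most $C(n+1)$ steps if $m=0$, for an absolute constant $C$. Consequently, WED can be solved on $(P_2+P_3)$-free graphs in polynomial time. -/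

import Mathlib

/-! ### Efficient dominating sets and classes of graphs -/

/-- `D` is an efficient dominating set of `G`: every vertex is dominated by (that is, equal or
adjacent to) exactly one vertex of `D`. -/
def IsEfficientDominating {V : Type*} (G : SimpleGraph V) (D : Finset V) : Prop :=
  ∀ v : V, ∃! d : V, d ∈ D ∧ (d = v ∨ G.Adj d v)

/-- `D` is an efficient dominating set of `G` of minimum total weight. -/
def IsMinWeightED {V : Type*} (G : SimpleGraph V) (ω : V → ℕ) (D : Finset V) : Prop :=
  IsEfficientDominating G D ∧
    ∀ D' : Finset V, IsEfficientDominating G D' → ∑ v ∈ D, ω v ≤ ∑ v ∈ D', ω v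

/-- `G` has no induced subgraph isomorphic to `F`. -/
def IndFree {W V : Type*} (F : SimpleGraph W) (G : SimpleGraph V) : Prop :=
  ¬ F.IsIndContained G

/-- `P₂ + P₄`: the disjoint union of the chordless paths on 2 and on 4 vertices. -/
abbrev P2P4 : SimpleGraph (Fin 2 ⊕ Fin 4) :=
  (SimpleGraph.pathGraph 2).sum (SimpleGraph.pathGraph 4)

/-- `P₂ + P₃`: the disjoint union of the chordless paths on 2 and on 3 vertices. -/
abbrev P2P3 : SimpleGraph (Fin 2 ⊕ Fin 3) :=
  (SimpleGraph.pathGraph 2).sum (SimpleGraph.pathGraph 3)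

/-! ### The machine model: a unit-cost random access machine

A machine has registers and arrays of registers that hold natural numbers; a program is a finite
text (so it names only finitely many registers and arrays). The arithmetic is addition and
truncated subtraction only, array cells are addressed indirectly, and the control structures are
conditionals and loops. Every elementary operation costs one step. -/
namespace RAM

/-- A memory configuration: the registers `reg 0, reg 1, …` and the arrays `arr 0, arr 1, …`. -/
structure State where
  reg : ℕ → ℕ
  arr : ℕ → ℕ → ℕ

/-- Arithmetic expressions: constants, registers, array cells, sums, truncated differences. -/
inductive Expr where
  | const (c : ℕ)
  | reg (x : ℕ)
  | load (a : ℕ) (i : Expr)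
  | add (e f : Expr)
  | sub (e f : Expr)

/-- The value of an expression. -/
def Expr.eval (s : State) : Expr → ℕ
  | .const c => c
  | .reg x => s.reg x
  | .load a i => s.arr a (i.eval s)
  | .add e f => e.eval s + f.eval s
  | .sub e f => e.eval s - f.eval s

/-- The number of steps for evaluating an expression: one for each operation in it. -/
def Expr.cost : Expr → ℕ
  | .const _ => 1
  | .reg _ => 1
  | .load _ i => i.cost + 1
  | .add e f => e.cost + f.cost + 1
  | .sub e f => e.cost + f.cost + 1

/-- Programs. A test is passed when the value of its expression is not zero. -/
inductive Prog where
  | skip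
  | assign (x : ℕ) (e : Expr)
  | store (a : ℕ) (i e : Expr)
  | seq (p q : Prog)
  | ite (e : Expr) (p q : Prog)
  | loop (e : Expr) (p : Prog)

/-- The register `x` receives the value `c`. -/
def State.setReg (s : State) (x c : ℕ) : State :=
  { s with reg := Function.update s.reg x c }

/-- The cell `i` of the array `a` receives the value `c`. -/
def State.setArr (s : State) (a i c : ℕ) : State :=
  { s with arr := Function.update s.arr a (Function.update (s.arr a) i c) }

/-- `Runs p s t s'`: the program `p`, started in `s`, halts in `s'` after exactly `t` steps. -/
inductive Runs : Prog → State → ℕ → State → Prop where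
  | skip (s : State) : Runs .skip s 1 s
  | assign (s : State) (x : ℕ) (e : Expr) :
      Runs (.assign x e) s (e.cost + 1) (s.setReg x (e.eval s))
  | store (s : State) (a : ℕ) (i e : Expr) :
      Runs (.store a i e) s (i.cost + e.cost + 1) (s.setArr a (i.eval s) (e.eval s))
  | seq {p q : Prog} {s s' s'' : State} {t t' : ℕ} :
      Runs p s t s' → Runs q s' t' s'' → Runs (.seq p q) s (t + t') s''
  | ite_true {e : Expr} {p q : Prog} {s s' : State} {t : ℕ} :
      e.eval s ≠ 0 → Runs p s t s' → Runs (.ite e p q) s (e.cost + 1 + t) s'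
  | ite_false {e : Expr} {p q : Prog} {s s' : State} {t : ℕ} :
      e.eval s = 0 → Runs q s t s' → Runs (.ite e p q) s (e.cost + 1 + t) s'
  | loop_stop {e : Expr} {p : Prog} {s : State} :
      e.eval s = 0 → Runs (.loop e p) s (e.cost + 1) s
  | loop_step {e : Expr} {p : Prog} {s s' s'' : State} {t t' : ℕ} :
      e.eval s ≠ 0 → Runs p s t s' → Runs (.loop e p) s' t' s'' →
        Runs (.loop e p) s (e.cost + 1 + t + t') s''

/-- The machine is deterministic. -/
theorem Runs.det {p : Prog} {s s₁ s₂ : State} {t₁ t₂ : ℕ}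
    (h₁ : Runs p s t₁ s₁) (h₂ : Runs p s t₂ s₂) : t₁ = t₂ ∧ s₁ = s₂ := by
  induction h₁ generalizing t₂ s₂ with
  | skip => cases h₂; exact ⟨rfl, rfl⟩
  | assign => cases h₂; exact ⟨rfl, rfl⟩
  | store => cases h₂; exact ⟨rfl, rfl⟩
  | seq _ _ ih ih' =>
    cases h₂ with
    | seq k k' =>
      obtain ⟨rfl, rfl⟩ := ih k
      obtain ⟨rfl, rfl⟩ := ih' k'
      exact ⟨rfl, rfl⟩
  | ite_true h _ ih =>
    cases h₂ with
    | ite_true _ k => obtain ⟨rfl, rfl⟩ := ih k; exact ⟨rfl, rfl⟩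
    | ite_false k _ => exact absurd k h
  | ite_false h _ ih =>
    cases h₂ with
    | ite_true k _ => exact absurd h k
    | ite_false _ k => obtain ⟨rfl, rfl⟩ := ih k; exact ⟨rfl, rfl⟩
  | loop_stop h =>
    cases h₂ with
    | loop_stop _ => exact ⟨rfl, rfl⟩
    | loop_step k _ _ => exact absurd h k
  | loop_step h _ _ ih ih' =>
    cases h₂ with
    | loop_stop k => exact absurd k h
    | loop_step _ k k' =>
      obtain ⟨rfl, rfl⟩ := ih k
      obtain ⟨rfl, rfl⟩ := ih' k'
      exact ⟨rfl, rfl⟩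

end RAM

/-! ### Input, output, and what it means to solve the problem -/

/-- `L` lists, for every vertex, its neighbours without repetition, in any order. -/
def IsAdjLists {n : ℕ} (G : SimpleGraph (Fin n)) (L : Fin n → List (Fin n)) : Prop :=
  ∀ u : Fin n, (L u).Nodup ∧ ∀ w : Fin n, w ∈ L u ↔ G.Adj u w

/-- The machine's memory when it starts on the graph with vertices `0, …, n - 1`, adjacency lists
`L` and vertex weights `ω`. Register `0` holds `n`. Array `1` holds the lists `L 0, …, L (n - 1)`
one after the other; the list of `u` fills the cells from `arr 0 u` up to, but not including,
`arr 0 (u + 1)`. Array `2` holds the weights. Everything else is zero. -/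
def inputState {n : ℕ} (L : Fin n → List (Fin n)) (ω : Fin n → ℕ) : RAM.State where
  reg x := if x = 0 then n else 0
  arr a i :=
    if a = 0 then (if i ≤ n then ((List.ofFn L).take i).flatten.length else 0)
    else if a = 1 then ((List.ofFn L).flatten.map Fin.val).getD i 0
    else if a = 2 then (if h : i < n then ω ⟨i, h⟩ else 0)
    else 0

/-- The vertex set that the machine returns: its indicator function is left in array `3`. -/
def outputSet (n : ℕ) (s : RAM.State) : Finset (Fin n) :=
  Finset.univ.filter fun v => s.arr 3 v ≠ 0

/-- The memory `s` gives a correct answer to the instance `(G, ω)` of Weighted Efficient Domination: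
register `0` is `0` and the returned set is an e.d. of minimum weight, or register `0` is `1`
(meaning that there is no e.d.) and there is none. -/
def IsWEDAnswer {n : ℕ} (G : SimpleGraph (Fin n)) (ω : Fin n → ℕ) (s : RAM.State) : Prop :=
  (s.reg 0 = 0 ∧ IsMinWeightED G ω (outputSet n s)) ∨
    (s.reg 0 = 1 ∧ ∀ D : Finset (Fin n), ¬ IsEfficientDominating G D)

/-- `p` solves Weighted Efficient Domination on `F`-free graphs in time `T` (a function of the
numbers of vertices and edges). -/
def SolvesWED {W : Type*} (p : RAM.Prog) (F : SimpleGraph W) (T : ℕ → ℕ → ℕ) : Prop :=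
  ∀ (n : ℕ) (G : SimpleGraph (Fin n)) (ω : Fin n → ℕ) (L : Fin n → List (Fin n)),
    IsAdjLists G L → IndFree F G →
      ∃ (t : ℕ) (s : RAM.State), RAM.Runs p (inputState L ω) t s ∧
        t ≤ T n G.edgeSet.ncard ∧ IsWEDAnswer G ω s

/-- `p` solves Weighted Efficient Domination on `F`-free graphs robustly in time `T`: on every
finite graph, whether `F`-free or not, it halts in time `T` and either answers correctly or reports,
by the value `2` in register `0`, that the graph is not `F`-free, and this only if it is not. -/
def SolvesWEDRobustly {W : Type*} (p : RAM.Prog) (F : SimpleGraph W) (T : ℕ → ℕ → ℕ) : Prop :=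
  ∀ (n : ℕ) (G : SimpleGraph (Fin n)) (ω : Fin n → ℕ) (L : Fin n → List (Fin n)),
    IsAdjLists G L →
      ∃ (t : ℕ) (s : RAM.State), RAM.Runs p (inputState L ω) t s ∧
        t ≤ T n G.edgeSet.ncard ∧
          (IsWEDAnswer G ω s ∨ (s.reg 0 = 2 ∧ ¬ IndFree F G))

/-! Fix a vertex `v` with a neighbour `y` and look for the lightest e.d. through `v`. Members of an
e.d. are pairwise at distance at least three, so such an e.d. lies in the core: `v` together with
the vertices at distance at least three from it. The edge `vy` is anticomplete to every core vertex
except `v`, and `v` is isolated in the core, so an induced path on four vertices in the core yields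
an induced P₂+P₄ (`not_indFree_of_core_path`). If there is no such path, every core component with
at least two vertices is a join. Two members of an e.d. in one component would then be adjacent or
have a common neighbour, so the e.d. takes one dominating vertex from each component. A component
without a dominating vertex therefore excludes `v` or exhibits a path (`not_mem_ed_of_bad`,
`not_indFree_of_not_join`).

Otherwise the problem is to choose one candidate (dominating vertex) per component so that every
vertex outside the core sees exactly one chosen vertex (`Split.ed_iff`). Each component has a
preferred candidate, its base vertex. A vertex `z` outside the core is mixed if it sees a candidate
but not the base vertex of one component, and misses a candidate of another component that has
several. If a mixed `z` misses two candidates of one component, there is an induced P₂+P₄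
(`Split.not_indFree_of_mixed`). If it does not, then all members of an e.d. except the dominator of
`z` are forced, being the only missed candidates of their components. If no vertex is mixed, at most
one member of an e.d. has an outside neighbour that misses its base vertex, and the order of
preference lets base vertices replace all others at no cost. In both cases some e.d. at least as
good arises from one fixed selection `N` by changing the choice in a single component
(`Split.exists_exchange_of_mixed`, `Split.exists_exchange_of_not_mixed`). Whether such an exchange
is an e.d. can be read off from a few counts (`Split.ed_exchange_iff`), so all exchanges for `v` are
tested in time O(n+m).

Every non-empty failure report comes with an induced P₂+P₄, which gives robustness. Only
non-isolated `v` are tried: if there is an edge, every e.d. contains a non-isolated vertex, and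
there are at most 2m of these, which keeps the total within O(nm).

On the machine side, the computation for `v` is a branch-free list of statements in
single-assignment form. All their defining equations hold together in the final state
(`ensures_seqProg`), so correctness becomes a statement about one state, `Computed`. -/

namespace RAM

/-! ### Program logic with time bounds -/

/-- `p`, started in `s`, halts after at most `T` steps in a state with the property `Q`. -/
def Ensures (p : Prog) (s : State) (T : ℕ) (Q : State → Prop) : Prop :=
  ∃ t s', Runs p s t s' ∧ t ≤ T ∧ Q s'

theorem Ensures.mono {p : Prog} {s : State} {T T' : ℕ} {Q Q' : State → Prop}
    (h : Ensures p s T Q) (hT : T ≤ T') (hQ : ∀ s', Q s' → Q' s') : Ensures p s T' Q' := by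
  obtain ⟨t, s', hr, ht, hq⟩ := h
  exact ⟨t, s', hr, ht.trans hT, hQ _ hq⟩

theorem Ensures.seq {p q : Prog} {s : State} {T T' : ℕ} {Q Q' : State → Prop}
    (h : Ensures p s T Q) (h' : ∀ s', Q s' → Ensures q s' T' Q') :
    Ensures (.seq p q) s (T + T') Q' := by
  obtain ⟨t, s', hr, ht, hq⟩ := h
  obtain ⟨t', s'', hr', ht', hq'⟩ := h' s' hq
  exact ⟨t + t', s'', .seq hr hr', by omega, hq'⟩

theorem Ensures.skip {s : State} {Q : State → Prop} (h : Q s) : Ensures .skip s 1 Q :=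
  ⟨_, _, .skip s, le_rfl, h⟩

theorem Ensures.assign {s : State} {x : ℕ} {e : Expr} {Q : State → Prop}
    (h : Q (s.setReg x (e.eval s))) : Ensures (.assign x e) s (e.cost + 1) Q :=
  ⟨_, _, .assign s x e, le_rfl, h⟩

theorem Ensures.store {s : State} {a : ℕ} {i e : Expr} {Q : State → Prop}
    (h : Q (s.setArr a (i.eval s) (e.eval s))) :
    Ensures (.store a i e) s (i.cost + e.cost + 1) Q :=
  ⟨_, _, .store s a i e, le_rfl, h⟩

theorem Ensures.ite {s : State} {e : Expr} {p q : Prog} {T : ℕ} {Q : State → Prop}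
    (hp : e.eval s ≠ 0 → Ensures p s T Q) (hq : e.eval s = 0 → Ensures q s T Q) :
    Ensures (.ite e p q) s (e.cost + 1 + T) Q := by
  by_cases h : e.eval s = 0
  · obtain ⟨t, s', hr, ht, hQ⟩ := hq h
    exact ⟨_, s', .ite_false h hr, by omega, hQ⟩
  · obtain ⟨t, s', hr, ht, hQ⟩ := hp h
    exact ⟨_, s', .ite_true h hr, by omega, hQ⟩

/-- Every loop of the solver counts up to a known bound, so its guard can be required to equal the
number of rounds left; this gives termination as well. The induction is on that number, because the
loop rule peels off the first round. -/
theorem Ensures.loop {e : Expr} {p : Prog} (N : ℕ) (f : ℕ → ℕ) (Inv : ℕ → State → Prop)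
    (hg : ∀ i s, i ≤ N → Inv i s → e.eval s = N - i)
    (hb : ∀ i s, i < N → Inv i s → Ensures p s (f i) (Inv (i + 1))) {s : State} (h0 : Inv 0 s) :
    Ensures (.loop e p) s (∑ i ∈ Finset.range N, (f i + (e.cost + 1)) + (e.cost + 1)) (Inv N) := by
  have key : ∀ k ≤ N, ∀ s, Inv (N - k) s → Ensures (.loop e p) s
      (∑ i ∈ Finset.Ico (N - k) N, (f i + (e.cost + 1)) + (e.cost + 1)) (Inv N) := by
    intro k
    induction k with
    | zero =>
      intro _ s hs
      have h := hg _ s (by omega) hs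
      exact ⟨_, s, Runs.loop_stop (by omega), by simp, by simpa using hs⟩
    | succ k ih =>
      intro hk s hs
      have h := hg _ s (by omega) hs
      obtain ⟨t, s', hr, ht, hI⟩ := hb _ s (by omega) hs
      rw [show N - (k + 1) + 1 = N - k by omega] at hI
      obtain ⟨t', s'', hr', ht', hI'⟩ := ih (by omega) s' hI
      refine ⟨_, s'', .loop_step (by omega) hr hr', ?_, hI'⟩
      rw [Finset.sum_eq_sum_Ico_succ_bot (by omega), show N - (k + 1) + 1 = N - k by omega]
      omega
  have h := key N le_rfl s (by simpa using h0)
  rw [Nat.sub_self, ← Finset.range_eq_Ico] at h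
  exact h

/-! ### Expressions with the loop variables supplied -/

/-- The registers during a loop: register `1` is the current vertex, register `2` its current
neighbour, register `4` the accumulated sum. -/
def envReg (s : State) (u x acc r : ℕ) : ℕ :=
  if r = 1 then u else if r = 2 then x else if r = 4 then acc else s.reg r

/-- The loop variables are arguments here, so that the meaning of an expression inside a loop can
still be stated in a state where the loop is over and these registers have been overwritten. -/
def Expr.evalAt (s : State) (u x acc : ℕ) : Expr → ℕ
  | .const c => c
  | .reg r => envReg s u x acc r
  | .load a i => s.arr a (i.evalAt s u x acc)
  | .add e f => e.evalAt s u x acc + f.evalAt s u x acc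
  | .sub e f => e.evalAt s u x acc - f.evalAt s u x acc

def Expr.regs : Expr → List ℕ
  | .const _ => []
  | .reg r => [r]
  | .load _ i => i.regs
  | .add e f => e.regs ++ f.regs
  | .sub e f => e.regs ++ f.regs

def Expr.arrs : Expr → List ℕ
  | .const _ => []
  | .reg _ => []
  | .load a i => a :: i.arrs
  | .add e f => e.arrs ++ f.arrs
  | .sub e f => e.arrs ++ f.arrs

theorem Expr.eval_eq_evalAt {s s' : State} {u x acc : ℕ} (e : Expr)
    (hr : ∀ r ∈ e.regs, s'.reg r = envReg s u x acc r) (ha : ∀ a ∈ e.arrs, s'.arr a = s.arr a) :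
    e.eval s' = e.evalAt s u x acc := by
  induction e with
  | const c => rfl
  | reg r => exact hr r (by simp [regs])
  | load a i ih =>
    simp only [eval, evalAt]
    rw [ih hr fun a h => ha a (by simp [arrs, h]), ha a (by simp [arrs])]
  | add e f ihe ihf =>
    simp only [eval, evalAt]
    rw [ihe (fun r h => hr r (by simp [regs, h])) fun a h => ha a (by simp [arrs, h]),
      ihf (fun r h => hr r (by simp [regs, h])) fun a h => ha a (by simp [arrs, h])]
  | sub e f ihe ihf =>
    simp only [eval, evalAt]
    rw [ihe (fun r h => hr r (by simp [regs, h])) fun a h => ha a (by simp [arrs, h]),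
      ihf (fun r h => hr r (by simp [regs, h])) fun a h => ha a (by simp [arrs, h])]

theorem Expr.evalAt_congr {s s' : State} {u x acc x' acc' : ℕ} (e : Expr)
    (hr : ∀ r ∈ e.regs, envReg s' u x' acc' r = envReg s u x acc r)
    (ha : ∀ a ∈ e.arrs, s'.arr a = s.arr a) :
    e.evalAt s' u x' acc' = e.evalAt s u x acc := by
  induction e with
  | const c => rfl
  | reg r => exact hr r (by simp [regs])
  | load a i ih =>
    simp only [evalAt]
    rw [ih hr fun a h => ha a (by simp [arrs, h]), ha a (by simp [arrs])]
  | add e f ihe ihf =>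
    simp only [evalAt]
    rw [ihe (fun r h => hr r (by simp [regs, h])) fun a h => ha a (by simp [arrs, h]),
      ihf (fun r h => hr r (by simp [regs, h])) fun a h => ha a (by simp [arrs, h])]
  | sub e f ihe ihf =>
    simp only [evalAt]
    rw [ihe (fun r h => hr r (by simp [regs, h])) fun a h => ha a (by simp [arrs, h]),
      ihf (fun r h => hr r (by simp [regs, h])) fun a h => ha a (by simp [arrs, h])]

/-! ### Adjacency lists in memory -/

/-- The position in the concatenated adjacency lists where the list of `i` starts. -/
def offset {n : ℕ} (L : Fin n → List (Fin n)) (i : ℕ) : ℕ :=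
  ((List.ofFn L).take i).flatten.length

structure HasGraph {n : ℕ} (L : Fin n → List (Fin n)) (s : State) : Prop where
  size : s.reg 0 = n
  start : ∀ i ≤ n, s.arr 0 i = offset L i
  entry : ∀ (u : Fin n) (k : ℕ) (h : k < (L u).length), s.arr 1 (offset L u + k) = (L u)[k]

theorem offset_succ {n : ℕ} (L : Fin n → List (Fin n)) (u : Fin n) :
    offset L (u + 1) = offset L u + (L u).length := by
  unfold offset
  rw [List.take_add_one, List.flatten_append, List.length_append]
  simp

theorem offset_eq_sum {n : ℕ} (L : Fin n → List (Fin n)) :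
    offset L n = ∑ u, (L u).length := by
  unfold offset
  rw [List.take_of_length_le (by simp), List.length_flatten, List.map_ofFn, List.sum_ofFn]
  rfl

theorem hasGraph_inputState {n : ℕ} (L : Fin n → List (Fin n)) (ω : Fin n → ℕ) :
    HasGraph L (inputState L ω) where
  size := by simp [inputState]
  start i hi := by simp [inputState, hi, offset]
  entry u k h := by
    simp only [inputState, one_ne_zero, if_false, if_true]
    have h1 : (List.ofFn L).flatten =
        ((List.ofFn L).take u).flatten ++ (L u ++ ((List.ofFn L).drop (u + 1)).flatten) := by
      conv_lhs => rw [← List.take_append_drop u (List.ofFn L), List.flatten_append]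
      rw [List.drop_eq_getElem_cons (by simp), List.flatten_cons]
      simp
    rw [h1, offset]
    generalize ((List.ofFn L).take u).flatten = l
    rw [List.map_append, List.getD_append_right _ _ _ _ (by simp)]
    simp [List.getD_eq_getElem?_getD, List.getElem?_append, h]

theorem HasGraph.congr {n : ℕ} {L : Fin n → List (Fin n)} {s s' : State} (h : HasGraph L s)
    (h0 : s'.reg 0 = s.reg 0) (h1 : s'.arr 0 = s.arr 0) (h2 : s'.arr 1 = s.arr 1) :
    HasGraph L s' :=
  ⟨by rw [h0, h.size], by rw [h1]; exact h.start, by rw [h2]; exact h.entry⟩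

end RAM

namespace RAM

/-- The neighbours of `u`. -/
noncomputable def nbrs {V : Type*} [Fintype V] (G : SimpleGraph V) (u : V) : Finset V :=
  open Classical in Finset.univ.filter (G.Adj u)

@[simp] theorem mem_nbrs {V : Type*} [Fintype V] {G : SimpleGraph V} {u x : V} :
    x ∈ nbrs G u ↔ G.Adj u x := by
  simp [nbrs]

theorem sum_adjList {n : ℕ} {G : SimpleGraph (Fin n)} {L : Fin n → List (Fin n)}
    (hL : IsAdjLists G L) (u : Fin n) (f : Fin n → ℕ) :
    ((L u).map f).sum = ∑ x ∈ nbrs G u, f x := by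
  rw [← List.sum_toFinset f (hL u).1]
  exact Finset.sum_congr (by ext x; simp [(hL u).2]) fun _ _ => rfl

theorem length_adjList {n : ℕ} {G : SimpleGraph (Fin n)} {L : Fin n → List (Fin n)}
    (hL : IsAdjLists G L) (u : Fin n) : (L u).length = (nbrs G u).card := by
  have := sum_adjList hL u fun _ => 1
  simpa using this

/-! ### Straight-line programs over vertex arrays -/

/-- The statements of straight-line programs. In `gather a e c f g`, the cell `u` of the array `a`
receives `f` or `g`, depending on the test `c`; these may refer to the sum of `e` over the
neighbours of `u`. -/
inductive Stmt where
  | gather (a : ℕ) (e c f g : Expr)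
  | total (r : ℕ) (e : Expr)
  | minim (r : ℕ) (e₀ e : Expr)
  | assign (r : ℕ) (e : Expr)

/-- Runs `p` for `u = 0, …, n - 1` in register `1`. -/
def forVertices (p : Prog) : Prog :=
  .seq (.assign 1 (.const 0)) (.loop (.sub (.reg 0) (.reg 1))
    (.seq p (.assign 1 (.add (.reg 1) (.const 1)))))

/-- Runs `p` with register `2` ranging over the neighbours of the vertex in register `u`. -/
def forNeighbors (u : ℕ) (p : Prog) : Prog :=
  .seq (.assign 3 (.load 0 (.reg u)))
    (.loop (.sub (.load 0 (.add (.reg u) (.const 1))) (.reg 3))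
      (.seq (.assign 2 (.load 1 (.reg 3)))
        (.seq p (.assign 3 (.add (.reg 3) (.const 1))))))

/-- With truncated subtraction, `r - (r - e)` is the minimum of `r` and `e`. -/
def Stmt.prog : Stmt → Prog
  | .gather a e c f g => forVertices (.seq (.assign 4 (.const 0))
      (.seq (forNeighbors 1 (.assign 4 (.add (.reg 4) e)))
        (.ite c (.store a (.reg 1) f) (.store a (.reg 1) g))))
  | .total r e => .seq (.assign r (.const 0)) (forVertices (.assign r (.add (.reg r) e)))
  | .minim r e₀ e => .seq (.assign r e₀)
      (forVertices (.assign r (.sub (.reg r) (.sub (.reg r) e))))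
  | .assign r e => .assign r e

/-- A factor for the bound `cost * (n + 2m + 1)`; the additive constants are generous. -/
def Stmt.cost : Stmt → ℕ
  | .gather _ e c f g => e.cost + c.cost + f.cost + g.cost + 40
  | .total _ e => e.cost + 20
  | .minim _ e₀ e => e₀.cost + e.cost + 20
  | .assign _ e => e.cost + 1

/-- What a statement establishes. -/
def Stmt.Holds {n : ℕ} (G : SimpleGraph (Fin n)) (s : State) : Stmt → Prop
  | .gather a e c f g => ∀ u : Fin n, s.arr a u =
      if c.evalAt s u 0 (∑ x ∈ nbrs G u, e.evalAt s u x 0) ≠ 0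
      then f.evalAt s u 0 (∑ x ∈ nbrs G u, e.evalAt s u x 0)
      else g.evalAt s u 0 (∑ x ∈ nbrs G u, e.evalAt s u x 0)
  | .total r e => s.reg r = ∑ u : Fin n, e.evalAt s u 0 0
  | .minim r e₀ e => s.reg r ≤ e₀.evalAt s 0 0 0 ∧ (∀ u : Fin n, s.reg r ≤ e.evalAt s u 0 0) ∧
      (s.reg r = e₀.evalAt s 0 0 0 ∨ ∃ u : Fin n, s.reg r = e.evalAt s u 0 0)
  | .assign r e => s.reg r = e.evalAt s 0 0 0

/-- The registers other than loop variables that a statement reads. -/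
def Stmt.rregs : Stmt → List ℕ
  | .gather _ e c f g => e.regs ++ c.regs ++ f.regs ++ g.regs
  | .total _ e => e.regs
  | .minim _ e₀ e => e₀.regs ++ e.regs
  | .assign _ e => e.regs

def Stmt.rarrs : Stmt → List ℕ
  | .gather _ e c f g => e.arrs ++ c.arrs ++ f.arrs ++ g.arrs
  | .total _ e => e.arrs
  | .minim _ e₀ e => e₀.arrs ++ e.arrs
  | .assign _ e => e.arrs

def Stmt.wregs : Stmt → List ℕ
  | .gather .. => []
  | .total r _ => [r]
  | .minim r _ _ => [r]
  | .assign r _ => [r]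

def Stmt.warrs : Stmt → List ℕ
  | .gather a .. => [a]
  | _ => []

/-- The statement does not read what it writes, and uses loop variables only where they are
meaningful. -/
def Stmt.Ok : Stmt → Prop
  | .gather a e c f g => 2 ≤ a ∧ (∀ r ∈ e.regs, r ≠ 3 ∧ r ≠ 4) ∧
      (∀ r ∈ c.regs ++ f.regs ++ g.regs, r ≠ 2 ∧ r ≠ 3) ∧
      ∀ b ∈ e.arrs ++ c.arrs ++ f.arrs ++ g.arrs, b ≠ a
  | .total r e => 5 ≤ r ∧ ∀ q ∈ e.regs, q ≠ 2 ∧ q ≠ 3 ∧ q ≠ 4 ∧ q ≠ r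
  | .minim r e₀ e => 5 ≤ r ∧ (∀ q ∈ e₀.regs, q ≠ 1 ∧ q ≠ 2 ∧ q ≠ 3 ∧ q ≠ 4 ∧ q ≠ r) ∧
      ∀ q ∈ e.regs, q ≠ 2 ∧ q ≠ 3 ∧ q ≠ 4 ∧ q ≠ r
  | .assign r e => 5 ≤ r ∧ ∀ q ∈ e.regs, q ≠ 1 ∧ q ≠ 2 ∧ q ≠ 3 ∧ q ≠ 4 ∧ q ≠ r

instance : DecidablePred Stmt.Ok := fun st => by
  cases st <;> unfold Stmt.Ok <;> infer_instance

/-- `s'` arises from `s` by changing only loop variables and the given registers and arrays. -/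
structure Frame (wr wa : List ℕ) (s s' : State) : Prop where
  reg : ∀ r, r ∉ wr → r ≠ 1 → r ≠ 2 → r ≠ 3 → r ≠ 4 → s'.reg r = s.reg r
  arr : ∀ a, a ∉ wa → s'.arr a = s.arr a

theorem Frame.refl (wr wa : List ℕ) (s : State) : Frame wr wa s s :=
  ⟨fun _ _ _ _ _ _ => rfl, fun _ _ => rfl⟩

theorem Frame.trans {wr wa wr' wa' : List ℕ} {s s' s'' : State} (h : Frame wr wa s s')
    (h' : Frame wr' wa' s' s'') : Frame (wr ++ wr') (wa ++ wa') s s'' where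
  reg r h0 h1 h2 h3 h4 := by
    simp only [List.mem_append, not_or] at h0
    rw [h'.reg r h0.2 h1 h2 h3 h4, h.reg r h0.1 h1 h2 h3 h4]
  arr a h0 := by
    simp only [List.mem_append, not_or] at h0
    rw [h'.arr a h0.2, h.arr a h0.1]

theorem Frame.hasGraph {wr wa : List ℕ} {s s' : State} (h : Frame wr wa s s') (h0 : 0 ∉ wr)
    (h1 : 0 ∉ wa) (h2 : 1 ∉ wa) {n : ℕ} {L : Fin n → List (Fin n)} (hs : HasGraph L s) :
    HasGraph L s' :=
  hs.congr (h.reg 0 h0 (by simp) (by simp) (by simp) (by simp)) (h.arr 0 h1) (h.arr 1 h2)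

theorem Frame.evalAt {wr wa : List ℕ} {s s' : State} (h : Frame wr wa s s') (e : Expr)
    (hr : ∀ r ∈ e.regs, r ∉ wr ∧ r ≠ 3) (ha : ∀ a ∈ e.arrs, a ∉ wa) (u x acc : ℕ) :
    e.evalAt s' u x acc = e.evalAt s u x acc := by
  refine e.evalAt_congr (fun r hre => ?_) fun a hae => h.arr a (ha a hae)
  unfold envReg
  split_ifs with h1 h2 h4 <;> try rfl
  exact h.reg r (hr r hre).1 h1 h2 (hr r hre).2 h4

/-- An established equation survives every later change that avoids the cells it mentions. Loop
variables may change freely, since `evalAt` supplies them. -/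
theorem Stmt.Holds.frame {n : ℕ} {G : SimpleGraph (Fin n)} {wr wa : List ℕ} {s s' : State}
    {st : Stmt} (hst : st.Ok) (h : Frame wr wa s s') (hr : ∀ r ∈ st.rregs ++ st.wregs, r ∉ wr)
    (ha : ∀ a ∈ st.rarrs ++ st.warrs, a ∉ wa) (hh : st.Holds G s) : st.Holds G s' := by
  cases st with
  | gather a e c f g =>
    simp only [Ok, rregs, wregs, rarrs, warrs, List.mem_append, List.mem_singleton] at hst hr ha
    intro u
    have he : ∀ x, e.evalAt s' u x 0 = e.evalAt s u x 0 := fun x => h.evalAt e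
      (fun r k => ⟨hr r (by simp [k]), (hst.2.1 r k).1⟩) (fun a k => ha a (by simp [k])) _ _ _
    simp only [he]
    rw [h.evalAt c (fun r k => ⟨hr r (by simp [k]), (hst.2.2.1 r (by simp [k])).2⟩)
        (fun a k => ha a (by simp [k])),
      h.evalAt f (fun r k => ⟨hr r (by simp [k]), (hst.2.2.1 r (by simp [k])).2⟩)
        (fun a k => ha a (by simp [k])),
      h.evalAt g (fun r k => ⟨hr r (by simp [k]), (hst.2.2.1 r (by simp [k])).2⟩)
        (fun a k => ha a (by simp [k])), h.arr a (ha a (by simp))]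
    exact hh u
  | total r e =>
    simp only [Ok, rregs, wregs, rarrs, warrs, List.mem_append, List.mem_singleton] at hst hr ha
    have he : ∀ u, e.evalAt s' u 0 0 = e.evalAt s u 0 0 := fun x => h.evalAt e
      (fun r k => ⟨hr r (by simp [k]), (hst.2 r k).2.1⟩) (fun a k => ha a (by simp [k])) _ _ _
    simp only [Holds, he] at hh ⊢
    rwa [h.reg r (hr r (by simp)) (by omega) (by omega) (by omega) (by omega)]
  | minim r e₀ e =>
    simp only [Ok, rregs, wregs, rarrs, warrs, List.mem_append, List.mem_singleton] at hst hr ha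
    have he : ∀ u, e.evalAt s' u 0 0 = e.evalAt s u 0 0 := fun x => h.evalAt e
      (fun r k => ⟨hr r (by simp [k]), (hst.2.2 r k).2.1⟩) (fun a k => ha a (by simp [k])) _ _ _
    have he₀ : e₀.evalAt s' 0 0 0 = e₀.evalAt s 0 0 0 := h.evalAt e₀
      (fun r k => ⟨hr r (by simp [k]), (hst.2.1 r k).2.2.1⟩) (fun a k => ha a (by simp [k])) _ _ _
    simp only [Holds, he, he₀] at hh ⊢
    rwa [h.reg r (hr r (by simp)) (by omega) (by omega) (by omega) (by omega)]
  | assign r e =>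
    simp only [Ok, rregs, wregs, rarrs, warrs, List.mem_append, List.mem_singleton] at hst hr ha
    have he : e.evalAt s' 0 0 0 = e.evalAt s 0 0 0 := h.evalAt e
      (fun r k => ⟨hr r (by simp [k]), (hst.2 r k).2.2.1⟩) (fun a k => ha a (by simp [k])) _ _ _
    simp only [Holds, he] at hh ⊢
    rwa [h.reg r (hr r (by simp)) (by omega) (by omega) (by omega) (by omega)]

/-! ### Loops over vertices and neighbours -/

theorem ensures_forVertices {n : ℕ} {p : Prog} (f : ℕ → ℕ) (Inv : ℕ → State → Prop)
    (h1 : ∀ i s, Inv i s → s.reg 1 = i ∧ s.reg 0 = n)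
    (hb : ∀ (i : Fin n) s, Inv i s →
      Ensures p s (f i) fun s' => s'.reg 1 = i ∧ Inv (i + 1) (s'.setReg 1 (i + 1)))
    {s : State} (h0 : Inv 0 (s.setReg 1 0)) :
    Ensures (forVertices p) s (∑ i ∈ Finset.range n, (f i + 8) + 6) (Inv n) := by
  unfold forVertices
  refine (Ensures.seq (Q := fun s' => Inv 0 s') (.assign h0) fun s' hs' =>
    Ensures.loop n (fun i => f i + 4) Inv ?_ ?_ hs').mono ?_ fun _ h => h
  · intro i s _ hI
    simp [Expr.eval, h1 i s hI]
  · intro i s hi hI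
    refine (hb ⟨i, hi⟩ s hI).seq fun s' hs' => .assign ?_
    simpa [Expr.eval, hs'.1] using hs'.2
  · simp only [Expr.cost, Finset.sum_add_distrib, Finset.sum_const, Finset.card_range, smul_eq_mul]
    omega

theorem ensures_forNeighbors {n : ℕ} {L : Fin n → List (Fin n)} {p : Prog} (ru : ℕ) (u : Fin n)
    (c : ℕ) (Inv : ℕ → State → Prop)
    (h1 : ∀ i s, Inv i s → HasGraph L s ∧ s.reg ru = u ∧ s.reg 3 = offset L u + i)
    (hb : ∀ (i : ℕ) (hi : i < (L u).length) s, Inv i s →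
      Ensures p (s.setReg 2 ((L u)[i] : Fin n)) c fun s' =>
        s'.reg 3 = offset L u + i ∧ Inv (i + 1) (s'.setReg 3 (offset L u + (i + 1))))
    {s : State} (hs : HasGraph L s) (hsu : s.reg ru = u)
    (h0 : Inv 0 (s.setReg 3 (offset L u))) :
    Ensures (forNeighbors ru p) s ((L u).length * (c + 14) + 10) (Inv (L u).length) := by
  unfold forNeighbors
  refine (Ensures.seq (Q := fun s' => Inv 0 s') (.assign ?_) fun s' hs' =>
    Ensures.loop (L u).length (fun i => 3 + (c + 4)) Inv ?_ ?_ hs').mono ?_ fun _ h => h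
  · simpa [Expr.eval, hsu, hs.start u u.2.le] using h0
  · intro i s hi hI
    obtain ⟨hG, hu, h3⟩ := h1 i s hI
    simp only [Expr.eval, hu, h3, hG.start (u + 1) u.2, offset_succ]
    omega
  · intro i s hi hI
    obtain ⟨hG, hu, h3⟩ := h1 i s hI
    refine (Ensures.assign (Q := fun s' => s' = s.setReg 2 ((L u)[i] : Fin n)) ?_).seq ?_
    · simp [Expr.eval, h3, hG.entry u i hi]
    · rintro _ rfl
      refine (hb i hi s hI).seq fun s' hs' => .assign ?_
      have := hs'.2
      simp only [Expr.eval, hs'.1]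
      rwa [add_assoc]
  · simp only [Expr.cost, Finset.sum_const, Finset.card_range, smul_eq_mul]
    ring_nf
    omega

end RAM

/-! ### Correctness and linear running time of the statements -/

namespace RAM

@[simp] theorem State.setReg_arr (s : State) (x c : ℕ) : (s.setReg x c).arr = s.arr := rfl

@[simp] theorem State.setReg_self (s : State) (x c : ℕ) : (s.setReg x c).reg x = c := by
  simp [State.setReg]

theorem State.setReg_of_ne (s : State) {x y : ℕ} (c : ℕ) (h : y ≠ x) :
    (s.setReg x c).reg y = s.reg y := by
  simp [State.setReg, h]

@[simp] theorem State.setArr_reg (s : State) (a i c : ℕ) : (s.setArr a i c).reg = s.reg := rfl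

theorem State.setArr_of_ne (s : State) {a b : ℕ} (i c : ℕ) (h : b ≠ a) :
    (s.setArr a i c).arr b = s.arr b := by
  simp [State.setArr, h]

theorem State.setArr_self (s : State) (a i c j : ℕ) :
    (s.setArr a i c).arr a j = if j = i then c else s.arr a j := by
  simp [State.setArr, Function.update_apply]

theorem Frame.setReg {wr wa : List ℕ} {s s' : State} (h : Frame wr wa s s') {r : ℕ}
    (hr : r ∈ wr ∨ r = 1 ∨ r = 2 ∨ r = 3 ∨ r = 4) (c : ℕ) : Frame wr wa s (s'.setReg r c) where
  reg q h0 h1 h2 h3 h4 := by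
    rw [State.setReg_of_ne, h.reg q h0 h1 h2 h3 h4]
    rintro rfl
    tauto
  arr a ha := h.arr a ha

theorem Frame.setArr {wr wa : List ℕ} {s s' : State} (h : Frame wr wa s s') {a : ℕ}
    (ha : a ∈ wa) (i c : ℕ) : Frame wr wa s (s'.setArr a i c) where
  reg q h0 h1 h2 h3 h4 := h.reg q h0 h1 h2 h3 h4
  arr b hb := by
    rw [State.setArr_of_ne, h.arr b hb]
    rintro rfl
    tauto

theorem Frame.eval {wr wa : List ℕ} {s s' : State} (h : Frame wr wa s s') (e : Expr)
    {u x acc : ℕ} (hr : ∀ r ∈ e.regs, r ∉ wr ∧ r ≠ 3) (ha : ∀ a ∈ e.arrs, a ∉ wa)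
    (h1 : 1 ∈ e.regs → s'.reg 1 = u) (h2 : 2 ∈ e.regs → s'.reg 2 = x)
    (h4 : 4 ∈ e.regs → s'.reg 4 = acc) : e.eval s' = e.evalAt s u x acc := by
  refine e.eval_eq_evalAt (fun r hre => ?_) fun a hae => h.arr a (ha a hae)
  unfold envReg
  split_ifs with k1 k2 k4
  · subst k1; exact h1 hre
  · subst k2; exact h2 hre
  · subst k4; exact h4 hre
  · exact h.reg r (hr r hre).1 k1 k2 (hr r hre).2 k4

theorem Frame.append_nil {wr wa : List ℕ} {s s' : State} (h : Frame (wr ++ []) (wa ++ []) s s') :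
    Frame wr wa s s' := by
  simpa using h

/-- The array written is never read, so every expression has the same value in the initial, the
intermediate and the final states. The inner loops have `offset L n` rounds in total, which gives
linear time. -/
theorem ensures_gather {n : ℕ} {G : SimpleGraph (Fin n)} {L : Fin n → List (Fin n)}
    (hL : IsAdjLists G L) {a : ℕ} {e c f g : Expr} (hok : (Stmt.gather a e c f g).Ok) {s : State}
    (hs : HasGraph L s) :
    Ensures (Stmt.gather a e c f g).prog s
      ((Stmt.gather a e c f g).cost * (n + offset L n + 1))
      (fun s' => (Stmt.gather a e c f g).Holds G s' ∧ Frame [] [a] s s') := by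
  obtain ⟨ha2, he, hc, hb⟩ := hok
  simp only [List.mem_append] at hc hb
  set acc : Fin n → ℕ := fun u => ∑ x ∈ nbrs G u, e.evalAt s u x 0 with hacc
  set val : Fin n → ℕ := fun u => if c.evalAt s u 0 (acc u) ≠ 0 then f.evalAt s u 0 (acc u)
    else g.evalAt s u 0 (acc u) with hval
  let Inv : ℕ → State → Prop := fun i s₁ => Frame [] [a] s s₁ ∧ s₁.reg 1 = i ∧
    ∀ w : Fin n, w < i → s₁.arr a w = val w
  have key : Ensures (Stmt.gather a e c f g).prog s (∑ i ∈ Finset.range n,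
      ((if h : i < n then (L ⟨i, h⟩).length * (e.cost + 17) else 0) +
        (c.cost + f.cost + g.cost + 15) + 8) + 6) (Inv n) := by
    refine ensures_forVertices _ Inv (n := n) ?_ ?_ ?_
    · rintro i s₁ ⟨hF, h1, _⟩
      exact ⟨h1, (hF.hasGraph (by simp) (by simp; omega) (by simp; omega) hs).size⟩
    · rintro u s₁ ⟨hF, h1, hv⟩
      have hs₁ : HasGraph L s₁ := hF.hasGraph (by simp) (by simp; omega) (by simp; omega) hs
      -- During the inner loop, register `4` holds the sum over the part of the adjacency list
      -- already read.
      let J : ℕ → State → Prop := fun k s₂ => Frame [] [] s₁ s₂ ∧ s₂.reg 1 = u ∧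
        s₂.reg 3 = offset L u + k ∧
        s₂.reg 4 = (((L u).take k).map fun x : Fin n => e.evalAt s u x 0).sum
      have hinner : ∀ s₂, s₂ = s₁.setReg 4 0 → Ensures
          (forNeighbors 1 (.assign 4 (.add (.reg 4) e))) s₂
          ((L u).length * ((e.cost + 3) + 14) + 10) (J (L u).length) := by
        rintro _ rfl
        refine ensures_forNeighbors 1 u _ J ?_ ?_ ?_ ?_ ?_
        · rintro i s₂ ⟨hF₂, h1₂, h3₂, _⟩
          exact ⟨hF₂.hasGraph (by simp) (by simp) (by simp) hs₁, h1₂, h3₂⟩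
        · rintro i hi s₂ ⟨hF₂, h1₂, h3₂, h4₂⟩
          refine (Ensures.assign ?_).mono (T := (Expr.add (.reg 4) e).cost + 1)
            (by simp only [Expr.cost]; omega) fun _ h => h
          have hFF : Frame [] [a] s (s₂.setReg 2 ((L u)[i] : Fin n)) :=
            (hF.trans hF₂).append_nil.setReg (by simp) _
          have hev : e.eval (s₂.setReg 2 ((L u)[i] : Fin n)) = e.evalAt s u ((L u)[i] : Fin n) 0 := by
            refine hFF.eval e (fun r hr => ⟨by simp, (he r hr).1⟩)
              (fun b hbe => by simpa using hb b (by simp [hbe])) (fun _ => ?_) (fun _ => by simp)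
              fun h => absurd rfl (he 4 h).2
            rw [State.setReg_of_ne _ _ (by simp), h1₂]
          refine ⟨?_, ?_, ?_, by simp, ?_⟩
          · simp [State.setReg_of_ne, h3₂]
          · exact ((hF₂.setReg (by simp) _).setReg (by simp) _).setReg (by simp) _
          · simp [State.setReg_of_ne, h1₂]
          · rw [State.setReg_of_ne _ _ (by simp), State.setReg_self]
            simp only [Expr.eval, hev, List.take_add_one, List.map_append, List.sum_append]
            rw [State.setReg_of_ne _ _ (by simp), h4₂]
            simp [hi]
        · exact hs₁.congr (by simp [State.setReg_of_ne]) rfl rfl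
        · simp [State.setReg_of_ne, h1]
        · refine ⟨((Frame.refl _ _ s₁).setReg (by simp) _).setReg (by simp) _, ?_, by simp, ?_⟩
          · simp [State.setReg_of_ne, h1]
          · simp [State.setReg_of_ne]
      refine ((Ensures.assign (Q := fun s₂ => s₂ = s₁.setReg 4 0) ?_).seq fun s₂ hs₂ =>
        (hinner s₂ hs₂).seq (T' := c.cost + 1 + (f.cost + g.cost + 2)) fun s₃ hs₃ =>
          Ensures.ite ?_ ?_).mono ?_ fun _ h => h
      · simp [Expr.eval]
      all_goals try
        obtain ⟨hF₃, h1₃, h3₃, h4₃⟩ := hs₃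
        rw [List.take_length, sum_adjList hL] at h4₃
        have hFF : Frame [] [a] s s₃ := (hF.trans hF₃).append_nil
        have hev : ∀ d : Expr, (∀ r ∈ d.regs, r ≠ 2 ∧ r ≠ 3) → (∀ b ∈ d.arrs, b ≠ a) →
            d.eval s₃ = d.evalAt s u 0 (acc u) := fun d hd hd' =>
          hFF.eval d (fun r hr => ⟨by simp, (hd r hr).2⟩) (fun b hbe => by simpa using hd' b hbe)
            (fun _ => h1₃) (fun h => absurd rfl (hd 2 h).1) fun _ => h4₃
        have hce := hev c (fun r h => hc r (by simp [h])) (fun r h => hb r (by simp [h]))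
        have hfe := hev f (fun r h => hc r (by simp [h])) (fun r h => hb r (by simp [h]))
        have hge := hev g (fun r h => hc r (by simp [h])) (fun r h => hb r (by simp [h]))
        have hstore : ∀ y, y = val u → (s₃.setArr a u y).reg 1 = u ∧
            Inv (u + 1) ((s₃.setArr a u y).setReg 1 (u + 1)) := by
          rintro y rfl
          refine ⟨by simp [h1₃], (hFF.setArr (by simp) _ _).setReg (by simp) _, by simp, ?_⟩
          intro w hw
          rw [State.setReg_arr, State.setArr_self]
          split_ifs with h
          · rw [Fin.ext h]
          · rw [hF₃.arr a (by simp)]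
            exact hv w (by omega)
      · intro h
        refine (Ensures.store ?_).mono (T := (Expr.reg 1).cost + f.cost + 1)
          (by simp only [Expr.cost]; omega) fun _ h => h
        simp only [Expr.eval, h1₃]
        apply hstore
        rw [hce] at h
        simp only [hval, hfe, if_pos h]
      · intro h
        refine (Ensures.store ?_).mono (T := (Expr.reg 1).cost + g.cost + 1)
          (by simp only [Expr.cost]; omega) fun _ h => h
        simp only [Expr.eval, h1₃]
        apply hstore
        rw [hce] at h
        simp [hval, hge, h]
      · simp only [Expr.cost, Fin.is_lt, dif_pos]
        ring_nf
        omega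
    · exact ⟨(Frame.refl _ _ s).setReg (by simp) _, by simp, fun w hw => by omega⟩
  refine key.mono ?_ ?_
  · simp only [Stmt.cost, Finset.sum_add_distrib, Finset.sum_const, Finset.card_range, smul_eq_mul,
      offset_eq_sum]
    rw [← Fin.sum_univ_eq_sum_range (fun i => if h : i < n then (L ⟨i, h⟩).length * (e.cost + 17)
      else 0)]
    simp only [Fin.is_lt, dif_pos, ← Finset.sum_mul]
    nlinarith [Nat.zero_le (∑ i, (L i).length), Nat.zero_le n,
      Nat.zero_le ((∑ i, (L i).length) * (c.cost + f.cost + g.cost)), Nat.zero_le (n * e.cost)]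
  · rintro s' ⟨hF, h1, hv⟩
    refine ⟨?_, hF⟩
    intro u
    have hee : ∀ x, e.evalAt s' u x 0 = e.evalAt s u x 0 := fun x => hF.evalAt e
      (fun r k => ⟨by simp, (he r k).1⟩) (fun b k => by simpa using hb b (by simp [k])) _ _ _
    simp only [hee]
    rw [hF.evalAt c (fun r k => ⟨by simp, (hc r (by simp [k])).2⟩)
        (fun b k => by simpa using hb b (by simp [k])),
      hF.evalAt f (fun r k => ⟨by simp, (hc r (by simp [k])).2⟩)
        (fun b k => by simpa using hb b (by simp [k])),
      hF.evalAt g (fun r k => ⟨by simp, (hc r (by simp [k])).2⟩)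
        (fun b k => by simpa using hb b (by simp [k])), hv u u.2]

/-- A loop over the vertices that updates only the register `r`. -/
theorem ensures_forVertices_assign {n : ℕ} {L : Fin n → List (Fin n)} {r : ℕ} {d : Expr}
    (hr5 : 5 ≤ r) {s : State} (hs : HasGraph L s) (P : ℕ → ℕ → Prop) (h0 : P 0 (s.reg r))
    (hstep : ∀ (i : Fin n) s₁, Frame [r] [] s s₁ → s₁.reg 1 = i → P i (s₁.reg r) →
      P (i + 1) (d.eval s₁)) :
    Ensures (forVertices (.assign r d)) s (n * (d.cost + 9) + 6)
      (fun s' => P n (s'.reg r) ∧ Frame [r] [] s s') := by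
  let Inv : ℕ → State → Prop := fun i s₁ => Frame [r] [] s s₁ ∧ s₁.reg 1 = i ∧ P i (s₁.reg r)
  refine (ensures_forVertices (n := n) (fun _ => d.cost + 1) Inv ?_ ?_ ?_).mono ?_ ?_
  · rintro i s₁ ⟨hF, h1, _⟩
    exact ⟨h1, (hF.hasGraph (by simp; omega) (by simp) (by simp) hs).size⟩
  · rintro u s₁ ⟨hF, h1, hv⟩
    refine .assign ⟨?_, ?_, by simp, ?_⟩
    · rw [State.setReg_of_ne _ _ (by omega), h1]
    · exact (hF.setReg (by simp) _).setReg (by simp) _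
    · rw [State.setReg_of_ne _ _ (by omega), State.setReg_self]
      exact hstep u s₁ hF h1 hv
  · refine ⟨(Frame.refl _ _ s).setReg (by simp) _, by simp, ?_⟩
    rwa [State.setReg_of_ne _ _ (by omega)]
  · simp only [Finset.sum_const, Finset.card_range, smul_eq_mul]
    ring_nf
    omega
  · rintro s' ⟨hF, h1, hP⟩
    exact ⟨hP, hF⟩

theorem ensures_stmt {n : ℕ} {G : SimpleGraph (Fin n)} {L : Fin n → List (Fin n)}
    (hL : IsAdjLists G L) {st : Stmt} (hok : st.Ok) {s : State} (hs : HasGraph L s) :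
    Ensures st.prog s (st.cost * (n + offset L n + 1))
      (fun s' => st.Holds G s' ∧ Frame st.wregs st.warrs s s') := by
  cases st with
  | gather a e c f g => exact ensures_gather hL hok hs
  | total r e =>
    obtain ⟨hr5, he⟩ := hok
    have h := (Ensures.assign (s := s) (x := r) (e := .const 0)
      (Q := fun s₁ => Frame [r] [] s s₁ ∧ s₁.reg r = 0)
      ⟨(Frame.refl _ _ s).setReg (by simp) _, by simp [Expr.eval]⟩).seq fun s₁ hs₁ =>
        (ensures_forVertices_assign (L := L) (d := .add (.reg r) e) hr5
          (hs₁.1.hasGraph (by simp; omega) (by simp) (by simp) hs)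
          (fun i y => y = ∑ j ∈ Finset.range i, e.evalAt s j 0 0) (by simp [hs₁.2])
          (by
            intro i s₂ hF h1 hP
            have hFF := hs₁.1.trans hF
            rw [Finset.sum_range_succ, ← hP]
            simp only [Expr.eval]
            congr 1
            refine hFF.eval e (fun q hq => ⟨by simpa using (he q hq).2.2.2, (he q hq).2.1⟩)
              (by simp) (fun _ => h1) (fun h => absurd rfl (he 2 h).1)
              fun h => absurd rfl (he 4 h).2.2.1)).mono (T' := n * (e.cost + 11) + 6)
                (by simp only [Expr.cost]; ring_nf; omega)
                (Q' := fun s₂ => s₂.reg r = ∑ j ∈ Finset.range n, e.evalAt s j 0 0 ∧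
                  Frame [r] [] s s₂)
                fun s₂ hs₂ => ⟨hs₂.1, by
                  have := hs₁.1.trans hs₂.2
                  exact ⟨fun q hq => this.reg q (by simpa using hq), this.arr⟩⟩
    refine h.mono ?_ ?_
    · simp only [Expr.cost, Stmt.cost]
      nlinarith [Nat.zero_le n, Nat.zero_le (offset L n * (e.cost + 20))]
    · rintro s' ⟨hv, hF⟩
      refine ⟨?_, hF⟩
      simp only [Stmt.Holds]
      rw [hv, Finset.sum_range]
      refine Finset.sum_congr rfl fun u _ => (hF.evalAt e
        (fun q hq => ⟨by simpa using (he q hq).2.2.2, (he q hq).2.1⟩) (by simp) _ _ _).symm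
  | minim r e₀ e =>
    obtain ⟨hr5, he₀, he⟩ := hok
    have hev₀ : ∀ s₁, Frame [r] [] s s₁ → e₀.eval s₁ = e₀.evalAt s 0 0 0 := fun s₁ hF =>
      hF.eval e₀ (fun q hq => ⟨by simpa using (he₀ q hq).2.2.2.2, (he₀ q hq).2.2.1⟩) (by simp)
        (fun h => absurd rfl (he₀ 1 h).1) (fun h => absurd rfl (he₀ 2 h).2.1)
        (fun h => absurd rfl (he₀ 4 h).2.2.2.1)
    have h := (Ensures.assign (s := s) (x := r) (e := e₀)
      (Q := fun s₁ => Frame [r] [] s s₁ ∧ s₁.reg r = e₀.evalAt s 0 0 0)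
      ⟨(Frame.refl _ _ s).setReg (by simp) _, by simp [hev₀ s (Frame.refl _ _ s)]⟩).seq fun s₁ hs₁ =>
        (ensures_forVertices_assign (L := L) (d := .sub (.reg r) (.sub (.reg r) e)) hr5
          (hs₁.1.hasGraph (by simp; omega) (by simp) (by simp) hs)
          (fun i y => y ≤ e₀.evalAt s 0 0 0 ∧ (∀ j : Fin n, j < i → y ≤ e.evalAt s j 0 0) ∧
            (y = e₀.evalAt s 0 0 0 ∨ ∃ j : Fin n, y = e.evalAt s j 0 0)) (by simp [hs₁.2])
          (by
            intro i s₂ hF h1 hP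
            have hFF := hs₁.1.trans hF
            have hv : e.eval s₂ = e.evalAt s i 0 0 :=
              hFF.eval e (fun q hq => ⟨by simpa using (he q hq).2.2.2, (he q hq).2.1⟩)
                (by simp) (fun _ => h1) (fun h => absurd rfl (he 2 h).1)
                fun h => absurd rfl (he 4 h).2.2.1
            simp only [Expr.eval, hv]
            obtain ⟨hP1, hP2, hP3⟩ := hP
            refine ⟨by omega, fun j hj => ?_, ?_⟩
            · rcases Nat.lt_succ_iff_lt_or_eq.1 hj with h | h
              · have := hP2 j h
                omega
              · rw [Fin.ext h]
                omega
            · rcases le_total (s₂.reg r) (e.evalAt s i 0 0) with h | h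
              · rw [Nat.sub_eq_zero_of_le h]
                exact hP3
              · exact Or.inr ⟨i, by omega⟩)).mono (T' := n * (e.cost + 13) + 6)
                (by simp only [Expr.cost]; ring_nf; omega)
                (Q' := fun s₂ => (s₂.reg r ≤ e₀.evalAt s 0 0 0 ∧
                  (∀ j : Fin n, j < n → s₂.reg r ≤ e.evalAt s j 0 0) ∧
                  (s₂.reg r = e₀.evalAt s 0 0 0 ∨ ∃ j : Fin n, s₂.reg r = e.evalAt s j 0 0)) ∧
                  Frame [r] [] s s₂)
                fun s₂ hs₂ => ⟨hs₂.1, by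
                  have := hs₁.1.trans hs₂.2
                  exact ⟨fun q hq => this.reg q (by simpa using hq), this.arr⟩⟩
    refine h.mono ?_ ?_
    · simp only [Stmt.cost]
      nlinarith [Nat.zero_le n, Nat.zero_le (offset L n * (e₀.cost + e.cost + 20)),
        Nat.zero_le (n * e₀.cost)]
    · rintro s' ⟨⟨hv1, hv2, hv3⟩, hF⟩
      refine ⟨?_, hF⟩
      have hee : ∀ u, e.evalAt s' u 0 0 = e.evalAt s u 0 0 := fun u => hF.evalAt e
        (fun q hq => ⟨by simpa using (he q hq).2.2.2, (he q hq).2.1⟩) (by simp) _ _ _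
      have hee₀ : e₀.evalAt s' 0 0 0 = e₀.evalAt s 0 0 0 := hF.evalAt e₀
        (fun q hq => ⟨by simpa using (he₀ q hq).2.2.2.2, (he₀ q hq).2.2.1⟩) (by simp) _ _ _
      simp only [Stmt.Holds, hee, hee₀]
      exact ⟨hv1, fun u => hv2 u u.2, hv3⟩
  | assign r e =>
    obtain ⟨hr5, he⟩ := hok
    have hF : Frame [r] [] s (s.setReg r (e.eval s)) := (Frame.refl _ _ s).setReg (by simp) _
    refine (Ensures.assign (Q := fun s' => (Stmt.assign r e).Holds G s' ∧ Frame [r] [] s s')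
      ⟨?_, hF⟩).mono ?_ fun _ h => h
    · simp only [Stmt.Holds]
      rw [hF.evalAt e (fun q hq => ⟨by simpa using (he q hq).2.2.2.2, (he q hq).2.2.1⟩) (by simp),
        State.setReg_self]
      exact (Frame.refl [] [] s).eval e (fun q hq => ⟨by simp, (he q hq).2.2.1⟩) (by simp)
        (fun h => absurd rfl (he 1 h).1) (fun h => absurd rfl (he 2 h).2.1)
        (fun h => absurd rfl (he 4 h).2.2.2.1)
    · exact Nat.le_mul_of_pos_right _ (by omega)

/-! ### Static single assignment -/

def seqProg : List Stmt → Prog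
  | [] => .skip
  | st :: l => .seq st.prog (seqProg l)

def seqCost (l : List Stmt) : ℕ := (l.map Stmt.cost).sum + 1

/-- Nothing that a statement reads or writes is written later. -/
def SSA : List Stmt → Prop
  | [] => True
  | st :: l => st.Ok ∧ (∀ r ∈ st.rregs ++ st.wregs, r ∉ l.flatMap Stmt.wregs) ∧
      (∀ a ∈ st.rarrs ++ st.warrs, a ∉ l.flatMap Stmt.warrs) ∧ SSA l

instance SSA.decidable : DecidablePred SSA
  | [] => .isTrue trivial
  | st :: l => by
    unfold SSA
    have := SSA.decidable l
    infer_instance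

theorem Stmt.Ok.two_le {st : Stmt} (h : st.Ok) : ∀ a ∈ st.warrs, 2 ≤ a := by
  cases st <;> simp_all [Stmt.Ok, Stmt.warrs]

theorem Stmt.Ok.five_le {st : Stmt} (h : st.Ok) : ∀ r ∈ st.wregs, 5 ≤ r := by
  cases st <;> simp_all [Stmt.Ok, Stmt.wregs]

/-- By single assignment no equation is destroyed later, so the final state satisfies all of them at
once and the order of execution can be forgotten. -/
theorem ensures_seqProg {n : ℕ} {G : SimpleGraph (Fin n)} {L : Fin n → List (Fin n)}
    (hL : IsAdjLists G L) {l : List Stmt} (hl : SSA l) {s : State} (hs : HasGraph L s) :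
    Ensures (seqProg l) s (seqCost l * (n + offset L n + 1))
      (fun s' => (∀ st ∈ l, st.Holds G s') ∧ HasGraph L s' ∧
        Frame (l.flatMap Stmt.wregs) (l.flatMap Stmt.warrs) s s') := by
  induction l generalizing s with
  | nil =>
    refine (Ensures.skip ?_).mono ?_ fun _ h => h
    · exact ⟨by simp, hs, Frame.refl _ _ _⟩
    · simp [seqCost]
  | cons st l ih =>
    obtain ⟨hok, hr, ha, hl⟩ := hl
    refine ((ensures_stmt hL hok hs).seq fun s₁ hs₁ => (ih hl (hs₁.2.hasGraph
      (fun h => by have := hok.five_le _ h; omega) (fun h => by have := hok.two_le _ h; omega)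
      (fun h => by have := hok.two_le _ h; omega) hs)).mono le_rfl
        (Q' := fun s' => (∀ st' ∈ st :: l, st'.Holds G s') ∧ HasGraph L s' ∧
        Frame ((st :: l).flatMap Stmt.wregs) ((st :: l).flatMap Stmt.warrs) s s')
        fun s' hs' => ⟨?_, hs'.2.1, ?_⟩).mono ?_ fun _ h => h
    · intro st' hst'
      rcases List.mem_cons.1 hst' with rfl | h
      · exact hs₁.1.frame hok hs'.2.2 hr ha
      · exact hs'.1 st' h
    · simpa using hs₁.2.trans hs'.2.2
    · simp only [seqCost, List.map_cons, List.sum_cons]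
      ring_nf
      omega

end RAM

/-! ### Induced patterns, the core of a vertex and its components -/

namespace WED
open RAM (nbrs mem_nbrs)

section Patterns
variable {V : Type*} {G : SimpleGraph V}

/-- The two paths are numbered 0, 1 and 3, 4, 5, 6; the gap at 2 makes adjacency the same as being
consecutive, which can be decided. -/
theorem P2P4_adj (x y : Fin 2 ⊕ Fin 4) : P2P4.Adj x y ↔
    Sum.elim (fun i : Fin 2 => i.val) (fun i : Fin 4 => i.val + 3) x + 1 =
      Sum.elim (fun i : Fin 2 => i.val) (fun i : Fin 4 => i.val + 3) y ∨
    Sum.elim (fun i : Fin 2 => i.val) (fun i : Fin 4 => i.val + 3) y + 1 =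
      Sum.elim (fun i : Fin 2 => i.val) (fun i : Fin 4 => i.val + 3) x := by
  rcases x with x | x <;> rcases y with y | y <;> simp [SimpleGraph.pathGraph_adj] <;> omega

/-- Since P₂+P₄ has no twins, a map that preserves and reflects adjacency is injective. This saves
checking that six vertices are distinct. -/
theorem P2P4_ext (x y : Fin 2 ⊕ Fin 4) (h : ∀ z, P2P4.Adj x z ↔ P2P4.Adj y z) : x = y := by
  revert x y
  simp only [P2P4_adj]
  decide

theorem not_indFree_P2P4 {a b p q r s : V} (hab : G.Adj a b) (hpq : G.Adj p q) (hqr : G.Adj q r)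
    (hrs : G.Adj r s) (hpr : ¬ G.Adj p r) (hps : ¬ G.Adj p s) (hqs : ¬ G.Adj q s)
    (h : ∀ x, x = p ∨ x = q ∨ x = r ∨ x = s → ¬ G.Adj a x ∧ ¬ G.Adj b x) :
    ¬ IndFree P2P4 G := by
  have hp := h p (by simp)
  have hq := h q (by simp)
  have hr := h r (by simp)
  have hs := h s (by simp)
  let f : Fin 2 ⊕ Fin 4 → V := Sum.elim ![a, b] ![p, q, r, s]
  have sy : ∀ {x y}, ¬ G.Adj x y → ¬ G.Adj y x := fun h k => h k.symm
  have key : ∀ x y, G.Adj (f x) (f y) ↔ P2P4.Adj x y := by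
    rintro (x | x) (y | y) <;> fin_cases x <;> fin_cases y <;>
      simp [f, SimpleGraph.pathGraph_adj, hab, hab.symm, hpq, hpq.symm, hqr, hqr.symm, hrs,
        hrs.symm, hpr, hps, hqs, sy hpr, sy hps, sy hqs, hp, hq, hr, hs,
        sy hp.1, sy hp.2, sy hq.1, sy hq.2, sy hr.1,
        sy hr.2, sy hs.1, sy hs.2]
  have inj : Function.Injective f := by
    intro x y hxy
    have h' : ∀ z, P2P4.Adj x z ↔ P2P4.Adj y z := fun z => by rw [← key, ← key, hxy]
    exact P2P4_ext x y h'
  unfold IndFree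
  rw [not_not]
  exact ⟨⟨⟨f, inj⟩, @fun x y => key x y⟩⟩

/-- P₃ is an initial segment of P₄; this transfers the algorithm to the smaller class. -/
theorem IndFree.of_P2P3 (h : IndFree P2P3 G) : IndFree P2P4 G := by
  intro ⟨e⟩
  refine h ⟨RelEmbedding.trans ⟨⟨Sum.map id Fin.castSucc, ?_⟩, ?_⟩ e⟩
  · exact Sum.map_injective.2 ⟨Function.injective_id, Fin.castSucc_injective 3⟩
  · rintro (x | x) (y | y) <;> simp [SimpleGraph.pathGraph_adj]

end Patterns

variable {V : Type*} {G : SimpleGraph V} {v : V}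

/-- `d` dominates `w`. -/
def Dom (G : SimpleGraph V) (d w : V) : Prop := d = w ∨ G.Adj d w

theorem Dom.symm {d w : V} (h : Dom G d w) : Dom G w d :=
  h.elim (fun h => .inl h.symm) fun h => .inr h.symm

/-- The vertex `v` and the vertices at distance at least three from `v`. -/
def Core (G : SimpleGraph V) (v w : V) : Prop :=
  w = v ∨ ∀ x, Dom G w x → x ≠ v ∧ ¬ G.Adj x v

theorem Core.not_adj {w : V} (h : Core G v w) : ¬ G.Adj v w := by
  rcases h with rfl | h
  · exact G.irrefl
  · exact fun k => (h w (.inl rfl)).2 k.symm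

theorem Core.not_adj_of_adj {w y : V} (h : Core G v w) (hw : w ≠ v) (hy : G.Adj v y) :
    ¬ G.Adj y w := fun k => by
  rcases h with rfl | h
  · exact hw rfl
  · exact (h y (.inr k.symm)).2 hy.symm

theorem Core.ne_of_adj {w w' : V} (h' : Core G v w') (k : G.Adj w w') : w ≠ v := by
  rintro rfl
  exact h'.not_adj k

theorem exists_of_not_core {z : V} (hz : ¬ Core G v z) (hvz : ¬ G.Adj v z) :
    ∃ y, G.Adj z y ∧ G.Adj v y := by
  unfold Core at hz
  push Not at hz
  obtain ⟨h1, x, h2, h3⟩ := hz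
  rcases h2 with rfl | h2
  · exact absurd (h3 h1).symm hvz
  · exact ⟨x, h2, (h3 fun h => hvz (h ▸ h2.symm)).symm⟩

/-- The core contains no chordless path on four vertices. -/
theorem not_indFree_of_core_path {y p q r s : V} (hy : G.Adj v y) (cp : Core G v p)
    (cq : Core G v q) (cr : Core G v r) (cs : Core G v s) (hpq : G.Adj p q) (hqr : G.Adj q r)
    (hrs : G.Adj r s) (hpr : ¬ G.Adj p r) (hps : ¬ G.Adj p s) (hqs : ¬ G.Adj q s) :
    ¬ IndFree P2P4 G := by
  refine not_indFree_P2P4 hy hpq hqr hrs hpr hps hqs ?_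
  rintro x (rfl | rfl | rfl | rfl)
  · exact ⟨cp.not_adj, cp.not_adj_of_adj (cq.ne_of_adj hpq) hy⟩
  · exact ⟨cq.not_adj, cq.not_adj_of_adj (cr.ne_of_adj hqr) hy⟩
  · exact ⟨cr.not_adj, cr.not_adj_of_adj (cs.ne_of_adj hrs) hy⟩
  · exact ⟨cs.not_adj, cs.not_adj_of_adj (cr.ne_of_adj hrs.symm) hy⟩

/-- If a vertex outside the core distinguishes two adjacent core vertices, then it has a neighbour
in every edge of the core that is anticomplete to them. -/
theorem not_indFree_of_distinguished {u u' z a b : V} (hz : ¬ Core G v z) (cu : Core G v u)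
    (cu' : Core G v u') (ca : Core G v a) (cb : Core G v b) (huu : G.Adj u u') (hzu : G.Adj z u)
    (hzu' : ¬ G.Adj z u') (hab : G.Adj a b) (h : ∀ x, x = u ∨ x = u' ∨ x = z →
      ¬ G.Adj a x ∧ ¬ G.Adj b x) : ¬ IndFree P2P4 G := by
  have hvz : ¬ G.Adj v z := fun k => cu.not_adj_of_adj (cu'.ne_of_adj huu) k hzu
  obtain ⟨y, hzy, hvy⟩ := exists_of_not_core hz hvz
  have hy : ∀ {w w'}, Core G v w → Core G v w' → G.Adj w w' → ¬ G.Adj w y := fun cw cw' k k' =>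
    cw.not_adj_of_adj (cw'.ne_of_adj k) hvy k'.symm
  -- The path is `u', u, z, y`: the vertex `z` is at distance two from `v`, and its neighbour `y` in
  -- the neighbourhood of `v` is seen by no core vertex other than `v`.
  refine not_indFree_P2P4 hab huu.symm hzu.symm hzy (fun k => hzu' k.symm) (hy cu' cu huu.symm)
    (hy cu cu' huu) ?_
  rintro x (rfl | rfl | rfl | rfl)
  · exact h x (by simp)
  · exact h x (by simp)
  · exact h x (by simp)
  · exact ⟨hy ca cb hab, hy cb ca hab.symm⟩

/-! ### Efficient dominating sets -/

theorem ed_unique {D : Finset V} (hD : IsEfficientDominating G D) {d d' w : V} (hd : d ∈ D)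
    (hd' : d' ∈ D) (h : Dom G d w) (h' : Dom G d' w) : d = d' :=
  (hD w).unique ⟨hd, h⟩ ⟨hd', h'⟩

theorem ed_exists {D : Finset V} (hD : IsEfficientDominating G D) (w : V) :
    ∃ d ∈ D, Dom G d w := by
  obtain ⟨d, ⟨h1, h2⟩, _⟩ := hD w
  exact ⟨d, h1, h2⟩

/-- A member at distance one or two from `v` would dominate some vertex together with `v`. -/
theorem ed_core {D : Finset V} (hD : IsEfficientDominating G D) (hv : v ∈ D) {d : V} (hd : d ∈ D) :
    Core G v d := by
  by_cases h : d = v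
  · exact .inl h
  · refine .inr fun x hx => ⟨?_, fun k => h (ed_unique hD hd hv hx (.inr k.symm))⟩
    rintro rfl
    exact h (ed_unique hD hd hv hx (.inl rfl))

section
variable [Fintype V]

open Classical in
/-- The number of neighbours of `u` with the property `P`. -/
noncomputable def degIn (G : SimpleGraph V) (P : V → Prop) (u : V) : ℕ :=
  ((nbrs G u).filter P).card

/-- The core vertices that have maximum degree in the core among their neighbours. -/
def Cand (G : SimpleGraph V) (v u : V) : Prop :=
  Core G v u ∧ ∀ x, G.Adj u x → Core G v x → degIn G (Core G v) x ≤ degIn G (Core G v) u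

variable [LinearOrder V]

/-- A preference between candidates: few neighbours outside the core, then small weight. -/
def Better (G : SimpleGraph V) (ω : V → ℕ) (v x u : V) : Prop :=
  degIn G (fun z => ¬ Core G v z) x < degIn G (fun z => ¬ Core G v z) u ∨
    degIn G (fun z => ¬ Core G v z) x = degIn G (fun z => ¬ Core G v z) u ∧
      (ω x < ω u ∨ ω x = ω u ∧ x < u)

/-- Outside degree comes before weight: if the outside neighbourhood of a candidate is contained in
that of the base vertex, the two must coincide, and then the base vertex is at most as heavy. The
index breaks ties. -/
def Base (G : SimpleGraph V) (ω : V → ℕ) (v u : V) : Prop :=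
  Cand G v u ∧ ∀ x, G.Adj u x → Cand G v x → ¬ Better G ω v x u

variable {ω : V → ℕ}

theorem not_better_self (u : V) : ¬ Better G ω v u u := by
  simp [Better]

theorem better_key (x u : V) : Better G ω v x u ↔
    toLex (degIn G (fun z => ¬ Core G v z) x, toLex (ω x, x)) <
      toLex (degIn G (fun z => ¬ Core G v z) u, toLex (ω u, u)) := by
  simp [Better, Prod.Lex.toLex_lt_toLex]

theorem better_total {x u : V} (h : x ≠ u) : Better G ω v x u ∨ Better G ω v u x := by
  rw [better_key, better_key]
  refine lt_or_gt_of_ne fun k => h ?_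
  simpa using congrArg (fun t => (ofLex (ofLex t).2).2) k

/-- `C` is a union of components of the graph induced by the core. -/
structure Closed (G : SimpleGraph V) (v : V) (C : Set V) : Prop where
  core : ∀ w ∈ C, Core G v w
  adj : ∀ w ∈ C, ∀ x, G.Adj w x → Core G v x → x ∈ C

/-- A dominating vertex has core degree `|C| - 1`, the largest possible in `C`, and every other
vertex of `C` is compared with it because they are adjacent. Dominating vertices are thus recognised
from degrees alone. -/
theorem Closed.cand_iff {C : Set V} (hC : Closed G v C) {d : V} (hd : d ∈ C)
    (hdom : ∀ w ∈ C, Dom G d w) {u : V} (hu : u ∈ C) : Cand G v u ↔ ∀ w ∈ C, Dom G u w := by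
  classical
  have sub : ∀ w ∈ C, (nbrs G w).filter (Core G v) ⊆ (Finset.univ.filter (· ∈ C)).erase w := by
    intro w hw x hx
    simp only [Finset.mem_filter, mem_nbrs] at hx
    simp [hC.adj w hw x hx.1 hx.2, hx.1.ne']
  have card : ∀ w ∈ C, ((Finset.univ.filter (· ∈ C)).erase w).card =
      (Finset.univ.filter (· ∈ C)).card - 1 := fun w hw =>
    Finset.card_erase_of_mem (by simp [hw])
  have full : ∀ w ∈ C, (∀ x ∈ C, Dom G w x) →
      degIn G (Core G v) w = (Finset.univ.filter (· ∈ C)).card - 1 := by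
    intro w hw h
    rw [← card w hw, degIn]
    congr 1
    refine (sub w hw).antisymm fun x hx => ?_
    simp only [Finset.mem_erase, Finset.mem_filter, Finset.mem_univ, true_and] at hx
    simp only [Finset.mem_filter, mem_nbrs]
    exact ⟨(h x hx.2).resolve_left (Ne.symm hx.1), hC.core x hx.2⟩
  constructor
  · rintro ⟨hcu, hmax⟩ w hw
    have h1 : degIn G (Core G v) d ≤ degIn G (Core G v) u := by
      rcases hdom u hu with rfl | h
      · exact le_rfl
      · exact hmax d h.symm (hC.core d hd)
    rw [full d hd hdom, ← card u hu] at h1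
    have h2 := Finset.eq_of_subset_of_card_le (sub u hu) h1
    by_cases hwu : u = w
    · exact .inl hwu
    · have h3 : w ∈ (Finset.univ.filter (· ∈ C)).erase u := by simp [hw, Ne.symm hwu]
      rw [← h2] at h3
      simp only [Finset.mem_filter, mem_nbrs] at h3
      exact .inr h3.1
  · intro h
    refine ⟨hC.core u hu, fun x hx cx => ?_⟩
    rw [full u hu h]
    have hxC := hC.adj u hu x hx cx
    rw [← card x hxC]
    exact Finset.card_le_card (sub x hxC)

/-- The candidates of `C` are pairwise adjacent, so a local optimum of the strict total preference
is the global one. -/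
theorem Closed.existsUnique_base {C : Set V} (hC : Closed G v C) {d : V} (hd : d ∈ C)
    (hdom : ∀ w ∈ C, Dom G d w) {c : V} (hc : c ∈ C) : ∃! b, Base G ω v b ∧ Dom G b c := by
  classical
  have hcand : ∀ {u}, u ∈ C → (Cand G v u ↔ ∀ w ∈ C, Dom G u w) := fun hu => hC.cand_iff hd hdom hu
  obtain ⟨b, hb, hmin⟩ := Finset.exists_min_image
    (Finset.univ.filter fun u => u ∈ C ∧ Cand G v u)
    (fun u => toLex (degIn G (fun z => ¬ Core G v z) u, toLex (ω u, u)))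
    ⟨d, by simp [hd, (hcand hd).2 hdom]⟩
  simp only [Finset.mem_filter, Finset.mem_univ, true_and] at hb hmin
  have hbest : ∀ x ∈ C, Cand G v x → ¬ Better G ω v x b := fun x hx hcx => by
    rw [better_key]
    exact not_lt.2 (hmin x ⟨hx, hcx⟩)
  refine ⟨b, ⟨⟨hb.2, fun x hx hcx => hbest x (hC.adj b hb.1 x hx hcx.1) hcx⟩,
    (hcand hb.1).1 hb.2 c hc⟩, ?_⟩
  rintro b' ⟨⟨hcb', hb'⟩, hdb'⟩
  have hbC' : b' ∈ C := hdb'.elim (fun h => h ▸ hc) fun h => hC.adj c hc b' h.symm hcb'.1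
  by_contra hne
  rcases better_total (G := G) (ω := ω) (v := v) hne with h | h
  · exact hbest b' hbC' hcb' h
  · exact hb' b (((hcand hb.1).1 hb.2 b' hbC').resolve_left (Ne.symm hne)).symm hb.2 h

/-! ### A component of the core without a dominating vertex -/

def Level1 (G : SimpleGraph V) (v c w : V) : Prop := Core G v w ∧ G.Adj c w

/-- The levels are the distance classes of `c` in the graph induced by the core. -/
def Level2 (G : SimpleGraph V) (v c w : V) : Prop :=
  Core G v w ∧ w ≠ c ∧ ¬ Level1 G v c w ∧ ∃ x, G.Adj w x ∧ Level1 G v c x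

def Level3 (G : SimpleGraph V) (v c w : V) : Prop :=
  Core G v w ∧ w ≠ c ∧ ¬ Level1 G v c w ∧ ¬ Level2 G v c w ∧ ∃ x, G.Adj w x ∧ Level2 G v c x

-- A shortest core path from `c` to a vertex at distance three is chordless.
omit [Fintype V] [LinearOrder V] in
theorem Level3.not_indFree {c w y : V} (hy : G.Adj v y) (hc : Core G v c) (h : Level3 G v c w) :
    ¬ IndFree P2P4 G := by
  obtain ⟨cw, hwc, h1, h2, x, hwx, cx, hxc, hx1, t, hxt, ct, hct⟩ := h
  refine not_indFree_of_core_path hy hc ct cx cw hct hxt.symm hwx.symm ?_ ?_ ?_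
  · exact fun k => hx1 ⟨cx, k⟩
  · exact fun k => h1 ⟨cw, k⟩
  · exact fun k => h2 ⟨cw, hwc, h1, t, k.symm, ct, hct⟩

-- The set M of level-one neighbours of `z` should be joined to the rest of the component of `c`; a
-- non-adjacent pair `m`, `w` across yields a path. If `w` is in level one, the path is `z, m, c,
-- w`. If `w` is in level two, the minimality of `z` gives a level-one vertex `a` that sees `w` but
-- not `z`, and the path is `z, m, c, a` or `w, z, m, c` or `z, m, a, w`.
omit [LinearOrder V] in
theorem not_indFree_of_not_join {c y z m w : V} (hy : G.Adj v y) (hc : Core G v c)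
    (hz : Level2 G v c z)
    (hmin : ∀ z', Level2 G v c z' → degIn G (Level1 G v c) z ≤ degIn G (Level1 G v c) z')
    (hm : Level1 G v c m) (hmz : G.Adj m z) (hw : w = c ∨ Level1 G v c w ∨ Level2 G v c w)
    (hwM : ¬ (Level1 G v c w ∧ G.Adj w z)) (hmw : ¬ G.Adj m w) : ¬ IndFree P2P4 G := by
  classical
  obtain ⟨cm, hcm⟩ := hm
  have hz' := hz
  obtain ⟨cz, hzc, hz1, -⟩ := hz
  have hcz : ¬ G.Adj c z := fun k => hz1 ⟨cz, k⟩
  have side : ∀ a, Level1 G v c a → ¬ G.Adj a z → ¬ G.Adj m a → ¬ IndFree P2P4 G :=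
    fun a ha haz hma => not_indFree_of_core_path hy cz cm hc ha.1 hmz.symm hcm.symm ha.2
      (fun k => hcz k.symm) (fun k => haz k.symm) hma
  rcases hw with rfl | hw | hw
  · exact absurd hcm.symm hmw
  · exact side w hw (fun k => hwM ⟨hw, k⟩) hmw
  · have hle := hmin w hw
    obtain ⟨cw, hwc, hw1, -⟩ := hw
    have hcw : ¬ G.Adj c w := fun k => hw1 ⟨cw, k⟩
    -- Otherwise the level-one neighbours of `w` are among those of `z` and omit `m`, so `w` has
    -- fewer of them than `z`.
    have : ∃ a, Level1 G v c a ∧ G.Adj a w ∧ ¬ G.Adj a z := by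
      by_contra hno
      push Not at hno
      have hsub : (nbrs G w).filter (Level1 G v c) ⊆
          ((nbrs G z).filter (Level1 G v c)).erase m := by
        intro a ha
        simp only [Finset.mem_filter, mem_nbrs, Finset.mem_erase] at ha ⊢
        refine ⟨?_, (hno a ha.2 ha.1.symm).symm, ha.2⟩
        rintro rfl
        exact hmw ha.1.symm
      have hmem : m ∈ (nbrs G z).filter (Level1 G v c) := by
        simp [hmz.symm, Level1, cm, hcm]
      have := Finset.card_le_card hsub
      have := Finset.card_erase_lt_of_mem hmem
      simp only [degIn] at hle
      omega
    obtain ⟨a, ha, haw, haz⟩ := this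
    by_cases hma : G.Adj m a
    · by_cases hzw : G.Adj z w
      · exact not_indFree_of_core_path hy cw cz cm hc hzw.symm hmz.symm hcm.symm
          (fun k => hmw k.symm) (fun k => hcw k.symm) fun k => hcz k.symm
      · exact not_indFree_of_core_path hy cz cm ha.1 cw hmz.symm hma haw (fun k => haz k.symm) hzw
          hmw
    · exact side a ha haz hma

/-- Levels zero to two form a closed set without a dominating vertex, so an e.d. through `v` needs
two members in it. That set is a join, and in a join any two vertices dominate a common vertex. -/
theorem not_mem_ed_of_bad {c : V} (hc : Core G v c) (hbad : ¬ ∃! b, Base G ω v b ∧ Dom G b c)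
    (h3 : ∀ w, ¬ Level3 G v c w)
    (hjoin : ∀ z, Level2 G v c z → ∃ z, Level2 G v c z ∧ ∀ m, Level1 G v c m → G.Adj m z →
      ∀ w, (w = c ∨ Level1 G v c w ∨ Level2 G v c w) → ¬ (Level1 G v c w ∧ G.Adj w z) →
        G.Adj m w)
    {D : Finset V} (hD : IsEfficientDominating G D) : v ∉ D := by
  intro hvD
  set C : Set V := {w | w = c ∨ Level1 G v c w ∨ Level2 G v c w} with hCdef
  have hcC : c ∈ C := .inl rfl
  have hC : Closed G v C := by
    constructor
    · rintro w (rfl | h | h)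
      exacts [hc, h.1, h.1]
    · rintro w hw x hwx cx
      by_cases hxc : x = c
      · exact .inl hxc
      by_cases hx1 : Level1 G v c x
      · exact .inr (.inl hx1)
      by_cases hx2 : Level2 G v c x
      · exact .inr (.inr hx2)
      exfalso
      rcases hw with rfl | h | h
      · exact hx1 ⟨cx, hwx⟩
      · exact hx2 ⟨cx, hxc, hx1, w, hwx.symm, h⟩
      · exact h3 x ⟨cx, hxc, hx1, hx2, w, hwx.symm, h⟩
  have hno : ∀ d ∈ C, ∃ w ∈ C, ¬ Dom G d w := by
    intro d hd
    by_contra h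
    push Not at h
    exact hbad (hC.existsUnique_base hd h hcC)
  have hclosed : ∀ {d w}, w ∈ C → Core G v d → Dom G d w → d ∈ C := fun {d w} hw cd h =>
    h.elim (fun h => h ▸ hw) fun h => hC.adj w hw d h.symm cd
  obtain ⟨d, hd, hdc⟩ := ed_exists hD c
  have hdC := hclosed hcC (ed_core hD hvD hd) hdc
  obtain ⟨w, hw, hdw⟩ := hno d hdC
  obtain ⟨d', hd', hdw'⟩ := ed_exists hD w
  have hdC' := hclosed hw (ed_core hD hvD hd') hdw'
  have hne : d ≠ d' := by
    rintro rfl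
    exact hdw hdw'
  obtain ⟨t, ht, hct⟩ := hno c hcC
  have hL2 : Level2 G v c t := by
    rcases ht with rfl | h | h
    · exact absurd (.inl rfl) hct
    · exact absurd (.inr h.2) hct
    · exact h
  obtain ⟨z, hz, hz'⟩ := hjoin t hL2
  obtain ⟨cz, hzc, hz1, m, hzm, hm⟩ := hz
  -- Two vertices in M share the neighbour `c`, two vertices outside M share `m`, and vertices on
  -- different sides are adjacent.
  by_cases h : Level1 G v c d ∧ G.Adj d z <;> by_cases h' : Level1 G v c d' ∧ G.Adj d' z
  · exact hne (ed_unique hD hd hd' (.inr h.1.2.symm) (.inr h'.1.2.symm))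
  · exact hne (ed_unique hD hd hd' (.inr (hz' d h.1 h.2 d' hdC' h')) (.inl rfl))
  · exact hne (ed_unique hD hd hd' (.inl rfl) (.inr (hz' d' h'.1 h'.2 d hdC h)))
  · exact hne (ed_unique hD hd hd' (.inr (hz' m hm hzm.symm d hdC h).symm)
      (.inr (hz' m hm hzm.symm d' hdC' h').symm))

end
end WED

/-! ### Selections of one candidate per component, and exchanges -/

namespace WED
open RAM (nbrs mem_nbrs)
variable {V : Type*} {G : SimpleGraph V} {v : V} [Fintype V] [LinearOrder V] {ω : V → ℕ}
  {own : V → V}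

/-- The components of the core have dominating vertices, and `own w` is the preferred one in the
component of `w`. -/
structure Split (G : SimpleGraph V) (ω : V → ℕ) (v : V) (own : V → V) : Prop where
  base : ∀ w, Core G v w → Base G ω v (own w) ∧ Dom G (own w) w
  unique : ∀ w b, Core G v w → Base G ω v b → Dom G b w → b = own w
  adj : ∀ w w', Core G v w → Core G v w' → G.Adj w w' → own w = own w'

namespace Split

theorem own_base (S : Split G ω v own) {b : V} (hb : Base G ω v b) : own b = b :=
  (S.unique b b hb.1.1 hb (.inl rfl)).symm

theorem own_own (S : Split G ω v own) {w : V} (hw : Core G v w) : own (own w) = own w :=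
  S.own_base (S.base w hw).1

theorem own_eq_of_dom (S : Split G ω v own) {u w : V} (hu : Core G v u) (hw : Core G v w)
    (h : Dom G u w) : own u = own w :=
  h.elim (fun h => h ▸ rfl) fun h => S.adj u w hu hw h

theorem cand_iff (S : Split G ω v own) {u : V} (hu : Core G v u) :
    Cand G v u ↔ ∀ w, Core G v w → own w = own u → Dom G u w := by
  have hC : Closed G v {w | Core G v w ∧ own w = own u} :=
    ⟨fun w hw => hw.1, fun w hw x hwx cx => ⟨cx, by rw [← hw.2, S.adj w x hw.1 cx hwx]⟩⟩
  rw [hC.cand_iff (d := own u) ⟨(S.base u hu).1.1.1, S.own_own hu⟩ ?_ ⟨hu, rfl⟩]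
  · simp only [Set.mem_ofPred_eq, and_imp]
  · rintro w ⟨hw, h⟩
    rw [← h]
    exact (S.base w hw).2

theorem dom_of_cand (S : Split G ω v own) {u w : V} (hu : Cand G v u) (hw : Core G v w)
    (h : own w = own u) : Dom G u w :=
  (S.cand_iff hu.1).1 hu w hw h

theorem not_better_own (S : Split G ω v own) {u : V} (hu : Cand G v u) :
    ¬ Better G ω v u (own u) := by
  have hb := (S.base u hu.1).1
  rcases (S.base u hu.1).2 with h | h
  · rw [h]
    exact not_better_self u
  · exact hb.2 u h hu

end Split

/-! ### Selections -/

/-- `D` consists of one candidate from every component of the core. -/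
structure Sel (G : SimpleGraph V) (v : V) (own : V → V) (D : Finset V) : Prop where
  cand : ∀ d ∈ D, Cand G v d
  exists_own : ∀ w, Core G v w → ∃ d ∈ D, own d = own w
  inj : ∀ d ∈ D, ∀ d' ∈ D, own d = own d' → d = d'

/-- Members in the same component would both dominate its base vertex, so there is only one. It must
dominate the whole component, since dominators of core vertices stay in their component. -/
theorem Split.sel_of_ed (S : Split G ω v own) {D : Finset V} (hD : IsEfficientDominating G D)
    (hv : v ∈ D) : Sel G v own D := by
  have core : ∀ d ∈ D, Core G v d := fun d hd => ed_core hD hv hd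
  have inj : ∀ d ∈ D, ∀ d' ∈ D, own d = own d' → d = d' := by
    intro d hd d' hd' h
    refine ed_unique hD hd hd' (S.base d (core d hd)).2.symm ?_
    rw [h]
    exact (S.base d' (core d' hd')).2.symm
  have ex : ∀ w, Core G v w → ∃ d ∈ D, own d = own w ∧ Dom G d w := by
    intro w hw
    obtain ⟨d, hd, h⟩ := ed_exists hD w
    exact ⟨d, hd, S.own_eq_of_dom (core d hd) hw h, h⟩
  refine ⟨fun d hd => (S.cand_iff (core d hd)).2 fun w hw h => ?_, fun w hw => ?_, inj⟩
  · obtain ⟨d', hd', h', h''⟩ := ex w hw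
    rwa [inj d hd d' hd' (by rw [h', h])]
  · obtain ⟨d, hd, h, _⟩ := ex w hw
    exact ⟨d, hd, h⟩

omit [LinearOrder V] in
theorem degIn_eq_one {P : V → Prop} {z : V} : degIn G P z = 1 ↔ ∃! d, G.Adj z d ∧ P d := by
  classical
  unfold degIn
  rw [Finset.card_eq_one]
  constructor
  · rintro ⟨d, hd⟩
    have h : ∀ x, x ∈ (nbrs G z).filter P ↔ x = d := by simp [hd]
    simp only [Finset.mem_filter, mem_nbrs] at h
    exact ⟨d, (h d).2 rfl, fun x hx => (h x).1 hx⟩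
  · rintro ⟨d, hd, hu⟩
    refine ⟨d, ?_⟩
    ext x
    simp only [Finset.mem_filter, mem_nbrs, Finset.mem_singleton]
    exact ⟨hu x, fun h => h ▸ hd⟩

/-- A selection dominates each core vertex exactly once by construction; only the vertices outside
the core impose conditions. -/
theorem Split.ed_iff (S : Split G ω v own) {D : Finset V} (hD : Sel G v own D) :
    IsEfficientDominating G D ↔ ∀ z, ¬ Core G v z → degIn G (· ∈ D) z = 1 := by
  constructor
  · intro h z hz
    obtain ⟨d, ⟨hd, hdz⟩, hu⟩ := h z
    have hne : ∀ x ∈ D, x ≠ z := fun x hx h => hz (h ▸ (hD.cand x hx).1)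
    rw [degIn_eq_one]
    exact ⟨d, ⟨(hdz.resolve_left (hne d hd)).symm, hd⟩, fun x hx => hu x ⟨hx.2, .inr hx.1.symm⟩⟩
  · intro h w
    by_cases hw : Core G v w
    · obtain ⟨d, hd, hdw⟩ := hD.exists_own w hw
      refine ⟨d, ⟨hd, S.dom_of_cand (hD.cand d hd) hw hdw.symm⟩, fun x hx => ?_⟩
      exact hD.inj x hx.1 d hd ((S.own_eq_of_dom (hD.cand x hx.1).1 hw hx.2).trans hdw.symm)
    · obtain ⟨d, hd, hu⟩ := degIn_eq_one.1 (h w hw)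
      refine ⟨d, ⟨hd.2, .inr hd.1.symm⟩, fun x hx => hu x ⟨?_, hx.1⟩⟩
      exact (hx.2.resolve_left fun h => hw (h ▸ (hD.cand x hx.1).1)).symm

/-- The selection that arises from `N` by choosing `u` in its component. -/
def exchange (N : Finset V) (β : V → V) (u : V) : Finset V := insert u (N.erase (β u))

section exchange
variable {N : Finset V} {β : V → V}

theorem Sel.exchange (hN : Sel G v own N)
    (hβ : ∀ w, Core G v w → β w ∈ N ∧ own (β w) = own w) {u : V} (hu : Cand G v u) :
    Sel G v own (exchange N β u) := by
  unfold WED.exchange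
  have key : ∀ d ∈ N, d ≠ β u → own d ≠ own u := fun d hd h k =>
    h (hN.inj d hd _ (hβ u hu.1).1 (by rw [k, (hβ u hu.1).2]))
  refine ⟨?_, ?_, ?_⟩
  · intro d hd
    rcases Finset.mem_insert.1 hd with rfl | h
    · exact hu
    · exact hN.cand d (Finset.mem_of_mem_erase h)
  · intro w hw
    by_cases h : own u = own w
    · exact ⟨u, by simp, h⟩
    · refine ⟨β w, ?_, (hβ w hw).2⟩
      refine Finset.mem_insert_of_mem (Finset.mem_erase.2 ⟨fun k => h ?_, (hβ w hw).1⟩)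
      rw [← (hβ w hw).2, k, (hβ u hu.1).2]
  · intro d hd d' hd' h
    simp only [Finset.mem_insert, Finset.mem_erase] at hd hd'
    rcases hd with rfl | hd <;> rcases hd' with rfl | hd'
    · rfl
    · exact absurd h.symm (key d' hd'.2 hd'.1)
    · exact absurd h (key d hd.2 hd.1)
    · exact hN.inj d hd.2 d' hd'.2 h

/-- Written additively, so that no subtraction occurs and `u = β u` needs no special case. It serves
both for weights and for numbers of chosen neighbours. -/
theorem Sel.sum_exchange (hN : Sel G v own N)
    (hβ : ∀ w, Core G v w → β w ∈ N ∧ own (β w) = own w) {u : V} (hu : Cand G v u) (f : V → ℕ) :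
    ∑ x ∈ WED.exchange N β u, f x + f (β u) = ∑ x ∈ N, f x + f u := by
  unfold WED.exchange
  rw [Finset.sum_insert, ← Finset.sum_erase_add N f (hβ u hu.1).1]
  · omega
  · intro h
    rw [Finset.mem_erase] at h
    exact h.1 (hN.inj u h.2 _ (hβ u hu.1).1 (hβ u hu.1).2.symm)

open Classical in
omit [LinearOrder V] in
theorem degIn_mem (D : Finset V) (z : V) :
    degIn G (· ∈ D) z = ∑ d ∈ D, if G.Adj z d then 1 else 0 := by
  rw [Finset.sum_boole, degIn, Nat.cast_id]
  congr 1
  ext x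
  simp [and_comm]

open Classical in
omit [LinearOrder V] in
theorem degIn_eq_sum (P : V → Prop) (u : V) :
    degIn G P u = ∑ z, if P z then (if G.Adj u z then 1 else 0) else 0 := by
  rw [degIn, Finset.card_filter, nbrs, Finset.sum_filter]
  refine Finset.sum_congr rfl fun z _ => ?_
  split_ifs <;> rfl

open Classical in
/-- Counting form of the condition that an exchange gives an efficient dominating set. -/
theorem Split.ed_exchange_iff (S : Split G ω v own) (hN : Sel G v own N)
    (hβ : ∀ w, Core G v w → β w ∈ N ∧ own (β w) = own w) {u : V} (hu : Cand G v u) :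
    IsEfficientDominating G (exchange N β u) ↔
      (∀ z, G.Adj u z → ¬ Core G v z →
        degIn G (· ∈ N) z = if G.Adj (β u) z then 1 else 0) ∧
      (Finset.univ.filter fun z => ¬ Core G v z ∧ degIn G (· ∈ N) z = 1).card +
        degIn G (fun z => ¬ Core G v z ∧ degIn G (· ∈ N) z = 2) (β u) +
        degIn G (fun z => ¬ Core G v z) u =
      (Finset.univ.filter fun z => ¬ Core G v z).card +
        degIn G (fun z => ¬ Core G v z ∧ degIn G (· ∈ N) z = 1) (β u) := by
  rw [S.ed_iff (hN.exchange hβ hu)]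
  have hcount : ∀ z, degIn G (· ∈ exchange N β u) z + (if G.Adj (β u) z then 1 else 0) =
      degIn G (· ∈ N) z + if G.Adj u z then 1 else 0 := by
    intro z
    rw [degIn_mem, degIn_mem, G.adj_comm (β u), G.adj_comm u]
    exact hN.sum_exchange hβ hu _
  have hle : ∀ z, (if G.Adj (β u) z then 1 else 0) ≤ degIn G (· ∈ N) z := by
    intro z
    rw [degIn_mem, G.adj_comm (β u)]
    exact Finset.single_le_sum (f := fun d => if G.Adj z d then 1 else 0) (fun _ _ => by simp)
      (hβ u hu.1).1
  generalize degIn G (· ∈ exchange N β u) = c' at *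
  generalize degIn G (· ∈ N) = c at *
  have step : ∀ (h : ∀ z, G.Adj u z → ¬ Core G v z → c z = if G.Adj (β u) z then 1 else 0),
      ((∀ z, ¬ Core G v z → c' z = 1) ↔
      (Finset.univ.filter fun z => ¬ Core G v z ∧ c z = 1).card +
        degIn G (fun z => ¬ Core G v z ∧ c z = 2) (β u) + degIn G (fun z => ¬ Core G v z) u =
      (Finset.univ.filter fun z => ¬ Core G v z).card +
        degIn G (fun z => ¬ Core G v z ∧ c z = 1) (β u)) := by
    intro h
    simp only [Finset.card_filter, degIn_eq_sum, ← Finset.sum_add_distrib]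
    -- Given the condition at the neighbours of `u`, each `z` contributes at most as much on the
    -- left as on the right, with equality for `z` outside the core exactly when `z` has one chosen
    -- neighbour after the exchange. Equality of the sums thus expresses all conditions at once.
    rw [Finset.sum_eq_sum_iff_of_le]
    · refine ⟨fun k z _ => ?_, fun k z hz => ?_⟩
      · have h1 := hcount z
        have h2 := hle z
        have h3 := h z
        by_cases hz : Core G v z
        · simp [hz]
        · have h4 := k z hz
          simp only [hz, not_false_eq_true, true_and] at *
          split_ifs at * <;> simp_all
      · have h1 := hcount z
        have h2 := hle z
        have h3 := h z
        have h4 := k z (Finset.mem_univ z)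
        simp only [hz, not_false_eq_true, true_and] at *
        split_ifs at * <;> simp_all
    · intro z _
      have h2 := hle z
      have h3 := h z
      by_cases hz : Core G v z
      · simp [hz]
      · simp only [hz, not_false_eq_true, true_and] at *
        split_ifs at * <;> simp_all
  constructor
  · intro h
    have h' : ∀ z, G.Adj u z → ¬ Core G v z → c z = if G.Adj (β u) z then 1 else 0 := by
      intro z hz hcz
      have h1 := hcount z
      rw [h z hcz, if_pos hz] at h1
      omega
    exact ⟨h', (step h').1 h⟩
  · rintro ⟨h', h⟩
    exact (step h').2 h

/-- A selection that is at least as good as `N` outside one component is improved by an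
exchange. -/
theorem Split.exchange_le (S : Split G ω v own) (hN : Sel G v own N)
    (hβ : ∀ w, Core G v w → β w ∈ N ∧ own (β w) = own w) {D : Finset V}
    (hD : IsEfficientDominating G D) (hDs : Sel G v own D) {u : V} (hu : u ∈ D)
    (h : ∀ d ∈ D, d ≠ u → (∀ z, ¬ Core G v z → (G.Adj z d ↔ G.Adj z (β d))) ∧ ω (β d) ≤ ω d) :
    IsEfficientDominating G (exchange N β u) ∧ ∑ x ∈ exchange N β u, ω x ≤ ∑ x ∈ D, ω x := by
  classical
  have hcu := hDs.cand u hu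
  have hcore : ∀ d ∈ D, Core G v d := fun d hd => (hDs.cand d hd).1
  have key : ∀ f : V → ℕ, ∑ x ∈ exchange N β u, f x = ∑ d ∈ D.erase u, f (β d) + f u := by
    intro f
    have h1 := hN.sum_exchange hβ hcu f
    rw [← Finset.sum_erase_add N f (hβ u hcu.1).1] at h1
    -- Both sets are selections, so `β` matches their members component by component.
    have h2 : ∑ d ∈ D.erase u, f (β d) = ∑ x ∈ N.erase (β u), f x := by
      refine Finset.sum_nbij β ?_ ?_ ?_ fun _ _ => rfl
      · intro d hd
        rw [Finset.mem_erase] at hd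
        refine Finset.mem_erase.2 ⟨fun k => hd.1 (hDs.inj d hd.2 u hu ?_), (hβ d (hcore d hd.2)).1⟩
        rw [← (hβ d (hcore d hd.2)).2, k, (hβ u hcu.1).2]
      · intro d hd d' hd' k
        simp only [Finset.coe_erase, Set.mem_sdiff, Finset.mem_coe] at hd hd'
        refine hDs.inj d hd.1 d' hd'.1 ?_
        rw [← (hβ d (hcore d hd.1)).2, k, (hβ d' (hcore d' hd'.1)).2]
      · intro x hx
        simp only [Finset.coe_erase, Set.mem_sdiff, Finset.mem_coe, Set.mem_singleton_iff] at hx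
        obtain ⟨d, hd, hdx⟩ := hDs.exists_own x (hN.cand x hx.1).1
        have hb : β d = x := hN.inj _ (hβ d (hcore d hd)).1 x hx.1
          ((hβ d (hcore d hd)).2.trans hdx)
        refine ⟨d, ?_, hb⟩
        simp only [Finset.coe_erase, Set.mem_sdiff, Finset.mem_coe, Set.mem_singleton_iff]
        exact ⟨hd, fun k => hx.2 (by rw [← hb, k])⟩
    omega
  constructor
  · rw [S.ed_iff (hN.exchange hβ hcu)]
    rw [S.ed_iff hDs] at hD
    intro z hz
    have hDz := hD z hz
    rw [degIn_mem, ← Finset.sum_erase_add D _ hu] at hDz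
    rw [degIn_mem, key]
    refine Eq.trans ?_ hDz
    congr 1
    refine Finset.sum_congr rfl fun d hd => ?_
    rw [Finset.mem_erase] at hd
    simp only [(h d hd.2 hd.1).1 z hz]
  · rw [key, ← Finset.sum_erase_add D _ hu]
    refine Nat.add_le_add_right (Finset.sum_le_sum fun d hd => ?_) _
    rw [Finset.mem_erase] at hd
    exact (h d hd.2 hd.1).2

end exchange

/-! ### Vertices that distinguish candidates -/

/-- `z` distinguishes candidates of one component and misses a candidate of another component
with several candidates. -/
def Mixed (G : SimpleGraph V) (v : V) (own : V → V) (z : V) : Prop :=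
  ∃ x, G.Adj z x ∧ Cand G v x ∧ ¬ G.Adj z (own x) ∧ ∃ y y', Cand G v y ∧ Cand G v y' ∧ y ≠ y' ∧
    own y = own y' ∧ own y ≠ own x ∧ ¬ G.Adj z y

theorem Split.not_indFree_of_mixed (S : Split G ω v own) {z x₁ x₂ : V}
    (hz : ¬ Core G v z) (hm : Mixed G v own z) (h1 : Cand G v x₁) (h2 : Cand G v x₂)
    (hne : x₁ ≠ x₂) (h12 : own x₁ = own x₂) (hz1 : ¬ G.Adj z x₁) (hz2 : ¬ G.Adj z x₂) :
    ¬ IndFree P2P4 G := by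
  obtain ⟨x, hzx, hx, hzo, y, y', hy, hy', hyy, hoy, hyx, hzy⟩ := hm
  have adj : ∀ {p q}, Cand G v p → Cand G v q → p ≠ q → own p = own q → G.Adj p q :=
    fun hp hq h k => (S.dom_of_cand hp hq.1 k.symm).resolve_left h
  have nadj : ∀ {p q}, Core G v p → Core G v q → own p ≠ own q → ¬ G.Adj p q :=
    fun hp hq h k => h (S.adj _ _ hp hq k)
  have main : ∀ {p p' a b}, Cand G v p → Cand G v p' → G.Adj z p → ¬ G.Adj z p' →
      own p = own p' → Cand G v a → Cand G v b → a ≠ b → own a = own b → ¬ G.Adj z a →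
      ¬ G.Adj z b → own a ≠ own p → ¬ IndFree P2P4 G := by
    intro p p' a b hp hp' hzp hzp' hpp ha hb hab hoab hza hzb hap
    have hne : p ≠ p' := by
      rintro rfl
      exact hzp' hzp
    refine not_indFree_of_distinguished hz hp.1 hp'.1 ha.1 hb.1 (adj hp hp' hne hpp) hzp hzp'
      (adj ha hb hab hoab) ?_
    rintro w (rfl | rfl | rfl)
    · exact ⟨nadj ha.1 hp.1 hap, nadj hb.1 hp.1 (hoab ▸ hap)⟩
    · exact ⟨nadj ha.1 hp'.1 (hpp ▸ hap), nadj hb.1 hp'.1 (hpp ▸ hoab ▸ hap)⟩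
    · exact ⟨fun k => hza k.symm, fun k => hzb k.symm⟩
  have hox : Cand G v (own x) := (S.base x hx.1).1.1
  have hoox : own x = own (own x) := (S.own_own hx.1).symm
  -- Main case: `z` distinguishes `x` from `own x`, and `x₁x₂` is a missed edge in another
  -- component. If the components agree, the component of `y` supplies either the missed edge `yy'`
  -- or the distinguished pair `y', y`.
  by_cases h : own x₁ = own x
  · by_cases hzy' : G.Adj z y'
    · exact main hy' hy hzy' hzy hoy.symm h1 h2 hne h12 hz1 hz2 (by rw [h, ← hoy]; exact hyx.symm)
    · exact main hx hox hzx hzo hoox hy hy' hyy hoy hzy hzy' hyx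
  · exact main hx hox hzx hzo hoox h1 h2 hne h12 hz1 hz2 h

/-- The selection that consists of the vertices with the property `M`, and of the preferred vertex
in each component without such a vertex. -/
def overrideBase (G : SimpleGraph V) (ω : V → ℕ) (v : V) (own : V → V) (M : V → Prop) (u : V) :
    Prop :=
  M u ∨ Base G ω v u ∧ ∀ x, M x → own x ≠ own u

theorem Split.sel_override (S : Split G ω v own) {M : V → Prop} (hM : ∀ x, M x → Cand G v x)
    (h1 : ∀ x x', M x → M x' → own x = own x' → x = x') {N : Finset V}
    (hN : ∀ x, x ∈ N ↔ overrideBase G ω v own M x) : Sel G v own N := by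
  refine ⟨?_, ?_, ?_⟩
  · intro d hd
    rcases (hN d).1 hd with h | h
    · exact hM d h
    · exact h.1.1
  · intro w hw
    by_cases h : ∃ x, M x ∧ own x = own w
    · obtain ⟨x, hx, hxw⟩ := h
      exact ⟨x, (hN x).2 (.inl hx), hxw⟩
    · push Not at h
      refine ⟨own w, (hN _).2 (.inr ⟨(S.base w hw).1, ?_⟩), S.own_own hw⟩
      rwa [S.own_own hw]
  · intro d hd d' hd' h
    rcases (hN d).1 hd with k | k <;> rcases (hN d').1 hd' with k' | k'
    · exact h1 d d' k k' h
    · exact absurd h (k'.2 d k)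
    · exact absurd h.symm (k.2 d' k')
    · rw [← S.own_base k.1, h, S.own_base k'.1]

theorem Split.exists_exchange_of_mixed (S : Split G ω v own) {z : V}
    {M : V → Prop} (hM : ∀ x, M x ↔ Cand G v x ∧ ¬ G.Adj z x)
    (h1 : ∀ x x', M x → M x' → own x = own x' → x = x') {N : Finset V}
    (hN : ∀ x, x ∈ N ↔ overrideBase G ω v own M x) {β : V → V}
    (hβ : ∀ w, Core G v w → β w ∈ N ∧ own (β w) = own w) {D : Finset V}
    (hD : IsEfficientDominating G D) (hv : v ∈ D) :
    ∃ u, Cand G v u ∧ IsEfficientDominating G (exchange N β u) ∧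
      ∑ x ∈ exchange N β u, ω x ≤ ∑ x ∈ D, ω x := by
  have hDs := S.sel_of_ed hD hv
  have hNs := S.sel_override (fun x hx => ((hM x).1 hx).1) h1 hN
  obtain ⟨u, hu, huz⟩ := ed_exists hD z
  refine ⟨u, hDs.cand u hu, S.exchange_le hNs hβ hD hDs hu fun d hd hdu => ?_⟩
  -- Only `u` dominates `z`, so `z` misses every other member of `D`; the one missed candidate in
  -- that component is already in `N`.
  have hd' : M d := (hM d).2 ⟨hDs.cand d hd, fun k => hdu (ed_unique hD hd hu (.inr k.symm) huz)⟩
  have hb := hβ d (hDs.cand d hd).1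
  have : β d = d := hNs.inj _ hb.1 d ((hN d).2 (.inl hd')) hb.2
  simp [this]

/-- Call a member of `D` special if some outside vertex sees it but not its base vertex. Two special
members would make a vertex mixed, so at most one is special and is kept; all the others can be
replaced by base vertices. -/
theorem Split.exists_exchange_of_not_mixed (S : Split G ω v own)
    (hm : ∀ z, ¬ Core G v z → ¬ Mixed G v own z) {N : Finset V}
    (hN : ∀ x, x ∈ N ↔ Base G ω v x) {β : V → V}
    (hβ : ∀ w, Core G v w → β w ∈ N ∧ own (β w) = own w) {D : Finset V}
    (hD : IsEfficientDominating G D) (hv : v ∈ D) :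
    ∃ u, Cand G v u ∧ IsEfficientDominating G (exchange N β u) ∧
      ∑ x ∈ exchange N β u, ω x ≤ ∑ x ∈ D, ω x := by
  classical
  have hDs := S.sel_of_ed hD hv
  have hNs := S.sel_override (M := fun _ => False) (N := N) (by simp) (by simp)
    (by simp [overrideBase, hN])
  have hβ' : ∀ w, Core G v w → β w = own w := fun w hw => by
    rw [← (hβ w hw).2, S.own_base ((hN _).1 (hβ w hw).1)]
  have alt : ∀ d ∈ D, ((∀ z, ¬ Core G v z → (G.Adj z d ↔ G.Adj z (own d))) ∧ ω (own d) ≤ ω d) ∨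
      ∃ z, ¬ Core G v z ∧ G.Adj z d ∧ ¬ G.Adj z (own d) := by
    intro d hd
    by_cases h : ∃ z, ¬ Core G v z ∧ G.Adj z d ∧ ¬ G.Adj z (own d)
    · exact .inr h
    · push Not at h
      left
      have hnb := S.not_better_own (hDs.cand d hd)
      unfold Better at hnb
      have hsub : (nbrs G d).filter (fun z => ¬ Core G v z) ⊆
          (nbrs G (own d)).filter (fun z => ¬ Core G v z) := by
        intro z hz
        simp only [Finset.mem_filter, mem_nbrs] at hz ⊢
        exact ⟨(h z hz.2 hz.1.symm).symm, hz.2⟩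
      have hle : degIn G (fun z => ¬ Core G v z) (own d) ≤ degIn G (fun z => ¬ Core G v z) d := by
        by_contra k
        exact hnb (.inl (by omega))
      -- The base vertex has the least outside degree, so the inclusion of outside neighbourhoods is
      -- an equality; preference then compares weights.
      have heq := Finset.eq_of_subset_of_card_le hsub (by unfold degIn at hle; convert hle)
      refine ⟨fun z hz => ⟨h z hz, fun k => ?_⟩, ?_⟩
      · have : z ∈ (nbrs G (own d)).filter (fun z => ¬ Core G v z) := by
          simp [k.symm, hz]
        rw [← heq] at this
        simp only [Finset.mem_filter, mem_nbrs] at this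
        exact this.1.symm
      · by_contra k
        refine hnb (.inr ⟨?_, .inl (by omega)⟩)
        unfold degIn
        convert congrArg Finset.card heq
  have one : ∀ d ∈ D, ∀ d' ∈ D, d ≠ d' →
      (∃ z, ¬ Core G v z ∧ G.Adj z d ∧ ¬ G.Adj z (own d)) →
      (∃ z, ¬ Core G v z ∧ G.Adj z d' ∧ ¬ G.Adj z (own d')) → False := by
    -- The vertex `z` sees `d` and hence misses `d'`, whose component has the second candidate `own
    -- d'`; so `z` is mixed.
    rintro d hd d' hd' hne ⟨z, hz, hzd, hzo⟩ ⟨z', hz', hzd', hzo'⟩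
    have hc' := hDs.cand d' hd'
    refine hm z hz ⟨d, hzd, hDs.cand d hd, hzo, d', own d', hc', (S.base d' hc'.1).1.1, ?_,
      (S.own_own hc'.1).symm, fun k => hne (hDs.inj d' hd' d hd k).symm, fun k =>
        hne (ed_unique hD hd hd' (.inr hzd.symm) (.inr k.symm))⟩
    intro k
    rw [← k] at hzo'
    exact hzo' hzd'
  by_cases hex : ∃ u ∈ D, ∃ z, ¬ Core G v z ∧ G.Adj z u ∧ ¬ G.Adj z (own u)
  · obtain ⟨u, hu, hzu⟩ := hex
    refine ⟨u, hDs.cand u hu, S.exchange_le hNs hβ hD hDs hu fun d hd hdu => ?_⟩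
    rw [hβ' d (hDs.cand d hd).1]
    exact (alt d hd).resolve_right fun k => one d hd u hu hdu k hzu
  -- With no special member, any member may play the role of `u`; `v` is at hand.
  · refine ⟨v, hDs.cand v hv, S.exchange_le hNs hβ hD hDs hv fun d hd hdu => ?_⟩
    rw [hβ' d (hDs.cand d hd).1]
    exact (alt d hd).resolve_right fun k => hex ⟨d, hd, k⟩

end WED

namespace WED
open RAM (nbrs mem_nbrs Expr Stmt Prog State)

/-! ### Boolean expressions -/

/-- The truth value of `P` as a number. -/
noncomputable def ind (P : Prop) : ℕ := open Classical in if P then 1 else 0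

@[simp] theorem ind_eq_zero {P : Prop} : ind P = 0 ↔ ¬ P := by
  unfold ind
  split_ifs <;> simp_all

@[simp] theorem ind_eq_one {P : Prop} : ind P = 1 ↔ P := by
  unfold ind
  split_ifs <;> simp_all

theorem ind_congr {P Q : Prop} (h : P ↔ Q) : ind P = ind Q := by rw [propext h]

/-- Truncated subtraction makes `1 - e` the truth value of `e = 0`; applied twice, it turns any
nonzero value into 1. -/
def eNot (e : Expr) : Expr := .sub (.const 1) e
def eOr (e f : Expr) : Expr := eNot (eNot (.add e f))
def eAnd (e f : Expr) : Expr := eNot (.add (eNot e) (eNot f))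
def eEq (e f : Expr) : Expr := eNot (.add (.sub e f) (.sub f e))
def eLt (e f : Expr) : Expr := eNot (eNot (.sub f e))

section
variable (s : State) (u x acc : ℕ) (e f : Expr)

@[simp] theorem evalAt_eNot : (eNot e).evalAt s u x acc = ind (e.evalAt s u x acc = 0) := by
  simp only [eNot, Expr.evalAt, ind]
  split_ifs <;> omega

@[simp] theorem evalAt_eOr : (eOr e f).evalAt s u x acc =
    ind (e.evalAt s u x acc ≠ 0 ∨ f.evalAt s u x acc ≠ 0) := by
  simp only [eOr, evalAt_eNot, Expr.evalAt, ind_eq_zero]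
  exact ind_congr (by omega)

@[simp] theorem evalAt_eAnd : (eAnd e f).evalAt s u x acc =
    ind (e.evalAt s u x acc ≠ 0 ∧ f.evalAt s u x acc ≠ 0) := by
  simp only [eAnd, evalAt_eNot, Expr.evalAt, Nat.add_eq_zero_iff, ind_eq_zero]

@[simp] theorem evalAt_eEq : (eEq e f).evalAt s u x acc =
    ind (e.evalAt s u x acc = f.evalAt s u x acc) := by
  simp only [eEq, evalAt_eNot, Expr.evalAt]
  exact ind_congr (by omega)

@[simp] theorem evalAt_eLt : (eLt e f).evalAt s u x acc =
    ind (e.evalAt s u x acc < f.evalAt s u x acc) := by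
  simp only [eLt, evalAt_eNot, Expr.evalAt, ind_eq_zero]
  exact ind_congr (by omega)

end

/-- The current vertex of a loop. -/
abbrev eU : Expr := .reg 1
/-- The current neighbour of the current vertex. -/
abbrev eX : Expr := .reg 2
/-- The sum over the neighbours of the current vertex. -/
abbrev eS : Expr := .reg 4
/-- The entry of the array `a` for the current vertex. -/
abbrev atU (a : ℕ) : Expr := .load a eU
/-- The entry of the array `a` for the current neighbour. -/
abbrev atX (a : ℕ) : Expr := .load a eX

/-! ### The computation for a given vertex

Register `0` contains the number of vertices, register `5` the given vertex `v`, register `7` a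
number that exceeds all weights of vertex sets; array `2` contains the weights, array `4` the
adjacency matrix, array `5` the positions of its rows. -/

def stBall : Stmt := .gather 10 (eEq eX (.reg 5)) (eOr (eEq eU (.reg 5)) eS) (.const 1) (.const 0)
def stCore : Stmt := .gather 11 (atX 10) (eOr (eEq eU (.reg 5)) (eNot (.add eS (atU 10))))
  (.const 1) (.const 0)
def stDegCore : Stmt := .gather 12 (atX 11) (.const 1) eS eS
def stDegOut : Stmt := .gather 13 (eNot (atX 11)) (.const 1) eS eS
def stCand : Stmt := .gather 14 (eAnd (atX 11) (eLt (atU 12) (atX 12))) (eAnd (atU 11) (eNot eS))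
  (.const 1) (.const 0)
def eBetter : Expr := eOr (eLt (atX 13) (atU 13)) (eAnd (eEq (atX 13) (atU 13))
  (eOr (eLt (atX 2) (atU 2)) (eAnd (eEq (atX 2) (atU 2)) (eLt eX eU))))
def stBase : Stmt := .gather 15 (eAnd (atX 14) eBetter) (eAnd (atU 14) (eNot eS))
  (.const 1) (.const 0)
def stBaseIdx : Stmt := .gather 16 (.const 0) (atU 15) eU (.const 0)
-- The sum of base indices over a closed neighbourhood. It is the index of the base vertex when
-- exactly one base vertex dominates the current vertex, which is the only case in which it is used.
def stOwn : Stmt := .gather 17 (atX 16) (.const 1) (.add (atU 16) eS) (.const 0)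
def stBad : Stmt := .gather 18 (atX 15) (eAnd (atU 11) (eNot (eEq (.add (atU 15) eS) (.const 1))))
  eU (.reg 0)
def stBadMin : Stmt := .minim 20 (.reg 0) (atU 18)
-- The block has no branches, so conditions such as `reg 20 ≥ n` (no bad vertex exists) are built
-- into the tests.
def stMismatch : Stmt := .gather 19
  (eAnd (eAnd (atU 11) (atX 11)) (eNot (eEq (atU 17) (atX 17))))
  (eAnd eS (eNot (eLt (.reg 20) (.reg 0)))) (.const 1) (.const 0)
def stMismatches : Stmt := .total 34 (atU 19)

def stLevel1 : Stmt := .gather 21 (eEq eX (.reg 20)) (eAnd (atU 11) eS) (.const 1) (.const 0)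
def stLevel2 : Stmt := .gather 22 (atX 21)
  (eAnd (eAnd (atU 11) (eNot (eEq eU (.reg 20)))) (eAnd (eNot (atU 21)) eS)) (.const 1) (.const 0)
def stLevel3 : Stmt := .gather 23 (atX 22)
  (eAnd (eAnd (atU 11) (eNot (eEq eU (.reg 20)))) (eAnd (eNot (atU 21)) (eAnd (eNot (atU 22)) eS)))
  (.const 1) (.const 0)
-- The default `n + 1` exceeds every degree, so vertices outside level two never attain the minimum
-- when level two is non-empty.
def stCommon : Stmt := .gather 24 (atX 21) (atU 22) eS (.add (.reg 0) (.const 1))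
def stCommonMin : Stmt := .minim 21 (.add (.reg 0) (.const 1)) (atU 24)
def stLow : Stmt := .gather 25 (.const 0) (eAnd (atU 22) (eEq (atU 24) (.reg 21))) eU (.reg 0)
def stLowMin : Stmt := .minim 22 (.reg 0) (atU 25)
def stJoin : Stmt := .gather 26 (eEq eX (.reg 22)) (eAnd (atU 21) eS) (.const 1) (.const 0)
def stRest : Stmt := .gather 27 (.const 0)
  (eAnd (eOr (eEq eU (.reg 20)) (eOr (atU 21) (atU 22))) (eNot (atU 26))) (.const 1) (.const 0)
def stRestSize : Stmt := .total 23 (atU 27)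
-- A vertex is joined to the rest exactly when its number of neighbours there is the size of the
-- rest.
def stNoJoin : Stmt := .gather 28 (atX 27) (eAnd (atU 26) (eLt eS (.reg 23))) (.const 1) (.const 0)
def stFlag1 : Stmt := .total 24 (.add (atU 23) (atU 28))

def stSize : Stmt := .gather 29 (atX 14) (.const 1) (.add (atU 14) eS) (.const 0)
def stBaseSize : Stmt := .gather 30 (.const 0) (atU 15) (atU 29) (.const 0)
def stBig : Stmt := .gather 31 (.const 0) (eAnd (atU 15) (eLt (.const 1) (atU 29)))
  (.const 1) (.const 0)
def stBigs : Stmt := .total 25 (atU 31)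
-- The adjacency matrix is needed here: `own x` need not be a neighbour of the current vertex, yet
-- adjacency to it must be tested in constant time.
def stMissBase : Stmt := .gather 32
  (eAnd (atX 14) (eNot (.load 4 (.add (atU 5) (atX 17))))) (.const 1) eS eS
def stCandNbrs : Stmt := .gather 33 (atX 14) (.const 1) eS eS
def stBaseSizes : Stmt := .gather 34 (atX 30) (.const 1) eS eS
def stBigNbrs : Stmt := .gather 35 (atX 31) (.const 1) eS eS
def stMixed : Stmt := .gather 36 (.const 0) (eAnd (eNot (atU 11)) (eAnd (atU 32)
  (eOr (eLt (.add (atU 35) (.const 1)) (.reg 25)) (eLt (atU 33) (.add (atU 34) (atU 32))))))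
  eU (.reg 0)
def stMixedMin : Stmt := .minim 26 (.reg 0) (atU 36)
def stMiss : Stmt := .gather 37 (eEq eX (.reg 26))
  (eAnd (atU 14) (eAnd (eLt (.reg 26) (.reg 0)) (eNot eS))) (.const 1) (.const 0)
def stMisses : Stmt := .gather 38 (atX 37) (.const 1) (.add (atU 37) eS) (.const 0)
def stFlag2 : Stmt := .total 27 (eAnd (eNot (eLt (.reg 20) (.reg 0)))
  (eAnd (atU 14) (eLt (.const 1) (atU 38))))
def stSel : Stmt := .gather 39 (.const 0) (atU 38) (atU 37) (atU 15)
def stSelIdx : Stmt := .gather 40 (.const 0) (atU 39) eU (.const 0)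
def stSelOwn : Stmt := .gather 41 (atX 40) (.const 1) (.add (atU 40) eS) (.const 0)
def stCount : Stmt := .gather 42 (atX 39) (.const 1) eS eS
def stOnce : Stmt := .gather 43 (.const 0) (eAnd (eNot (atU 11)) (eEq (atU 42) (.const 1)))
  (.const 1) (.const 0)
def stOnces : Stmt := .total 28 (atU 43)
def stOuts : Stmt := .total 29 (eNot (atU 11))
def stOnceNbrs : Stmt := .gather 44 (atX 43) (.const 1) eS eS
def stTwiceNbrs : Stmt := .gather 45 (eAnd (eNot (atX 11)) (eEq (atX 42) (.const 2)))
  (.const 1) eS eS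
def stWrong : Stmt := .gather 46 (eAnd (eNot (atX 11))
  (eNot (eEq (atX 42) (.load 4 (.add (.load 5 (atU 41)) eX))))) (.const 1) eS eS
def stFeas : Stmt := .gather 47 (.const 0) (eAnd (eNot (eLt (.reg 20) (.reg 0))) (eAnd (atU 14)
  (eAnd (eNot (atU 46)) (eEq (.add (.add (.reg 28) (.load 45 (atU 41))) (atU 13))
    (.add (.reg 29) (.load 44 (atU 41))))))) (.const 1) (.const 0)
def stSelWeight : Stmt := .gather 48 (.const 0) (atU 39) (atU 2) (.const 0)
def stSelWeights : Stmt := .total 30 (atU 48)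
-- Register `7` is larger than any weight of a vertex set and stands for an infeasible exchange.
def stValue : Stmt := .gather 49 (.const 0) (atU 47)
  (.add (.sub (.reg 30) (.load 2 (atU 41))) (atU 2)) (.reg 7)
def stValueMin : Stmt := .minim 31 (.reg 7) (atU 49)
def stArg : Stmt := .gather 50 (.const 0) (eAnd (atU 47) (eEq (atU 49) (.reg 31))) eU (.reg 0)
def stArgMin : Stmt := .minim 32 (.reg 0) (atU 50)
def stResult : Stmt := .gather 51 (.const 0) (eOr (eEq eU (.reg 32))
  (eAnd (atU 39) (eNot (eEq eU (.load 41 (.reg 32)))))) (.const 1) (.const 0)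
def stFlag : Stmt := .assign 33 (.add (.reg 24) (.add (.reg 34) (.reg 27)))

def block : List Stmt :=
  [stBall, stCore, stDegCore, stDegOut, stCand, stBase, stBaseIdx, stOwn, stBad, stBadMin,
    stMismatch, stMismatches, stLevel1, stLevel2, stLevel3, stCommon, stCommonMin, stLow, stLowMin,
    stJoin, stRest, stRestSize, stNoJoin, stFlag1, stSize, stBaseSize, stBig, stBigs, stMissBase,
    stCandNbrs, stBaseSizes, stBigNbrs, stMixed, stMixedMin, stMiss, stMisses, stFlag2, stSel,
    stSelIdx, stSelOwn, stCount, stOnce, stOnces, stOuts, stOnceNbrs, stTwiceNbrs, stWrong, stFeas,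
    stSelWeight, stSelWeights, stValue, stValueMin, stArg, stArgMin, stResult, stFlag]

set_option maxRecDepth 100000 in
theorem ssa_block : RAM.SSA block := by decide +kernel

theorem wregs_block : ∀ r ∈ block.flatMap Stmt.wregs, 20 ≤ r := by decide

theorem warrs_block : ∀ a ∈ block.flatMap Stmt.warrs, 10 ≤ a := by decide

end WED

/-! ### The contents of memory: core, candidates and base vertices -/

namespace WED
open RAM (nbrs mem_nbrs Expr Stmt Prog State)

attribute [simp] RAM.Expr.evalAt RAM.envReg

theorem gather_ind {n : ℕ} {G : SimpleGraph (Fin n)} {s : State} {a : ℕ} {e c : Expr}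
    (h : (Stmt.gather a e c (.const 1) (.const 0)).Holds G s) (u : Fin n) :
    s.arr a u = ind (c.evalAt s u 0 (∑ x ∈ nbrs G u, e.evalAt s u x 0) ≠ 0) := by
  rw [h u]
  unfold ind
  split_ifs <;> simp

theorem gather_val {n : ℕ} {G : SimpleGraph (Fin n)} {s : State} {a : ℕ} {e f g : Expr}
    (h : (Stmt.gather a e (.const 1) f g).Holds G s) (u : Fin n) :
    s.arr a u = f.evalAt s u 0 (∑ x ∈ nbrs G u, e.evalAt s u x 0) := by
  rw [h u]
  simp

section
variable {V : Type*} [Fintype V] {G : SimpleGraph V}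

@[simp] theorem sum_ind_nbrs (P : V → Prop) (u : V) :
    ∑ x ∈ nbrs G u, ind (P x) = degIn G P u := by
  classical
  rw [degIn, Finset.card_filter]
  refine Finset.sum_congr rfl fun x _ => ?_
  unfold ind
  congr

theorem sum_ind (P : V → Prop) [DecidablePred P] :
    ∑ x, ind (P x) = (Finset.univ.filter P).card := by
  rw [Finset.card_filter]
  refine Finset.sum_congr rfl fun x _ => ?_
  unfold ind
  congr

theorem degIn_eq_zero {P : V → Prop} {u : V} : degIn G P u = 0 ↔ ∀ x, G.Adj u x → ¬ P x := by
  classical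
  simp [degIn, Finset.filter_eq_empty_iff]

theorem sum_ind_eq_zero {P : V → Prop} : ∑ x, ind (P x) = 0 ↔ ∀ x, ¬ P x := by
  simp [Finset.sum_eq_zero_iff]

open Classical in
/-- Sums over the closed neighbourhood of `u`. -/
theorem closedSum_eq {P : V → Prop} {f g : V → ℕ} (hf : ∀ x, f x = if P x then g x else 0) (u : V) :
    f u + ∑ x ∈ nbrs G u, f x = ∑ x ∈ Finset.univ.filter (fun x => P x ∧ Dom G x u), g x := by
  have : Finset.univ.filter (fun x => Dom G x u) = insert u (nbrs G u) := by
    ext x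
    simp [Dom, G.adj_comm]
  simp only [and_comm (a := P _)]
  rw [← Finset.filter_filter, this, Finset.sum_filter, Finset.sum_insert (by simp)]
  simp only [hf]

open Classical in
theorem closedSum_ind {P : V → Prop} (u : V) : ind (P u) + ∑ x ∈ nbrs G u, ind (P x) =
    (Finset.univ.filter (fun x => P x ∧ Dom G x u)).card := by
  rw [closedSum_eq (f := fun x => ind (P x)) (g := fun _ => 1) (fun x => by unfold ind; congr)]
  simp

theorem closedSum_ind_eq_one {P : V → Prop} {u : V} :
    ind (P u) + ∑ x ∈ nbrs G u, ind (P x) = 1 ↔ ∃! b, P b ∧ Dom G b u := by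
  classical
  rw [closedSum_ind, Finset.card_eq_one]
  constructor
  · rintro ⟨b, hb⟩
    have h : ∀ x, x ∈ Finset.univ.filter (fun x => P x ∧ Dom G x u) ↔ x = b := by simp [hb]
    simp only [Finset.mem_filter, Finset.mem_univ, true_and] at h
    exact ⟨b, (h b).2 rfl, fun x hx => (h x).1 hx⟩
  · rintro ⟨b, hb, hu⟩
    refine ⟨b, ?_⟩
    ext x
    simp only [Finset.mem_filter, Finset.mem_univ, true_and, Finset.mem_singleton]
    exact ⟨hu x, fun h => h ▸ hb⟩

-- This recovers a label without search: a sum with just one possibly nonzero term is that term.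
open Classical in
theorem closedSum_unique {P : V → Prop} {f g : V → ℕ} (hf : ∀ x, f x = if P x then g x else 0)
    {u b : V} (hb : P b ∧ Dom G b u) (hu : ∀ x, P x → Dom G x u → x = b) :
    f u + ∑ x ∈ nbrs G u, f x = g b := by
  rw [closedSum_eq hf]
  have : Finset.univ.filter (fun x => P x ∧ Dom G x u) = {b} := by
    ext x
    simp only [Finset.mem_filter, Finset.mem_univ, true_and, Finset.mem_singleton]
    exact ⟨fun h => hu x h.1 h.2, fun h => h ▸ hb⟩
  rw [this, Finset.sum_singleton]

end

/-- The state `s` is reached by the computation for the vertex `v`. -/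
structure Computed {n : ℕ} (G : SimpleGraph (Fin n)) (ω : Fin n → ℕ) (v : Fin n) (s : State) :
    Prop where
  size : s.reg 0 = n
  vertex : s.reg 5 = v
  top : s.reg 7 = ∑ u, ω u + 1
  weight : ∀ u : Fin n, s.arr 2 u = ω u
  adj : ∀ u x : Fin n, s.arr 4 (u * n + x) = ind (G.Adj u x)
  row : ∀ u : Fin n, s.arr 5 u = u * n
  holds : ∀ st ∈ block, st.Holds G s

namespace Computed
variable {n : ℕ} {G : SimpleGraph (Fin n)} {ω : Fin n → ℕ} {v : Fin n} {s : State}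

theorem ball (B : Computed G ω v s) (u : Fin n) : s.arr 10 u = ind (Dom G u v) := by
  rw [gather_ind (B.holds stBall (by simp [block]))]
  simp [B.vertex, Fin.val_inj, degIn_eq_zero]
  exact ind_congr (by unfold Dom; tauto)

theorem core (B : Computed G ω v s) (u : Fin n) : s.arr 11 u = ind (Core G v u) := by
  rw [gather_ind (B.holds stCore (by simp [block]))]
  simp [B.ball, B.vertex, degIn_eq_zero, Fin.val_inj, or_iff_not_imp_left.symm]
  refine ind_congr (or_congr Iff.rfl ⟨fun h x hx => ?_, fun h => ⟨fun x hx => ?_, ?_⟩⟩)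
  · have : ¬ Dom G x v := by
      rcases hx with rfl | hx
      · exact h.2
      · exact h.1 x hx
    exact ⟨fun k => this (.inl k), fun k => this (.inr k)⟩
  · exact fun k => k.elim (h x (.inr hx)).1 (h x (.inr hx)).2
  · exact fun k => k.elim (h u (.inl rfl)).1 (h u (.inl rfl)).2

theorem degCore (B : Computed G ω v s) (u : Fin n) : s.arr 12 u = degIn G (Core G v) u := by
  rw [gather_val (B.holds stDegCore (by simp [block]))]
  simp [B.core]

theorem degOut (B : Computed G ω v s) (u : Fin n) :
    s.arr 13 u = degIn G (fun z => ¬ Core G v z) u := by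
  rw [gather_val (B.holds stDegOut (by simp [block]))]
  simp [B.core]

theorem cand (B : Computed G ω v s) (u : Fin n) : s.arr 14 u = ind (Cand G v u) := by
  rw [gather_ind (B.holds stCand (by simp [block]))]
  simp [B.core, B.degCore, degIn_eq_zero]
  exact ind_congr Iff.rfl

theorem base (B : Computed G ω v s) (u : Fin n) : s.arr 15 u = ind (Base G ω v u) := by
  rw [gather_ind (B.holds stBase (by simp [block]))]
  simp [B.cand, B.degOut, B.weight, eBetter, degIn_eq_zero]
  refine ind_congr ?_
  simp [Base, Better]

open Classical in
theorem baseIdx (B : Computed G ω v s) (u : Fin n) :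
    s.arr 16 u = if Base G ω v u then (u : ℕ) else 0 := by
  rw [B.holds stBaseIdx (by simp [block])]
  simp [B.base]

theorem own (B : Computed G ω v s) {u b : Fin n} (hb : Base G ω v b ∧ Dom G b u)
    (hu : ∀ x, Base G ω v x → Dom G x u → x = b) : s.arr 17 u = b := by
  rw [gather_val (B.holds stOwn (by simp [block]))]
  simp only [Expr.evalAt, RAM.envReg]
  simp
  exact closedSum_unique (f := fun x : Fin n => s.arr 16 x) (g := fun x : Fin n => (x : ℕ)) B.baseIdx hb hu

open Classical in
theorem bad (B : Computed G ω v s) (u : Fin n) : s.arr 18 u =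
    if Core G v u ∧ ¬ ∃! b, Base G ω v b ∧ Dom G b u then (u : ℕ) else n := by
  rw [B.holds stBad (by simp [block])]
  simp only [← closedSum_ind_eq_one]
  simp [B.core, B.base, B.size]

end Computed
end WED

/-! ### The contents of memory: components without a dominating vertex -/

namespace WED
open RAM (nbrs mem_nbrs Expr Stmt Prog State)

theorem degIn_lt_card {V : Type*} [Fintype V] {G : SimpleGraph V} {P : V → Prop} [DecidablePred P]
    {u : V} : degIn G P u < (Finset.univ.filter P).card ↔ ∃ w, P w ∧ ¬ G.Adj u w := by
  classical
  have hsub : (nbrs G u).filter P ⊆ Finset.univ.filter P :=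
    Finset.filter_subset_filter _ (Finset.subset_univ _)
  have : degIn G P u = ((nbrs G u).filter P).card := by unfold degIn; congr
  rw [this]
  constructor
  · intro h
    obtain ⟨w, hw, hw'⟩ := Finset.exists_mem_notMem_of_card_lt_card h
    simp only [Finset.mem_filter, Finset.mem_univ, true_and, mem_nbrs, not_and] at hw hw'
    exact ⟨w, hw, fun k => hw' k hw⟩
  · rintro ⟨w, hw, hw'⟩
    refine Finset.card_lt_card ((Finset.ssubset_iff_of_subset hsub).2 ⟨w, by simp [hw], ?_⟩)
    simp [hw']

/-- The value `n`, which is the index of no vertex, means that the search failed; later tests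
against this register are then false at every vertex. -/
theorem minIndex {n : ℕ} {G : SimpleGraph (Fin n)} {s : State} {r a : ℕ} {P : Fin n → Prop}
    [DecidablePred P]
    (h : (Stmt.minim r (.reg 0) (atU a)).Holds G s) (hn : s.reg 0 = n)
    (ha : ∀ u : Fin n, s.arr a u = if P u then (u : ℕ) else n) :
    (∃ c : Fin n, P c ∧ s.reg r = c) ∨ (s.reg r = n ∧ ∀ u, ¬ P u) := by
  obtain ⟨h1, h2, h3⟩ := h
  simp only [Expr.evalAt, RAM.envReg] at h1 h2 h3
  simp only [↓reduceIte, zero_ne_one, OfNat.zero_ne_ofNat, hn, ha] at h1 h2 h3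
  have h4 : ∀ u : Fin n, s.reg r = (if P u then (u : ℕ) else n) → P u → s.reg r = u :=
    fun u h hu => by rw [h, if_pos hu]
  by_cases h : ∃ u, P u
  · obtain ⟨u, hu⟩ := h
    have := h2 u
    rw [if_pos hu] at this
    rcases h3 with h3 | ⟨w, hw⟩
    · omega
    · by_cases hPw : P w
      · exact .inl ⟨w, hPw, h4 w hw hPw⟩
      · rw [if_neg hPw] at hw
        omega
  · push Not at h
    right
    refine ⟨?_, h⟩
    rcases h3 with h3 | ⟨w, hw⟩
    · exact h3
    · rwa [if_neg (h w)] at hw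

namespace Computed
variable {n : ℕ} {G : SimpleGraph (Fin n)} {ω : Fin n → ℕ} {v : Fin n} {s : State}

theorem badMin (B : Computed G ω v s) :
    (∃ c : Fin n, (Core G v c ∧ ¬ ∃! b, Base G ω v b ∧ Dom G b c) ∧ s.reg 20 = c) ∨
      (s.reg 20 = n ∧ ∀ u, ¬ (Core G v u ∧ ¬ ∃! b, Base G ω v b ∧ Dom G b u)) := by
  classical
  exact minIndex (B.holds stBadMin (by simp [block])) B.size fun u => (B.bad u).trans (by congr)

section bad
variable {c : Fin n}

theorem level1 (B : Computed G ω v s) (hc : s.reg 20 = c) (u : Fin n) :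
    s.arr 21 u = ind (Level1 G v c u) := by
  rw [gather_ind (B.holds stLevel1 (by simp [block]))]
  simp [B.core, hc, Fin.val_inj, degIn_eq_zero]
  exact ind_congr (by simp [Level1, G.adj_comm])

theorem level2 (B : Computed G ω v s) (hc : s.reg 20 = c) (u : Fin n) :
    s.arr 22 u = ind (Level2 G v c u) := by
  rw [gather_ind (B.holds stLevel2 (by simp [block]))]
  simp [B.core, B.level1 hc, hc, Fin.val_inj, degIn_eq_zero]
  exact ind_congr (by simp [Level2])

theorem level3 (B : Computed G ω v s) (hc : s.reg 20 = c) (u : Fin n) :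
    s.arr 23 u = ind (Level3 G v c u) := by
  rw [gather_ind (B.holds stLevel3 (by simp [block]))]
  simp [B.core, B.level1 hc, B.level2 hc, hc, Fin.val_inj, degIn_eq_zero]
  exact ind_congr (by simp [Level3])

open Classical in
theorem common (B : Computed G ω v s) (hc : s.reg 20 = c) (u : Fin n) :
    s.arr 24 u = if Level2 G v c u then degIn G (Level1 G v c) u else n + 1 := by
  rw [B.holds stCommon (by simp [block])]
  simp [B.level1 hc, B.level2 hc, B.size]

theorem low (B : Computed G ω v s) (hc : s.reg 20 = c) :
    (∃ z : Fin n, Level2 G v c z ∧ s.reg 22 = z ∧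
      ∀ z', Level2 G v c z' → degIn G (Level1 G v c) z ≤ degIn G (Level1 G v c) z') ∨
      (s.reg 22 = n ∧ ∀ u, ¬ Level2 G v c u) := by
  classical
  have hlow : ∀ u : Fin n, s.arr 25 u =
      if Level2 G v c u ∧ s.arr 24 u = s.reg 21 then (u : ℕ) else n := by
    intro u
    rw [B.holds stLow (by simp [block])]
    simp [B.level2 hc, B.size]
  obtain ⟨h1, h2, h3⟩ := B.holds stCommonMin (by simp [block])
  simp only [Expr.evalAt, RAM.envReg] at h1 h2 h3
  simp only [↓reduceIte, B.size, B.common hc] at h1 h2 h3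
  rcases minIndex (B.holds stLowMin (by simp [block])) B.size hlow with ⟨z, ⟨hz, hz'⟩, h⟩ | ⟨h, h'⟩
  · refine .inl ⟨z, hz, h, fun z' hz'' => ?_⟩
    have := h2 z'
    rw [if_pos hz''] at this
    rw [B.common hc, if_pos hz] at hz'
    omega
  · refine .inr ⟨h, fun t ht => ?_⟩
    have h4 := h2 t
    rw [if_pos ht] at h4
    have h5 : degIn G (Level1 G v c) t ≤ n := by
      unfold degIn
      exact (Finset.card_le_univ _).trans (by simp)
    rcases h3 with h3 | ⟨w, hw⟩
    · simp at h3
      omega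
    · by_cases hw2 : Level2 G v c w
      · exact h' w ⟨hw2, by rw [B.common hc, hw]⟩
      · rw [if_neg hw2] at hw
        omega

theorem join (B : Computed G ω v s) (hc : s.reg 20 = c) (u : Fin n) :
    s.arr 26 u = ind (Level1 G v c u ∧ ∃ x : Fin n, G.Adj u x ∧ (x : ℕ) = s.reg 22) := by
  rw [gather_ind (B.holds stJoin (by simp [block]))]
  simp [B.level1 hc, degIn_eq_zero]

theorem rest (B : Computed G ω v s) (hc : s.reg 20 = c) (u : Fin n) :
    s.arr 27 u = ind ((u = c ∨ Level1 G v c u ∨ Level2 G v c u) ∧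
      ¬ (Level1 G v c u ∧ ∃ x : Fin n, G.Adj u x ∧ (x : ℕ) = s.reg 22)) := by
  rw [gather_ind (B.holds stRest (by simp [block]))]
  simp only [evalAt_eAnd, evalAt_eOr, evalAt_eNot, evalAt_eEq, Expr.evalAt, RAM.envReg]
  simp only [↓reduceIte, B.level1 hc, B.level2 hc, B.join hc, hc, ne_eq, ind_eq_zero, not_not]
  simp [Fin.val_inj]

theorem noJoin (B : Computed G ω v s) (hc : s.reg 20 = c) (u : Fin n) :
    s.arr 28 u = ind ((Level1 G v c u ∧ ∃ x : Fin n, G.Adj u x ∧ (x : ℕ) = s.reg 22) ∧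
      ∃ w, ((w = c ∨ Level1 G v c w ∨ Level2 G v c w) ∧
        ¬ (Level1 G v c w ∧ ∃ x : Fin n, G.Adj w x ∧ (x : ℕ) = s.reg 22)) ∧ ¬ G.Adj u w) := by
  classical
  have hsize := B.holds stRestSize (by simp [block])
  simp only [stRestSize, Stmt.Holds, Expr.evalAt, RAM.envReg] at hsize
  simp only [↓reduceIte, B.rest hc, sum_ind] at hsize
  rw [gather_ind (B.holds stNoJoin (by simp [block]))]
  simp only [evalAt_eAnd, evalAt_eLt, Expr.evalAt, RAM.envReg]
  simp only [↓reduceIte, B.rest hc, B.join hc, OfNat.ofNat_ne_one,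
    sum_ind_nbrs, ne_eq, ind_eq_zero, not_not, Nat.reduceEqDiff, hsize, degIn_lt_card]

theorem flag1 (B : Computed G ω v s) (hc : s.reg 20 = c) : s.reg 24 = 0 ↔
    (∀ w, ¬ Level3 G v c w) ∧ ∀ m, Level1 G v c m → (∃ x : Fin n, G.Adj m x ∧ (x : ℕ) = s.reg 22) →
      ∀ w, (w = c ∨ Level1 G v c w ∨ Level2 G v c w) →
        ¬ (Level1 G v c w ∧ ∃ x : Fin n, G.Adj w x ∧ (x : ℕ) = s.reg 22) → G.Adj m w := by
  have h := B.holds stFlag1 (by simp [block])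
  simp only [stFlag1, Stmt.Holds, Expr.evalAt, RAM.envReg] at h
  simp only [↓reduceIte, B.level3 hc, B.noJoin hc, Finset.sum_add_distrib] at h
  rw [h, Nat.add_eq_zero_iff, sum_ind_eq_zero, sum_ind_eq_zero]
  refine and_congr Iff.rfl (forall_congr' fun m => ?_)
  constructor
  · intro k h1 h2 w h3 h4
    by_contra h5
    exact k ⟨⟨h1, h2⟩, w, ⟨h3, h4⟩, h5⟩
  · rintro k ⟨⟨h1, h2⟩, w, ⟨h3, h4⟩, h5⟩
    exact h5 (k h1 h2 w h3 h4)

theorem bad_spec (B : Computed G ω v s) {y : Fin n} (hy : G.Adj v y) (hc : s.reg 20 = c)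
    (hcore : Core G v c) (hbad : ¬ ∃! b, Base G ω v b ∧ Dom G b c) :
    (s.reg 24 ≠ 0 → ¬ IndFree P2P4 G) ∧
      (s.reg 24 = 0 → ∀ D, IsEfficientDominating G D → v ∉ D) := by
  have hz : ∀ z : Fin n, s.reg 22 = z → ∀ m, (∃ x : Fin n, G.Adj m x ∧ (x : ℕ) = s.reg 22) ↔
      G.Adj m z := by
    intro z h m
    simp [h, Fin.val_inj]
  rw [ne_eq, B.flag1 hc]
  constructor
  · intro h
    by_cases h3 : ∀ w, ¬ Level3 G v c w
    · have h' := fun k => h ⟨h3, k⟩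
      rcases B.low hc with ⟨z, hz2, hz22, hmin⟩ | ⟨h22, -⟩
      · simp only [hz z hz22] at h'
        by_contra hfree
        refine h' fun m hm hmz w hw hw' => ?_
        by_contra hmw
        exact not_indFree_of_not_join hy hcore hz2 hmin hm hmz hw hw' hmw hfree
      -- Here level two is empty and no vertex has index `n`, so the set M is empty and the join
      -- condition is vacuous.
      · refine absurd (fun m _ ⟨x, _, hx⟩ => ?_) h'
        have := x.2
        omega
    · push Not at h3
      obtain ⟨w, hw⟩ := h3
      exact hw.not_indFree hy hcore
  · rintro ⟨h3, hj⟩ D hD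
    refine not_mem_ed_of_bad hcore hbad h3 (fun t ht => ?_) hD
    rcases B.low hc with ⟨z, hz2, hz22, -⟩ | ⟨-, hno⟩
    · refine ⟨z, hz2, ?_⟩
      simpa only [hz z hz22] using hj
    · exact absurd ht (hno t)

end bad

/-- Register `20` names no vertex, so all levels are computed as empty. -/
theorem flag1_of_noBad (B : Computed G ω v s) (h20 : s.reg 20 = n) : s.reg 24 = 0 := by
  have h1 : ∀ u : Fin n, s.arr 21 u = 0 := by
    intro u
    rw [gather_ind (B.holds stLevel1 (by simp [block]))]
    simp [h20, (Fin.is_lt _).ne]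
  have h2 : ∀ u : Fin n, s.arr 22 u = 0 := by
    intro u
    rw [gather_ind (B.holds stLevel2 (by simp [block]))]
    simp [h1]
  have h3 : ∀ u : Fin n, s.arr 23 u = 0 := by
    intro u
    rw [gather_ind (B.holds stLevel3 (by simp [block]))]
    simp [h2]
  have h4 : ∀ u : Fin n, s.arr 28 u = 0 := by
    intro u
    rw [gather_ind (B.holds stNoJoin (by simp [block]))]
    have : s.arr 26 u = 0 := by
      rw [gather_ind (B.holds stJoin (by simp [block]))]
      simp [h1]
    simp [this]
  have h := B.holds stFlag1 (by simp [block])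
  simpa [stFlag1, Stmt.Holds, h3, h4] using h

theorem mismatches (B : Computed G ω v s) : s.reg 34 = 0 ↔ (s.reg 20 < n ∨
    ∀ u x : Fin n, G.Adj u x → Core G v u → Core G v x → s.arr 17 u = s.arr 17 x) := by
  have h := B.holds stMismatches (by simp [block])
  simp only [stMismatches, Stmt.Holds, Expr.evalAt, RAM.envReg] at h
  simp only [↓reduceIte, fun u : Fin n => gather_ind (B.holds stMismatch (by simp [block])) u] at h
  rw [h, sum_ind_eq_zero]
  simp [B.core, B.size, degIn_eq_zero]
  constructor
  · intro k
    by_cases h20 : s.reg 20 < n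
    · exact .inl h20
    · right
      intro u x hux hu hx
      by_contra hne
      exact h20 (k u x hux hu hx hne)
  · rintro (k | k) u x hux hu hx hne
    · exact k
    · exact absurd (k u x hux hu hx) hne

/-- If there is no component without a dominating vertex, then a mismatch of owners yields a chordless
path, and otherwise the owners are constant on components. -/
theorem split (B : Computed G ω v s) {y : Fin n} (hy : G.Adj v y) (h20 : s.reg 20 = n)
    (hgood : ∀ u, ¬ (Core G v u ∧ ¬ ∃! b, Base G ω v b ∧ Dom G b u)) :
    (s.reg 34 ≠ 0 → ¬ IndFree P2P4 G) ∧ (s.reg 34 = 0 → ∃ own : Fin n → Fin n,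
      Split G ω v own ∧ ∀ u, Core G v u → s.arr 17 u = own u) := by
  classical
  have hex : ∀ u, Core G v u → ∃! b, Base G ω v b ∧ Dom G b u := fun u hu => by
    by_contra k
    exact hgood u ⟨hu, k⟩
  choose! own hown huniq using hex
  have h17 : ∀ u, Core G v u → s.arr 17 u = own u := fun u hu =>
    B.own (hown u hu) fun x hx hxu => huniq u hu x ⟨hx, hxu⟩
  rw [ne_eq, B.mismatches]
  constructor
  · intro h
    push Not at h
    obtain ⟨-, u, x, hux, hu, hx, hne⟩ := h
    rw [h17 u hu, h17 x hx, ne_eq, Fin.val_inj] at hne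
    have hb := hown u hu
    have hb' := hown x hx
    have hux' : ¬ Dom G (own u) x := fun k => hne (huniq x hx _ ⟨hb.1, k⟩)
    have hxu' : ¬ Dom G (own x) u := fun k => hne (huniq u hu _ ⟨hb'.1, k⟩).symm
    have hbb : ¬ G.Adj (own u) (own x) := fun k => hne (((huniq (own x) hb'.1.1.1 (own u) ⟨hb.1, .inr k⟩).trans
      (huniq (own x) hb'.1.1.1 (own x) ⟨hb'.1, .inl rfl⟩).symm))
    have hau : G.Adj (own u) u := hb.2.resolve_left fun k => hux' (.inr (by rw [k]; exact hux))
    have hax : G.Adj (own x) x := hb'.2.resolve_left fun k => hxu' (.inr (by rw [k]; exact hux.symm))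
    -- The path is `own u, u, x, own x`; each missing edge follows from the uniqueness of the base
    -- vertex that dominates a core vertex.
    exact not_indFree_of_core_path hy hb.1.1.1 hu hx hb'.1.1.1 hau hux hax.symm
      (fun k => hux' (.inr k)) hbb (fun k => hxu' (.inr k.symm))
  · rintro (h | h)
    · omega
    · refine ⟨own, ⟨hown, fun w b hw hb hbw => huniq w hw b ⟨hb, hbw⟩, fun w w' hw hw' k => ?_⟩, h17⟩
      have := h w w' k hw hw'
      rw [h17 w hw, h17 w' hw'] at this
      exact Fin.ext this

end Computed
end WED

/-! ### Recognising mixed vertices by counting -/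

namespace WED
open RAM (nbrs mem_nbrs Expr Stmt Prog State)

section
variable {V : Type*} {G : SimpleGraph V} {v : V} [Fintype V]

open Classical in
/-- The number of candidates in the component of `u`. -/
noncomputable def numCand (G : SimpleGraph V) (v : V) (own : V → V) (u : V) : ℕ :=
  (Finset.univ.filter fun x => Cand G v x ∧ own x = own u).card

variable [LinearOrder V] {ω : V → ℕ} {own : V → V}

theorem Split.dom_iff (S : Split G ω v own) {x u : V} (hx : Cand G v x) (hu : Core G v u) :
    Dom G x u ↔ own x = own u :=
  ⟨S.own_eq_of_dom hx.1 hu, fun h => S.dom_of_cand hx hu h.symm⟩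

-- Suppose `z` sees `x` but not `own x`, so that `own x` is a missed base vertex of a component with
-- several candidates. Then `z` is mixed exactly when it misses a second such base vertex (hence the
-- `+ 1`), or when it sees the base vertex of a component but not all of its candidates. The latter
-- is detected by comparing the candidates that `z` sees with the sizes of the components whose base
-- vertex it sees, the term for missed base vertices being moved across.
open Classical in
theorem Split.mixed_iff (S : Split G ω v own) (z : V) : Mixed G v own z ↔
    degIn G (fun x => Cand G v x ∧ ¬ G.Adj z (own x)) z ≠ 0 ∧
    (degIn G (fun b => Base G ω v b ∧ 1 < numCand G v own b) z + 1 <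
      (Finset.univ.filter fun b => Base G ω v b ∧ 1 < numCand G v own b).card ∨
    degIn G (Cand G v) z < (∑ b ∈ nbrs G z, if Base G ω v b then numCand G v own b else 0) +
      degIn G (fun x => Cand G v x ∧ ¬ G.Adj z (own x)) z) := by
  have big_iff : ∀ b, 1 < numCand G v own b ↔ ∃ y y', Cand G v y ∧ Cand G v y' ∧ y ≠ y' ∧
      own y = own b ∧ own y' = own b := by
    intro b
    unfold numCand
    rw [Finset.one_lt_card]
    simp only [Finset.mem_filter, Finset.mem_univ, true_and]
    constructor
    · rintro ⟨y, ⟨h1, h2⟩, y', ⟨h3, h4⟩, h⟩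
      exact ⟨y, y', h1, h3, h, h2, h4⟩
    · rintro ⟨y, y', h1, h3, h, h2, h4⟩
      exact ⟨y, ⟨h1, h2⟩, y', ⟨h3, h4⟩, h⟩
  have sizes : (∑ b ∈ nbrs G z, if Base G ω v b then numCand G v own b else 0) =
      (Finset.univ.filter fun x => Cand G v x ∧ G.Adj z (own x)).card := by
    rw [← Finset.sum_filter, Finset.card_eq_sum_card_fiberwise (f := own)
      (t := (nbrs G z).filter (Base G ω v))]
    · refine Finset.sum_congr rfl fun b hb => ?_
      simp only [Finset.mem_filter, mem_nbrs] at hb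
      unfold numCand
      rw [S.own_base hb.2]
      congr 1
      ext x
      simp only [Finset.mem_filter, Finset.mem_univ, true_and]
      constructor
      · rintro ⟨h1, h2⟩
        exact ⟨⟨h1, by rw [h2]; exact hb.1⟩, h2⟩
      · rintro ⟨⟨h1, -⟩, h2⟩
        exact ⟨h1, h2⟩
    · intro x hx
      simp only [Finset.coe_filter, Finset.mem_univ, true_and, Set.mem_ofPred_eq, mem_nbrs] at hx ⊢
      exact ⟨hx.2, (S.base x hx.1.1).1⟩
  have parts : degIn G (Cand G v) z = degIn G (fun x => Cand G v x ∧ G.Adj z (own x)) z +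
      degIn G (fun x => Cand G v x ∧ ¬ G.Adj z (own x)) z := by
    unfold degIn
    rw [← Finset.card_filter_add_card_filter_not (s := (nbrs G z).filter (Cand G v))
      (fun x => G.Adj z (own x)), Finset.filter_filter, Finset.filter_filter]
    congr!
  have partial_iff : degIn G (Cand G v) z <
      (∑ b ∈ nbrs G z, if Base G ω v b then numCand G v own b else 0) +
        degIn G (fun x => Cand G v x ∧ ¬ G.Adj z (own x)) z ↔
      ∃ y, (Cand G v y ∧ G.Adj z (own y)) ∧ ¬ G.Adj z y := by
    rw [sizes, parts, ← degIn_lt_card]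
    omega
  have missed_iff : degIn G (fun b => Base G ω v b ∧ 1 < numCand G v own b) z + 1 <
      (Finset.univ.filter fun b => Base G ω v b ∧ 1 < numCand G v own b).card ↔
      ∃ b b', (Base G ω v b ∧ 1 < numCand G v own b) ∧ (Base G ω v b' ∧ 1 < numCand G v own b') ∧
        ¬ G.Adj z b ∧ ¬ G.Adj z b' ∧ b ≠ b' := by
    have h := Finset.card_filter_add_card_filter_not
      (s := Finset.univ.filter fun b => Base G ω v b ∧ 1 < numCand G v own b) (fun b => G.Adj z b)
    have h' : degIn G (fun b => Base G ω v b ∧ 1 < numCand G v own b) z =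
        ((Finset.univ.filter fun b => Base G ω v b ∧ 1 < numCand G v own b).filter
          fun b => G.Adj z b).card := by
      unfold degIn
      congr 1
      ext b
      simp [and_comm]
    have h'' := Finset.one_lt_card (s := (Finset.univ.filter fun b =>
      Base G ω v b ∧ 1 < numCand G v own b).filter fun b => ¬ G.Adj z b)
    simp only [Finset.mem_filter, Finset.mem_univ, true_and] at h''
    rw [h', ← h, add_lt_add_iff_left, h'']
    constructor
    · rintro ⟨b, ⟨h1, h2⟩, b', ⟨h3, h4⟩, h5⟩
      exact ⟨b, b', h1, h3, h2, h4, h5⟩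
    · rintro ⟨b, b', h1, h3, h2, h4, h5⟩
      exact ⟨b, ⟨h1, h2⟩, b', ⟨h3, h4⟩, h5⟩
  rw [partial_iff, missed_iff, ne_eq, degIn_eq_zero]
  push Not
  constructor
  · rintro ⟨x, hzx, hx, hzo, y, y', hy, hy', hyy, hoy, hyx, hzy⟩
    refine ⟨⟨x, hzx, hx, hzo⟩, ?_⟩
    by_cases hzy' : G.Adj z (own y)
    · exact .inr ⟨y, ⟨hy, hzy'⟩, hzy⟩
    · refine .inl ⟨own x, own y, ⟨(S.base x hx.1).1, (big_iff _).2 ⟨x, own x, hx,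
        (S.base x hx.1).1.1, ?_, (S.own_own hx.1).symm, rfl⟩⟩, ⟨(S.base y hy.1).1,
        (big_iff _).2 ⟨y, y', hy, hy', hyy, (S.own_own hy.1).symm, ?_⟩⟩, hzo, hzy', hyx.symm⟩
      · intro k
        rw [← k] at hzo
        exact hzo hzx
      · rw [S.own_own hy.1, hoy]
  · rintro ⟨⟨x, hzx, hx, hzo⟩, h⟩
    rcases h with ⟨b, b', hb, hb', hzb, hzb', hbb⟩ | ⟨y, ⟨hy, hzy'⟩, hzy⟩
    · have main : ∀ d, Base G ω v d → 1 < numCand G v own d → ¬ G.Adj z d → d ≠ own x →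
          Mixed G v own z := by
        intro d hd hdn hzd hdx
        obtain ⟨y, y', hy, hy', hyy, h1, h2⟩ := (big_iff d).1 hdn
        rw [S.own_base hd] at h1 h2
        by_cases hyd : y = d
        · exact ⟨x, hzx, hx, hzo, d, y', hd.1, hy', hyd ▸ hyy, by rw [S.own_base hd, h2],
            by rwa [S.own_base hd], hzd⟩
        · exact ⟨x, hzx, hx, hzo, d, y, hd.1, hy, Ne.symm hyd, by rw [S.own_base hd, h1],
            by rwa [S.own_base hd], hzd⟩
      -- Of two missed base vertices, at least one belongs to another component than `x`.
      by_cases hbx : b = own x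
      · exact main b' hb'.1 hb'.2 hzb' fun k => hbb (hbx.trans k.symm)
      · exact main b hb.1 hb.2 hzb hbx
    · refine ⟨x, hzx, hx, hzo, y, own y, hy, (S.base y hy.1).1.1, ?_, (S.own_own hy.1).symm, ?_,
        hzy⟩
      · intro k
        rw [← k] at hzy'
        exact hzy hzy'
      · intro k
        rw [k] at hzy'
        exact hzo hzy'

end

namespace Computed
variable {n : ℕ} {G : SimpleGraph (Fin n)} {ω : Fin n → ℕ} {v : Fin n} {s : State}
  {own : Fin n → Fin n}

theorem size_eq (B : Computed G ω v s) (S : Split G ω v own) {u : Fin n} (hu : Core G v u) :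
    s.arr 29 u = numCand G v own u := by
  classical
  rw [gather_val (B.holds stSize (by simp [block]))]
  simp only [Expr.evalAt, RAM.envReg]
  simp only [↓reduceIte, B.cand, OfNat.ofNat_ne_one]
  rw [if_neg (by norm_num), closedSum_ind]
  unfold numCand
  congr 1
  ext x
  simp only [Finset.mem_filter, Finset.mem_univ, true_and]
  exact and_congr_right fun hx => S.dom_iff hx hu

open Classical in
theorem baseSize (B : Computed G ω v s) (S : Split G ω v own) (u : Fin n) :
    s.arr 30 u = if Base G ω v u then numCand G v own u else 0 := by
  rw [B.holds stBaseSize (by simp [block])]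
  by_cases hu : Base G ω v u
  · simp [B.base, hu, B.size_eq S hu.1.1]
  · simp [B.base, hu]

theorem big (B : Computed G ω v s) (S : Split G ω v own) (u : Fin n) :
    s.arr 31 u = ind (Base G ω v u ∧ 1 < numCand G v own u) := by
  rw [gather_ind (B.holds stBig (by simp [block]))]
  simp [B.base]
  exact ind_congr (and_congr_right fun hu => by rw [B.size_eq S hu.1.1])

theorem missBase (B : Computed G ω v s) (h17 : ∀ u, Core G v u → s.arr 17 u = own u)
    (z : Fin n) : s.arr 32 z = degIn G (fun x => Cand G v x ∧ ¬ G.Adj z (own x)) z := by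
  rw [gather_val (B.holds stMissBase (by simp [block])), ← sum_ind_nbrs]
  change ∑ x ∈ nbrs G z, _ = _
  refine Finset.sum_congr rfl fun x _ => ?_
  simp [B.cand, B.row]
  refine ind_congr (and_congr_right fun hx => ?_)
  rw [h17 x hx.1, B.adj, ind_eq_zero]

open Classical in
theorem mixed (B : Computed G ω v s) (S : Split G ω v own)
    (h17 : ∀ u, Core G v u → s.arr 17 u = own u) (z : Fin n) :
    s.arr 36 z = if ¬ Core G v z ∧ Mixed G v own z then (z : ℕ) else n := by
  have h33 : s.arr 33 z = degIn G (Cand G v) z := by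
    rw [gather_val (B.holds stCandNbrs (by simp [block]))]
    simp [B.cand]
  have h34 : s.arr 34 z = ∑ b ∈ nbrs G z, if Base G ω v b then numCand G v own b else 0 := by
    rw [gather_val (B.holds stBaseSizes (by simp [block]))]
    simp [B.baseSize S]
  have h35 : s.arr 35 z = degIn G (fun b => Base G ω v b ∧ 1 < numCand G v own b) z := by
    rw [gather_val (B.holds stBigNbrs (by simp [block]))]
    simp [B.big S]
  have h25 := B.holds stBigs (by simp [block])
  simp only [stBigs, Stmt.Holds, Expr.evalAt, RAM.envReg] at h25
  simp only [↓reduceIte, B.big S, sum_ind] at h25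
  rw [B.holds stMixed (by simp [block])]
  simp only [S.mixed_iff]
  simp [B.core, B.size, h33, h34, h35, h25, B.missBase h17, or_iff_not_imp_left]

theorem mixedMin (B : Computed G ω v s) (S : Split G ω v own)
    (h17 : ∀ u, Core G v u → s.arr 17 u = own u) :
    (∃ z : Fin n, (¬ Core G v z ∧ Mixed G v own z) ∧ s.reg 26 = z) ∨
      (s.reg 26 = n ∧ ∀ z, ¬ (¬ Core G v z ∧ Mixed G v own z)) := by
  classical
  exact minIndex (B.holds stMixedMin (by simp [block])) B.size fun u =>
    (B.mixed S h17 u).trans (by congr)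

/-- The candidates that the chosen vertex misses. -/
def Missed (G : SimpleGraph (Fin n)) (v : Fin n) (s : State) (u : Fin n) : Prop :=
  Cand G v u ∧ s.reg 26 < n ∧ ∀ x : Fin n, G.Adj u x → (x : ℕ) ≠ s.reg 26

theorem miss (B : Computed G ω v s) (u : Fin n) : s.arr 37 u = ind (Missed G v s u) := by
  rw [gather_ind (B.holds stMiss (by simp [block]))]
  simp [B.cand, B.size, degIn_eq_zero]
  exact ind_congr (by simp [Missed])

open Classical in
theorem misses (B : Computed G ω v s) (u : Fin n) :
    s.arr 38 u = (Finset.univ.filter fun x => Missed G v s x ∧ Dom G x u).card := by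
  rw [gather_val (B.holds stMisses (by simp [block])), ← closedSum_ind]
  simp [B.miss]

/-- The candidates in the closed neighbourhood of a candidate are precisely those of its component,
so missed candidates are counted component by component. -/
theorem flag2 (B : Computed G ω v s) (S : Split G ω v own) (h20 : s.reg 20 = n) :
    s.reg 27 = 0 ↔ ∀ x x', Missed G v s x → Missed G v s x' → own x = own x' → x = x' := by
  classical
  have h := B.holds stFlag2 (by simp [block])
  simp only [stFlag2, Stmt.Holds] at h
  simp [h20, B.size, B.cand, B.misses] at h
  rw [h, sum_ind_eq_zero]
  constructor
  · intro k x x' hx hx' hxx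
    by_contra hne
    refine k x ⟨hx.1, Finset.one_lt_card.2 ⟨x, ?_, x', ?_, hne⟩⟩
    · exact Finset.mem_filter.2 ⟨Finset.mem_univ _, hx, .inl rfl⟩
    · exact Finset.mem_filter.2 ⟨Finset.mem_univ _, hx', (S.dom_iff hx'.1 hx.1.1).2 hxx.symm⟩
  · rintro k u ⟨hu, h2⟩
    obtain ⟨x, hx, x', hx', hne⟩ := Finset.one_lt_card.1 h2
    simp only [Finset.mem_filter, Finset.mem_univ, true_and] at hx hx'
    exact hne (k x x' hx.1 hx'.1 (((S.dom_iff hx.1.1 hu.1).1 hx.2).trans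
      ((S.dom_iff hx'.1.1 hu.1).1 hx'.2).symm))

theorem sel (B : Computed G ω v s) (S : Split G ω v own) (u : Fin n) :
    s.arr 39 u = ind (overrideBase G ω v own (Missed G v s) u) := by
  classical
  rw [B.holds stSel (by simp [block])]
  simp [B.misses, B.miss, B.base, Finset.filter_eq_empty_iff]
  unfold overrideBase
  by_cases hu : Core G v u
  · split_ifs with h
    · refine ind_congr ⟨.inl, ?_⟩
      rintro (k | k)
      · exact k
      · obtain ⟨x, hx, hd⟩ := h
        exact absurd ((S.dom_iff hx.1 hu).1 hd) (k.2 x hx)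
    · push Not at h
      refine ind_congr ⟨fun hb => .inr ⟨hb, fun x hx k => h x hx ((S.dom_iff hx.1 hu).2 k)⟩, ?_⟩
      rintro (k | k)
      · exact absurd (.inl rfl) (h u k)
      · exact k.1
  · have h1 : ¬ Missed G v s u := fun h => hu h.1.1
    have h2 : ¬ Base G ω v u := fun h => hu h.1.1
    simp [h1, h2]

end Computed
end WED

/-! ### Evaluating all exchanges for one vertex -/

namespace WED
open RAM (nbrs mem_nbrs Expr Stmt Prog State)

theorem ind_eq_ite (P : Prop) [Decidable P] : ind P = if P then 1 else 0 := by
  unfold ind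
  congr

namespace Computed
variable {n : ℕ} {G : SimpleGraph (Fin n)} {ω : Fin n → ℕ} {v : Fin n} {s : State}
  {own β : Fin n → Fin n} {N : Finset (Fin n)}

open Classical in
theorem selOwn (B : Computed G ω v s) (S : Split G ω v own)
    (hN : ∀ x, x ∈ N ↔ overrideBase G ω v own (Missed G v s) x) (hNs : Sel G v own N)
    (hβ : ∀ w, Core G v w → β w ∈ N ∧ own (β w) = own w) {u : Fin n} (hu : Core G v u) :
    s.arr 41 u = β u := by
  have h39 : ∀ x : Fin n, s.arr 39 x = ind (x ∈ N) := fun x => by rw [B.sel S, hN]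
  have h40 : ∀ x : Fin n, s.arr 40 x = if x ∈ N then (x : ℕ) else 0 := by
    intro x
    rw [B.holds stSelIdx (by simp [block])]
    simp [h39]
  rw [gather_val (B.holds stSelOwn (by simp [block]))]
  simp only [Expr.evalAt, RAM.envReg]
  simp
  refine closedSum_unique (P := (· ∈ N)) (f := fun x : Fin n => s.arr 40 x)
    (g := fun x : Fin n => (x : ℕ))
    (fun x => (h40 x).trans (by congr))
    ⟨(hβ u hu).1, (S.dom_iff (hNs.cand _ (hβ u hu).1) hu).2 (hβ u hu).2⟩ fun x hx hxu => ?_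
  exact hNs.inj x hx _ (hβ u hu).1
    (((S.dom_iff (hNs.cand x hx) hu).1 hxu).trans (hβ u hu).2.symm)

open Classical in
theorem feas (B : Computed G ω v s) (S : Split G ω v own) (h20 : s.reg 20 = n)
    (hN : ∀ x, x ∈ N ↔ overrideBase G ω v own (Missed G v s) x) (hNs : Sel G v own N)
    (hβ : ∀ w, Core G v w → β w ∈ N ∧ own (β w) = own w) (u : Fin n) :
    s.arr 47 u = ind (Cand G v u ∧ IsEfficientDominating G (exchange N β u)) := by
  have h39 : ∀ x : Fin n, s.arr 39 x = ind (x ∈ N) := fun x => by rw [B.sel S, hN]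
  have h42 : ∀ z : Fin n, s.arr 42 z = degIn G (· ∈ N) z := by
    intro z
    rw [gather_val (B.holds stCount (by simp [block]))]
    simp [h39]
  have h43 : ∀ z : Fin n, s.arr 43 z = ind (¬ Core G v z ∧ degIn G (· ∈ N) z = 1) := by
    intro z
    rw [gather_ind (B.holds stOnce (by simp [block]))]
    simp [B.core, h42]
  have h28 := B.holds stOnces (by simp [block])
  simp only [stOnces, Stmt.Holds, Expr.evalAt, RAM.envReg] at h28
  simp only [↓reduceIte, h43, sum_ind] at h28
  have h29 := B.holds stOuts (by simp [block])
  simp only [stOuts, Stmt.Holds, evalAt_eNot, Expr.evalAt, RAM.envReg] at h29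
  simp only [↓reduceIte, B.core, ind_eq_zero, sum_ind] at h29
  have h44 : ∀ z : Fin n, s.arr 44 z =
      degIn G (fun z => ¬ Core G v z ∧ degIn G (· ∈ N) z = 1) z := by
    intro z
    rw [gather_val (B.holds stOnceNbrs (by simp [block]))]
    simp [h43]
  have h45 : ∀ z : Fin n, s.arr 45 z =
      degIn G (fun z => ¬ Core G v z ∧ degIn G (· ∈ N) z = 2) z := by
    intro z
    rw [gather_val (B.holds stTwiceNbrs (by simp [block]))]
    simp [B.core, h42]
  rw [gather_ind (B.holds stFeas (by simp [block]))]
  by_cases hu : Cand G v u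
  · have h41 := B.selOwn S hN hNs hβ hu.1
    have h46 : s.arr 46 u = 0 ↔ ∀ z, G.Adj u z → ¬ Core G v z →
        degIn G (· ∈ N) z = if G.Adj (β u) z then 1 else 0 := by
      rw [gather_val (B.holds stWrong (by simp [block]))]
      simp [B.core, h42, h41, B.row, B.adj, ind_eq_ite]
    rw [S.ed_exchange_iff hNs hβ hu, ← h46]
    simp [h20, B.size, B.cand, hu, h41, h44, h45, h28, h29, B.degOut]
  · simp [B.cand, hu]

open Classical in
theorem value (B : Computed G ω v s) (S : Split G ω v own) (h20 : s.reg 20 = n)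
    (hN : ∀ x, x ∈ N ↔ overrideBase G ω v own (Missed G v s) x) (hNs : Sel G v own N)
    (hβ : ∀ w, Core G v w → β w ∈ N ∧ own (β w) = own w) (u : Fin n) :
    s.arr 49 u = if Cand G v u ∧ IsEfficientDominating G (exchange N β u)
      then ∑ x ∈ exchange N β u, ω x else ∑ x, ω x + 1 := by
  have h48 : ∀ x : Fin n, s.arr 48 x = if x ∈ N then ω x else 0 := by
    intro x
    rw [B.holds stSelWeight (by simp [block])]
    simp [B.sel S, ← hN, B.weight]
  have h30 := B.holds stSelWeights (by simp [block])
  simp only [stSelWeights, Stmt.Holds, Expr.evalAt, RAM.envReg] at h30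
  simp only [↓reduceIte, h48] at h30
  rw [B.holds stValue (by simp [block])]
  by_cases hu : Cand G v u ∧ IsEfficientDominating G (exchange N β u)
  · have h1 := hNs.sum_exchange hβ hu.1 ω
    -- This keeps the machine's subtraction from truncating.
    have h2 : ω (β u) ≤ ∑ x ∈ N, ω x :=
      Finset.single_le_sum (f := ω) (fun _ _ => Nat.zero_le _) (hβ u hu.1.1).1
    simp [B.feas S h20 hN hNs hβ, hu, B.selOwn S hN hNs hβ hu.1.1, B.weight, h30]
    omega
  · simp [B.feas S h20 hN hNs hβ, hu, B.top]

theorem split_spec (B : Computed G ω v s) (S : Split G ω v own) (h20 : s.reg 20 = n)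
    (h17 : ∀ u, Core G v u → s.arr 17 u = own u) :
    (s.reg 27 ≠ 0 → ¬ IndFree P2P4 G) ∧ (s.reg 27 = 0 →
      (s.reg 31 < s.reg 7 → ∃ D, IsEfficientDominating G D ∧ ∑ x ∈ D, ω x = s.reg 31 ∧
        ∀ u : Fin n, s.arr 51 u = ind (u ∈ D)) ∧
      ∀ D, IsEfficientDominating G D → v ∈ D → s.reg 31 ≤ ∑ x ∈ D, ω x) := by
  classical
  have hmix := B.mixedMin S h17
  have hmiss : ∀ z : Fin n, s.reg 26 = z → ∀ x, Missed G v s x ↔ Cand G v x ∧ ¬ G.Adj z x := by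
    intro z hz x
    simp only [Missed, hz, Fin.is_lt, true_and, ne_eq, Fin.val_inj]
    refine and_congr_right fun _ => ⟨fun h k => h z k.symm rfl, ?_⟩
    rintro h y k rfl
    exact h k.symm
  have hmiss' : s.reg 26 = n → ∀ x, ¬ Missed G v s x := fun h x hx => by
    have := hx.2.1
    omega
  constructor
  · intro h
    rw [ne_eq, B.flag2 S h20] at h
    push Not at h
    obtain ⟨x, x', hx, hx', hxx, hne⟩ := h
    rcases hmix with ⟨z, ⟨hz, hm⟩, h26⟩ | ⟨h26, -⟩
    · rw [hmiss z h26] at hx hx'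
      exact S.not_indFree_of_mixed hz hm hx.1 hx'.1 hne hxx hx.2 hx'.2
    · exact absurd hx (hmiss' h26 x)
  · intro h
    rw [B.flag2 S h20] at h
    set N : Finset (Fin n) :=
      Finset.univ.filter (overrideBase G ω v own (Missed G v s)) with hNdef
    have hN : ∀ x, x ∈ N ↔ overrideBase G ω v own (Missed G v s) x := by simp [hNdef]
    have hNs : Sel G v own N := S.sel_override (fun x hx => hx.1) h hN
    choose! β hβ using hNs.exists_own
    have hval := B.value S h20 hN hNs hβ
    have hfeas := B.feas S h20 hN hNs hβ
    obtain ⟨h1, h2, h3⟩ := B.holds stValueMin (by simp [block])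
    simp only [Expr.evalAt, RAM.envReg] at h1 h2 h3
    simp only [↓reduceIte, OfNat.ofNat_ne_one, hval] at h2 h3
    have h3' : s.reg 31 = s.reg 7 ∨ ∃ u : Fin n, s.reg 31 =
      if Cand G v u ∧ IsEfficientDominating G (exchange N β u)
      then ∑ x ∈ exchange N β u, ω x else ∑ x, ω x + 1 := by simpa using h3
    clear h3
    constructor
    · intro hlt
      rcases h3' with h3 | ⟨w, hw⟩
      · omega
      · have hwf : Cand G v w ∧ IsEfficientDominating G (exchange N β w) := by
          by_contra k
          rw [if_neg k, ← B.top] at hw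
          omega
        have harg : ∀ u : Fin n, s.arr 50 u =
            if (Cand G v u ∧ IsEfficientDominating G (exchange N β u)) ∧ s.arr 49 u = s.reg 31
            then (u : ℕ) else n := by
          intro u
          rw [B.holds stArg (by simp [block])]
          simp [hfeas, B.size, and_assoc]
        rcases minIndex (B.holds stArgMin (by simp [block])) B.size harg with
          ⟨u, ⟨huf, hu⟩, h32⟩ | ⟨-, hno⟩
        · refine ⟨exchange N β u, huf.2, ?_, fun x => ?_⟩
          · rw [← hu, hval, if_pos huf]
          · rw [gather_ind (B.holds stResult (by simp [block]))]
            simp [h32, B.sel S, ← hN, B.selOwn S hN hNs hβ huf.1.1, Fin.val_inj]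
            refine ind_congr ?_
            simp only [exchange, Finset.mem_insert, Finset.mem_erase]
            tauto
        · exact absurd ⟨hwf, by rw [hval, hw]⟩ (hno w)
    · intro D hD hv
      have : ∃ u, Cand G v u ∧ IsEfficientDominating G (exchange N β u) ∧
          ∑ x ∈ exchange N β u, ω x ≤ ∑ x ∈ D, ω x := by
        rcases hmix with ⟨z, -, h26⟩ | ⟨h26, hno⟩
        · exact S.exists_exchange_of_mixed (hmiss z h26) h hN hβ hD hv
        -- Without a mixed vertex nothing counts as missed, so `N` is the set of all base vertices.
        · refine S.exists_exchange_of_not_mixed (fun z hz hm => hno z ⟨hz, hm⟩) (N := N) (fun x => ?_)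
            hβ hD hv
          rw [hN, overrideBase]
          simp [hmiss' h26]
      obtain ⟨u, hu, hed, hle⟩ := this
      have h4 := h2 u
      rw [if_pos ⟨hu, hed⟩] at h4
      omega

/-- The result of the computation for the vertex `v`. -/
theorem spec (B : Computed G ω v s) {y : Fin n} (hy : G.Adj v y) :
    (s.reg 33 ≠ 0 → ¬ IndFree P2P4 G) ∧ (s.reg 33 = 0 →
      (s.reg 31 < s.reg 7 → ∃ D, IsEfficientDominating G D ∧ ∑ x ∈ D, ω x = s.reg 31 ∧
        ∀ u : Fin n, s.arr 51 u = ind (u ∈ D)) ∧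
      ∀ D, IsEfficientDominating G D → v ∈ D → s.reg 31 ≤ ∑ x ∈ D, ω x) := by
  have h33 : s.reg 33 = s.reg 24 + (s.reg 34 + s.reg 27) := by
    have := B.holds stFlag (by simp [block])
    simpa [stFlag, Stmt.Holds] using this
  rcases B.badMin with ⟨c, ⟨hc, hbad⟩, h20⟩ | ⟨h20, hgood⟩
  -- There is a bad vertex. The tests on register `20` switch off the two later flags and all
  -- exchanges, so only the join test decides and the value found is infinite.
  · have h34 : s.reg 34 = 0 := B.mismatches.2 (.inl (by rw [h20]; exact c.2))
    have h27 : s.reg 27 = 0 := by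
      have := B.holds stFlag2 (by simp [block])
      simp only [stFlag2, Stmt.Holds] at this
      simp [h20, B.size] at this
      rw [this]
      simp [ind]
    have h31 : s.reg 31 = s.reg 7 := by
      have h49 : ∀ u : Fin n, s.arr 49 u = s.reg 7 := by
        intro u
        have h47 : s.arr 47 u = 0 := by
          rw [gather_ind (B.holds stFeas (by simp [block]))]
          simp [h20, B.size]
        rw [B.holds stValue (by simp [block])]
        simp [h47]
      obtain ⟨-, -, h3⟩ := B.holds stValueMin (by simp [block])
      simp [h49] at h3
      tauto
    rw [h33, h34, h27]
    obtain ⟨h1, h2⟩ := B.bad_spec hy h20 hc hbad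
    exact ⟨h1, fun h => ⟨fun k => by omega, fun D hD hv => absurd hv (h2 h D hD)⟩⟩
  · have h24 := B.flag1_of_noBad h20
    obtain ⟨h1, h2⟩ := B.split hy h20 hgood
    rw [h33, h24]
    by_cases h34 : s.reg 34 = 0
    · obtain ⟨own, S, h17⟩ := h2 h34
      rw [h34, zero_add, zero_add]
      exact B.split_spec S h20 h17
    · exact ⟨fun _ => h1 h34, fun h => by omega⟩

end Computed
end WED

namespace WED
open RAM (nbrs mem_nbrs Expr Stmt Prog State Ensures Frame HasGraph offset forVertices forNeighbors
  seqProg seqCost)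

/-! ### The program -/

/-- Stores the adjacency matrix in array `4` and the multiples of `n` in array `5`. -/
def buildMatrix : Prog := forVertices (.seq (.store 5 (.reg 1) (.reg 9))
  (.seq (forNeighbors 1 (.store 4 (.add (.reg 9) (.reg 2)) (.const 1)))
    (.assign 9 (.add (.reg 9) (.reg 0)))))

/-- Computes the value `∑ ω + 1`, which stands for infinity. -/
def prepare : List Stmt :=
  [.total 10 (.load 2 (.reg 1)), .assign 7 (.add (.reg 10) (.const 1)), .assign 8 (.reg 7)]

/-- Stores the solution that has been found for the current vertex. -/
def save : List Stmt :=
  [.gather 3 (.const 0) (.load 51 (.reg 1)) (.const 1) (.const 0), .assign 8 (.reg 31)]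

def treatVertex : Prog := .seq (seqProg block) (.seq (.assign 6 (.add (.reg 6) (.reg 33)))
  (.ite (.sub (.reg 8) (.reg 31)) (seqProg save) .skip))

/-- Isolated vertices are skipped: the argument for `v` uses a neighbour of `v`, and the time bound
needs at most 2m treated vertices. -/
def search : Prog := .loop (.sub (.reg 0) (.reg 5))
  (.seq (.ite (.sub (.load 0 (.add (.reg 5) (.const 1))) (.load 0 (.reg 5))) treatVertex .skip)
    (.assign 5 (.add (.reg 5) (.const 1))))

def report : Prog := .ite (.reg 6) (.assign 0 (.const 2))
  (.ite (.sub (.reg 7) (.reg 8)) (.assign 0 (.const 0)) (.assign 0 (.const 1)))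

def allVertices : List Stmt := [.gather 3 (.const 0) (.const 1) (.const 1) (.const 1)]

/-- Cell `n` of array `0` is the total length of the adjacency lists, which is 2m, so this tests for
an edge. -/
def solver : Prog := .ite (.load 0 (.reg 0))
  (.seq buildMatrix (.seq (seqProg prepare) (.seq search report)))
  (.seq (seqProg allVertices) (.assign 0 (.const 0)))

section
variable {n : ℕ} {G : SimpleGraph (Fin n)} {L : Fin n → List (Fin n)} {ω : Fin n → ℕ}

theorem mul_add_inj {u w x y : ℕ} (hx : x < n) (hy : y < n) :
    u * n + x = w * n + y ↔ u = w ∧ x = y := by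
  refine ⟨fun h => ?_, by rintro ⟨rfl, rfl⟩; rfl⟩
  have hn : 0 < n := by omega
  have h1 := congrArg (· / n) h
  have h2 := congrArg (· % n) h
  simp only [mul_comm _ n, Nat.mul_add_div hn, Nat.div_eq_of_lt hx,
    Nat.div_eq_of_lt hy, Nat.mul_add_mod, Nat.mod_eq_of_lt hx, Nat.mod_eq_of_lt hy] at h1 h2
  omega

/-- Array `4` is initially zero, so only the ones are written and the matrix costs O(n+m). Row
starts are found by repeated addition, as there is no multiplication. -/
theorem ensures_buildMatrix (hL : IsAdjLists G L) {s : State} (hs : HasGraph L s)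
    (h9 : s.reg 9 = 0) (h4 : ∀ i, s.arr 4 i = 0) :
    Ensures buildMatrix s (25 * (n + offset L n + 1)) (fun s' => Frame [9] [4, 5] s s' ∧
      (∀ u x : Fin n, s'.arr 4 (u * n + x) = ind (G.Adj u x)) ∧
      ∀ u : Fin n, s'.arr 5 u = u * n) := by
  let Inv : ℕ → State → Prop := fun i s₁ => Frame [9] [4, 5] s s₁ ∧ s₁.reg 1 = i ∧
    s₁.reg 9 = i * n ∧ (∀ u x : Fin n, s₁.arr 4 (u * n + x) = ind (u < i ∧ G.Adj u x)) ∧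
    ∀ u : Fin n, u < i → s₁.arr 5 u = u * n
  refine (RAM.ensures_forVertices (n := n)
    (fun i => (if h : i < n then (L ⟨i, h⟩).length * 19 else 0) + 17) Inv ?_ ?_ ?_).mono ?_ ?_
  · rintro i s₁ ⟨hF, h1, _⟩
    exact ⟨h1, (hF.hasGraph (by simp) (by simp) (by simp) hs).size⟩
  · rintro u s₁ ⟨hF, h1, h9₁, h4₁, h5₁⟩
    have hs₁ : HasGraph L s₁ := hF.hasGraph (by simp) (by simp) (by simp) hs
    let J : ℕ → State → Prop := fun k s₂ => Frame [9] [4, 5] s s₂ ∧ s₂.reg 1 = u ∧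
      s₂.reg 3 = offset L u + k ∧ s₂.reg 9 = u * n ∧
      (∀ w x : Fin n, s₂.arr 4 (w * n + x) =
        ind ((w < u ∧ G.Adj w x) ∨ (w = u ∧ x ∈ (L u).take k))) ∧
      ∀ w : Fin n, w < (u + 1 : ℕ) → s₂.arr 5 w = w * n
    have hinner : ∀ s₂, s₂ = s₁.setArr 5 u (u * n) → Ensures
        (forNeighbors 1 (.store 4 (.add (.reg 9) (.reg 2)) (.const 1))) s₂
        ((L u).length * (5 + 14) + 10) (J (L u).length) := by
      rintro _ rfl
      refine RAM.ensures_forNeighbors 1 u _ J ?_ ?_ ?_ ?_ ?_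
      · rintro i s₂ ⟨hF₂, h1₂, h3₂, _⟩
        exact ⟨hF₂.hasGraph (by simp) (by simp) (by simp) hs, h1₂, h3₂⟩
      · rintro i hi s₂ ⟨hF₂, h1₂, h3₂, h9₂, h4₂, h5₂⟩
        refine Ensures.store ?_
        simp only [Expr.eval, State.setReg_self, State.setReg_of_ne _ _ (show 9 ≠ 2 by simp), h9₂]
        refine ⟨?_, ?_, ?_, ?_, ?_, ?_, ?_⟩
        · simp [State.setReg_of_ne, h3₂]
        · exact ((hF₂.setReg (by simp) _).setArr (by simp) _ _).setReg (by simp) _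
        · simp [State.setReg_of_ne, h1₂]
        · simp
        · simp [State.setReg_of_ne, h9₂]
        · intro w x
          rw [State.setReg_arr, State.setArr_self, State.setReg_arr, h4₂,
            List.take_add_one]
          simp only [mul_add_inj x.2 (Fin.is_lt _), List.mem_append, Fin.val_inj]
          split_ifs with h
          · rw [eq_comm, ind_eq_one]
            simp [h, hi]
          · refine ind_congr ?_
            simp only [List.getElem?_eq_getElem hi, Option.toList_some, List.mem_singleton]
            tauto
        · intro w hw
          rw [State.setReg_arr, State.setArr_of_ne _ _ _ (by simp), State.setReg_arr, h5₂ w hw]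
      · exact hs₁.congr rfl (State.setArr_of_ne _ _ _ (by simp)) (State.setArr_of_ne _ _ _ (by simp))
      · simp [h1]
      · refine ⟨(hF.setArr (by simp) _ _).setReg (by simp) _, ?_, by simp, ?_, ?_, ?_⟩
        · simp [State.setReg_of_ne, h1]
        · simp [State.setReg_of_ne, h9₁]
        · intro w x
          rw [State.setReg_arr, State.setArr_of_ne _ _ _ (by simp), h4₁]
          simp
        · intro w hw
          rw [State.setReg_arr, State.setArr_self]
          split_ifs with h
          · rw [h]
          · exact h5₁ w (by omega)
    refine ((Ensures.store (Q := fun s₂ => s₂ = s₁.setArr 5 u (u * n)) ?_).seq fun s₂ hs₂ =>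
      (hinner s₂ hs₂).seq (T' := 4) fun s₃ hs₃ => Ensures.assign ?_).mono ?_ fun _ h => h
    · simp [Expr.eval, h1, h9₁]
    · obtain ⟨hF₃, h1₃, -, h9₃, h4₃, h5₃⟩ := hs₃
      refine ⟨?_, ?_, ?_, ?_, ?_, ?_⟩
      · simp [State.setReg_of_ne, h1₃]
      · exact (hF₃.setReg (by simp) _).setReg (by simp) _
      · simp
      · rw [State.setReg_of_ne _ _ (by simp), State.setReg_self]
        simp only [Expr.eval, h9₃, (hF₃.hasGraph (by simp) (by simp) (by simp) hs).size]
        ring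
      · intro w x
        rw [State.setReg_arr, State.setReg_arr, h4₃, List.take_length]
        refine ind_congr ?_
        rw [(hL u).2, Nat.lt_succ_iff_lt_or_eq, Fin.val_inj, Fin.lt_def]
        constructor
        · rintro (h | ⟨rfl, h⟩)
          · exact ⟨.inl h.1, h.2⟩
          · exact ⟨.inr rfl, h⟩
        · rintro ⟨h | rfl, h'⟩
          · exact .inl ⟨h, h'⟩
          · exact .inr ⟨rfl, h'⟩
      · exact h5₃
    · simp only [Expr.cost, Fin.is_lt, dif_pos, Fin.eta]
      omega
  · refine ⟨(Frame.refl _ _ s).setReg (by simp) _, by simp, ?_, ?_, fun w hw => by omega⟩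
    · simp [State.setReg_of_ne, h9]
    · simp [h4, ind]
  · simp only [Finset.sum_add_distrib, Finset.sum_const, Finset.card_range, smul_eq_mul,
      RAM.offset_eq_sum]
    rw [← Fin.sum_univ_eq_sum_range (fun i => if h : i < n then (L ⟨i, h⟩).length * 19 else 0)]
    simp only [Fin.is_lt, dif_pos, Fin.eta, ← Finset.sum_mul]
    omega
  · rintro s' ⟨hF, -, -, h4', h5'⟩
    exact ⟨hF, fun u x => by simpa using h4' u x, fun u => h5' u u.2⟩

/-- The memory holds the graph, its adjacency matrix, the weights and a bound on the weights. -/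
structure Prepared (G : SimpleGraph (Fin n)) (L : Fin n → List (Fin n)) (ω : Fin n → ℕ)
    (s : State) : Prop where
  graph : HasGraph L s
  top : s.reg 7 = ∑ u, ω u + 1
  weight : ∀ u : Fin n, s.arr 2 u = ω u
  adj : ∀ u x : Fin n, s.arr 4 (u * n + x) = ind (G.Adj u x)
  row : ∀ u : Fin n, s.arr 5 u = u * n

theorem Prepared.frame {s s' : State} (h : Prepared G L ω s) {wr wa : List ℕ}
    (hF : Frame wr wa s s') (hr : 0 ∉ wr ∧ 7 ∉ wr)
    (ha : 0 ∉ wa ∧ 1 ∉ wa ∧ 2 ∉ wa ∧ 4 ∉ wa ∧ 5 ∉ wa) : Prepared G L ω s' where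
  graph := hF.hasGraph hr.1 ha.1 ha.2.1 h.graph
  top := by rw [hF.reg 7 hr.2 (by simp) (by simp) (by simp) (by simp), h.top]
  weight := by rw [hF.arr 2 ha.2.2.1]; exact h.weight
  adj := by rw [hF.arr 4 ha.2.2.2.1]; exact h.adj
  row := by rw [hF.arr 5 ha.2.2.2.2]; exact h.row

/-- The state of the search after the vertices below `i` have been treated. -/
structure Searched (G : SimpleGraph (Fin n)) (ω : Fin n → ℕ) (i : ℕ) (s : State) : Prop where
  le_top : s.reg 8 ≤ s.reg 7
  flag : s.reg 6 ≠ 0 → ¬ IndFree P2P4 G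
  found : s.reg 6 = 0 → s.reg 8 < s.reg 7 → ∃ D, IsEfficientDominating G D ∧
    ∑ x ∈ D, ω x = s.reg 8 ∧ ∀ u : Fin n, s.arr 3 u = ind (u ∈ D)
  le : s.reg 6 = 0 → ∀ D, IsEfficientDominating G D → ∀ v ∈ D, v < i → ∀ y, G.Adj v y →
    s.reg 8 ≤ ∑ x ∈ D, ω x

theorem Searched.congr {i j : ℕ} {s s' : State} (h : Searched G ω i s)
    (h6 : s'.reg 6 = s.reg 6) (h7 : s'.reg 7 = s.reg 7) (h8 : s'.reg 8 = s.reg 8)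
    (h3 : s'.arr 3 = s.arr 3)
    (hj : ∀ v : Fin n, v < j → ∀ y, G.Adj v y → v < i) : Searched G ω j s' where
  le_top := by rw [h7, h8]; exact h.le_top
  flag := by rw [h6]; exact h.flag
  found := by rw [h6, h7, h8, h3]; exact h.found
  le := by
    rw [h6, h8]
    exact fun h0 D hD v hv hvj y hy => h.le h0 D hD v hv (hj v hvj y hy) y hy

theorem ensures_treatVertex (hL : IsAdjLists G L) {v y : Fin n} (hy : G.Adj v y) {s : State}
    (hP : Prepared G L ω s) (h5 : s.reg 5 = v) (hS : Searched G ω v s) :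
    Ensures treatVertex s ((seqCost block + seqCost save + 8) * (n + offset L n + 1))
      (fun s' => s'.reg 5 = v ∧ Prepared G L ω s' ∧ Searched G ω (v + 1) s') := by
  have hb : ∀ r < 20, r ∉ block.flatMap Stmt.wregs := fun r hr h => by
    have := wregs_block r h
    omega
  have hb' : ∀ a < 10, a ∉ block.flatMap Stmt.warrs := fun a ha h => by
    have := warrs_block a h
    omega
  refine ((RAM.ensures_seqProg hL ssa_block hP.graph).seq
    (T' := 4 + (4 + seqCost save * (n + offset L n + 1))) (Q' := fun s' => s'.reg 5 = v ∧
      Prepared G L ω s' ∧ Searched G ω (v + 1) s') ?_).mono ?_ fun _ h => h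
  · rintro s₁ ⟨hB, hG₁, hF₁⟩
    have hP₁ : Prepared G L ω s₁ := hP.frame hF₁ ⟨hb _ (by simp), hb _ (by simp)⟩
      ⟨hb' _ (by simp), hb' _ (by simp), hb' _ (by simp), hb' _ (by simp), hb' _ (by simp)⟩
    have hreg : ∀ r < 20, 4 < r → s₁.reg r = s.reg r := fun r h h' =>
      hF₁.reg r (hb r h) (by omega) (by omega) (by omega) (by omega)
    have h5₁ : s₁.reg 5 = v := by rw [hreg 5 (by simp) (by simp), h5]
    have hS₁ : Searched G ω v s₁ := hS.congr (hreg 6 (by simp) (by simp))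
      (hreg 7 (by simp) (by simp)) (hreg 8 (by simp) (by simp)) (hF₁.arr 3 (hb' _ (by simp)))
      fun w hw _ _ => hw
    have hC : Computed G ω v s₁ :=
      ⟨hG₁.size, h5₁, hP₁.top, hP₁.weight, hP₁.adj, hP₁.row, hB⟩
    obtain ⟨hflag, hres⟩ := hC.spec hy
    refine (Ensures.assign (Q := fun s₂ => s₂ = s₁.setReg 6 (s₁.reg 6 + s₁.reg 33)) rfl).seq ?_
    rintro s₂ rfl
    have hF₂ : Frame [6] [] s₁ (s₁.setReg 6 (s₁.reg 6 + s₁.reg 33)) :=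
      (Frame.refl _ _ _).setReg (by simp) _
    have hP₂ := hP₁.frame hF₂ (by simp) (by simp)
    set s₂ := s₁.setReg 6 (s₁.reg 6 + s₁.reg 33) with hs₂
    have h6 : s₂.reg 6 = s₁.reg 6 + s₁.reg 33 := by simp [hs₂]
    have hr₂ : ∀ r, r ≠ 6 → s₂.reg r = s₁.reg r := fun r hr => State.setReg_of_ne _ _ hr
    have hflag₂ : s₂.reg 6 ≠ 0 → ¬ IndFree P2P4 G := fun h => by
      rw [h6] at h
      by_cases h' : s₁.reg 6 = 0
      · exact hflag (by omega)
      · exact hS₁.flag h'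
    refine Ensures.ite (fun h => ?_) fun h => ?_
    · simp only [Expr.eval, hr₂ 8 (by simp), hr₂ 31 (by simp)] at h
      refine (RAM.ensures_seqProg hL (l := save) (by decide) hP₂.graph).mono le_rfl ?_
      rintro s₃ ⟨hh, -, hF₃⟩
      have hF₃' : Frame [8] [3] s₂ s₃ := hF₃
      have hr₃ : ∀ r, r ≠ 8 → 4 < r → s₃.reg r = s₂.reg r := fun r h h' =>
        hF₃'.reg r (by simpa) (by omega) (by omega) (by omega) (by omega)
      have h3 : ∀ u : Fin n, s₃.arr 3 u = if s₁.arr 51 u = 0 then 0 else 1 := fun u => by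
        have := hh _ (List.mem_cons_self ..) u
        simp [Expr.evalAt, RAM.envReg, hF₃'.arr 51 (by simp)] at this
        exact this
      have h8 : s₃.reg 8 = s₁.reg 31 := by
        have := hh (.assign 8 (.reg 31)) (by simp [save])
        simp only [Stmt.Holds, Expr.evalAt, RAM.envReg] at this
        simpa [hr₃ 31 (by simp) (by simp), hr₂] using this
      have h7 : s₃.reg 7 = s₁.reg 7 := by rw [hr₃ 7 (by simp) (by simp), hr₂ 7 (by simp)]
      have h6₃ : s₃.reg 6 = s₂.reg 6 := hr₃ 6 (by simp) (by simp)
      refine ⟨by rw [hr₃ 5 (by simp) (by simp), hr₂ 5 (by simp), h5₁],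
        hP₂.frame hF₃' (by simp) (by simp), ?_, ?_, ?_, ?_⟩
      · have := hS₁.le_top
        omega
      · rwa [h6₃]
      · rw [h6₃, h7, h8]
        intro h0 hlt
        obtain ⟨D, hD, hsum, hind⟩ := (hres (by omega)).1 hlt
        refine ⟨D, hD, hsum, fun u => ?_⟩
        rw [h3, hind]
        by_cases hu : u ∈ D <;> simp [ind, hu]
      · rw [h6₃, h8]
        intro h0 D hD w hw hwv z hz
        rcases Nat.lt_succ_iff_lt_or_eq.1 hwv with hlt | heq
        · have := hS₁.le (by omega) D hD w hw hlt z hz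
          omega
        · rw [Fin.ext heq] at hw
          exact (hres (by omega)).2 D hD hw
    · simp only [Expr.eval, hr₂ 8 (by simp), hr₂ 31 (by simp)] at h
      refine (Ensures.skip ?_).mono (T := 1) ?_ fun _ h => h
      · refine ⟨by rw [hr₂ 5 (by simp), h5₁], hP₂, ?_, hflag₂, ?_, ?_⟩
        · rw [hr₂ 8 (by simp), hr₂ 7 (by simp)]
          exact hS₁.le_top
        · rw [hr₂ 8 (by simp), hr₂ 7 (by simp)]
          exact fun h0 => hS₁.found (by omega)
        · rw [hr₂ 8 (by simp)]
          intro h0 D hD w hw hwv z hz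
          rcases Nat.lt_succ_iff_lt_or_eq.1 hwv with hlt | heq
          · exact hS₁.le (by omega) D hD w hw hlt z hz
          · rw [Fin.ext heq] at hw
            have := (hres (by omega)).2 D hD hw
            omega
      · have : 1 ≤ seqCost save := by simp [seqCost]
        nlinarith [Nat.zero_le (seqCost save * (n + offset L n))]
  · ring_nf
    omega

/-- The part of a treatment proportional to `n + 1` is charged to the degree of the treated vertex,
which is at least one; the part proportional to 2m is charged to every vertex. Both add up to O(nm)
when there is an edge. -/
theorem ensures_search (hL : IsAdjLists G L) {s : State} (hP : Prepared G L ω s)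
    (h5 : s.reg 5 = 0) (hS : Searched G ω 0 s) :
    Ensures search s ((seqCost block + seqCost save + 30) *
        (offset L n * (n + 1) + n * offset L n + n + 1))
      (fun s' => Prepared G L ω s' ∧ Searched G ω n s') := by
  set K := seqCost block + seqCost save + 8 with hK
  refine (Ensures.loop n (fun i => (if h : i < n then (L ⟨i, h⟩).length * (K * (n + 1)) else 0) +
    K * offset L n + 15) (fun i s₁ => s₁.reg 5 = i ∧ Prepared G L ω s₁ ∧ Searched G ω i s₁)
    ?_ ?_ ⟨h5, hP, hS⟩).mono ?_ fun _ h => h.2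
  · rintro i s₁ hi ⟨h5₁, hP₁, -⟩
    simp [Expr.eval, h5₁, hP₁.graph.size]
  · rintro i s₁ hi ⟨h5₁, hP₁, hS₁⟩
    refine (Ensures.seq (Q := fun s₂ => s₂.reg 5 = i ∧ Prepared G L ω s₂ ∧ Searched G ω (i + 1) s₂)
      (Ensures.ite (T := (L ⟨i, hi⟩).length * (K * (n + 1)) + K * offset L n + 1) ?_ ?_)
      (T' := 4) (Q' := fun s₂ => s₂.reg 5 = i + 1 ∧ Prepared G L ω s₂ ∧ Searched G ω (i + 1) s₂)
      ?_).mono ?_ fun _ h => h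
    · intro h
      simp only [Expr.eval, h5₁, hP₁.graph.start (i + 1) hi, hP₁.graph.start i hi.le,
        RAM.offset_succ L ⟨i, hi⟩, Nat.add_sub_cancel_left] at h
      obtain ⟨y, hy⟩ := List.exists_mem_of_length_pos (Nat.pos_of_ne_zero h)
      refine (ensures_treatVertex hL (((hL _).2 y).1 hy) hP₁ h5₁ hS₁).mono ?_ fun _ h => h
      have : 1 * (K * (n + 1)) ≤ (L ⟨i, hi⟩).length * (K * (n + 1)) :=
        Nat.mul_le_mul_right _ (by omega)
      rw [← hK]
      nlinarith
    · intro h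
      simp only [Expr.eval, h5₁, hP₁.graph.start (i + 1) hi, hP₁.graph.start i hi.le,
        RAM.offset_succ L ⟨i, hi⟩, Nat.add_sub_cancel_left] at h
      refine (Ensures.skip ?_).mono (by omega) fun _ h => h
      refine ⟨h5₁, hP₁, hS₁.congr rfl rfl rfl rfl fun w hw y hy => ?_⟩
      rcases Nat.lt_succ_iff_lt_or_eq.1 hw with hlt | rfl
      · exact hlt
      · rw [← (hL w).2, List.eq_nil_of_length_eq_zero h] at hy
        simp at hy
    · rintro s₂ ⟨h5₂, hP₂, hS₂⟩
      refine Ensures.assign ⟨by simp [Expr.eval, h5₂], hP₂.frame (wr := [5]) (wa := [])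
        ((Frame.refl _ _ _).setReg (by simp) _) (by simp) (by simp), hS₂.congr ?_ ?_ ?_ rfl
          fun w hw _ _ => hw⟩ <;> simp [State.setReg_of_ne]
    · simp only [Expr.cost, hi, dif_pos]
      omega
  · simp only [Finset.sum_add_distrib, Finset.sum_const, Finset.card_range, smul_eq_mul]
    rw [← Fin.sum_univ_eq_sum_range (fun i => if h : i < n then (L ⟨i, h⟩).length * (K * (n + 1))
      else 0)]
    simp only [Fin.is_lt, dif_pos, ← Finset.sum_mul, ← RAM.offset_eq_sum, Expr.cost]
    rw [show seqCost block + seqCost save + 30 = K + 22 by omega]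
    generalize offset L n = M
    have h1 : 0 ≤ M * (n + 1) := Nat.zero_le _
    have h2 : 0 ≤ K * n := Nat.zero_le _
    nlinarith [Nat.zero_le (n * M)]

theorem ensures_report (hn : ∃ x y, G.Adj x y) {s : State} (hP : Prepared G L ω s)
    (hS : Searched G ω n s) :
    Ensures report s 20 (fun s' => IsWEDAnswer G ω s' ∨ s'.reg 0 = 2 ∧ ¬ IndFree P2P4 G) := by
  have hle : s.reg 6 = 0 → ∀ D, IsEfficientDominating G D → s.reg 8 ≤ ∑ x ∈ D, ω x := by
    intro h0 D hD
    obtain ⟨x, y, hxy⟩ := hn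
    -- An end of an edge is dominated by a vertex that has a neighbour, so every e.d. has a member
    -- that was treated.
    obtain ⟨d, hd, rfl | h⟩ := ed_exists hD x
    · exact hS.le h0 D hD d hd d.2 y hxy
    · exact hS.le h0 D hD d hd d.2 x h
  refine (Ensures.ite (T := 15) (fun h => (Ensures.assign ?_).mono (by simp [Expr.cost])
    fun _ h => h) fun h => (Ensures.ite (T := 2) (fun h' => Ensures.assign ?_)
      fun h' => Ensures.assign ?_).mono (by simp [Expr.cost]) fun _ h => h).mono
        (by simp [Expr.cost]) fun _ h => h
  · exact .inr ⟨by simp [Expr.eval], hS.flag h⟩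
  · simp only [Expr.eval] at h h'
    obtain ⟨D, hD, hsum, hind⟩ := hS.found h (by omega)
    refine .inl (.inl ⟨by simp [Expr.eval], ?_⟩)
    have : outputSet n (s.setReg 0 (Expr.eval s (.const 0))) = D := by
      ext u
      simp [outputSet, hind]
    rw [this]
    exact ⟨hD, fun D' hD' => by rw [hsum]; exact hle h D' hD'⟩
  · simp only [Expr.eval] at h h'
    refine .inl (.inr ⟨by simp [Expr.eval], fun D hD => ?_⟩)
    have h1 := hle h D hD
    have h2 : ∑ x ∈ D, ω x ≤ ∑ x, ω x := Finset.sum_le_univ_sum_of_nonneg fun _ => Nat.zero_le _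
    have h3 := hP.top
    omega

/-- Without edges every vertex dominates only itself, so the set of all vertices is the one e.d. -/
theorem ensures_allVertices (hL : IsAdjLists G L) (hG : ∀ x y, ¬ G.Adj x y) {s : State}
    (hs : HasGraph L s) :
    Ensures (.seq (seqProg allVertices) (.assign 0 (.const 0))) s
      (seqCost allVertices * (n + offset L n + 1) + 2) (IsWEDAnswer G ω) := by
  refine (RAM.ensures_seqProg hL (l := allVertices) (by decide) hs).seq ?_
  rintro s₁ ⟨hh, -, -⟩
  have h3 : ∀ u : Fin n, s₁.arr 3 u = 1 := fun u => by
    have := hh _ (List.mem_cons_self ..) u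
    simpa [Expr.evalAt] using this
  refine Ensures.assign (.inl ⟨by simp [Expr.eval], ?_⟩)
  have : outputSet n (s₁.setReg 0 (Expr.eval s₁ (.const 0))) = Finset.univ := by
    ext u
    simp [outputSet, h3]
  rw [this]
  refine ⟨fun x => ⟨x, by simp, by simp [hG]⟩, fun D hD => ?_⟩
  refine (Finset.sum_le_sum_of_subset fun x _ => ?_)
  obtain ⟨d, hd, rfl | h⟩ := ed_exists hD x
  · exact hd
  · exact absurd h (hG d x)

theorem offset_eq_twice_ncard (hL : IsAdjLists G L) : offset L n = 2 * G.edgeSet.ncard := by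
  classical
  rw [RAM.offset_eq_sum, Set.ncard_eq_toFinset_card', ← SimpleGraph.edgeFinset,
    ← SimpleGraph.sum_degrees_eq_twice_card_edges]
  refine Finset.sum_congr rfl fun u _ => ?_
  rw [RAM.length_adjList hL, ← SimpleGraph.card_neighborFinset_eq_degree]
  congr 1
  ext x
  simp

theorem ensures_solver (hL : IsAdjLists G L) : Ensures solver (inputState L ω)
    (if G.edgeSet.ncard = 0 then (seqCost allVertices + 5) * (n + 1) else
      (3 + 25 * 4 + seqCost prepare * 4 + (seqCost block + seqCost save + 30) * 8 + 20) *
        (n * G.edgeSet.ncard))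
    (fun s' => IsWEDAnswer G ω s' ∨ s'.reg 0 = 2 ∧ ¬ IndFree P2P4 G) := by
  have hM := offset_eq_twice_ncard hL
  have hs := RAM.hasGraph_inputState L ω
  have hguard : (Expr.load 0 (.reg 0)).eval (inputState L ω) = 2 * G.edgeSet.ncard := by
    rw [← hM, ← hs.start n le_rfl]
    simp [Expr.eval, hs.size]
  split_ifs with hm
  · refine (Ensures.ite (T := seqCost allVertices * (n + 1) + 2) (fun h => ?_) fun _ => ?_).mono
      ?_ fun _ h => h
    · omega
    · rw [hm] at hM
      have hG : ∀ x y, ¬ G.Adj x y := by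
        intro x y hxy
        rw [Set.ncard_eq_zero (Set.toFinite _)] at hm
        have : s(x, y) ∈ G.edgeSet := hxy
        simp [hm] at this
      refine (ensures_allVertices hL hG hs).mono ?_ fun _ h => .inl h
      simp [hM]
    · simp only [Expr.cost]
      nlinarith
  · have hn : ∃ x y, G.Adj x y := by
      by_contra! h
      refine hm ?_
      rw [Set.ncard_eq_zero (Set.toFinite _), SimpleGraph.edgeSet_eq_empty]
      ext x y
      simp [h]
    have hn1 : 1 ≤ n := by
      obtain ⟨x, -⟩ := hn
      have := x.2
      omega
    refine (Ensures.ite (T := 25 * (n + offset L n + 1) + (seqCost prepare * (n + offset L n + 1) +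
      ((seqCost block + seqCost save + 30) * (offset L n * (n + 1) + n * offset L n + n + 1) + 20)))
      (fun _ => ?_) fun h => ?_).mono ?_ fun _ h => h
    · refine (ensures_buildMatrix hL hs (by simp [inputState]) (by simp [inputState])).seq ?_
      rintro s₁ ⟨hF₁, h4₁, h5₁⟩
      have hs₁ : HasGraph L s₁ := hF₁.hasGraph (by simp) (by simp) (by simp) hs
      refine (RAM.ensures_seqProg hL (l := prepare) (by decide) hs₁).seq ?_
      rintro s₂ ⟨hh, hs₂, hF₂⟩
      have hF₂' : Frame [10, 7, 8] [] s₁ s₂ := hF₂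
      have hF : Frame ([9] ++ [10, 7, 8]) ([4, 5] ++ []) (inputState L ω) s₂ := hF₁.trans hF₂'
      have hw : ∀ u : Fin n, s₂.arr 2 u = ω u := fun u => by
        rw [hF.arr 2 (by simp)]
        simp [inputState]
      have h10 : s₂.reg 10 = ∑ u, ω u := by
        have := hh (.total 10 (.load 2 (.reg 1))) (by simp [prepare])
        simpa [Stmt.Holds, Expr.evalAt, RAM.envReg, hw] using this
      have h7 : s₂.reg 7 = ∑ u, ω u + 1 := by
        have := hh (.assign 7 (.add (.reg 10) (.const 1))) (by simp [prepare])
        simpa [Stmt.Holds, Expr.evalAt, RAM.envReg, h10] using this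
      have h8 : s₂.reg 8 = s₂.reg 7 := by
        have := hh (.assign 8 (.reg 7)) (by simp [prepare])
        simpa [Stmt.Holds, Expr.evalAt, RAM.envReg] using this
      have h5 : s₂.reg 5 = 0 := by
        rw [hF.reg 5 (by simp) (by simp) (by simp) (by simp) (by simp)]
        simp [inputState]
      have h6 : s₂.reg 6 = 0 := by
        rw [hF.reg 6 (by simp) (by simp) (by simp) (by simp) (by simp)]
        simp [inputState]
      have hP : Prepared G L ω s₂ := ⟨hs₂, h7, hw, by rw [hF₂'.arr 4 (by simp)]; exact h4₁,
        by rw [hF₂'.arr 5 (by simp)]; exact h5₁⟩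
      refine (ensures_search hL hP h5 ⟨h8.le, fun h => absurd h6 h, fun _ h => by omega,
        fun _ _ _ _ _ h => by omega⟩).seq fun s₃ hs₃ => ensures_report hn hs₃.1 hs₃.2
    · omega
    · rw [hM]
      simp only [Expr.cost]
      generalize G.edgeSet.ncard = m at hm ⊢
      have hm1 : 1 ≤ m := Nat.one_le_iff_ne_zero.2 hm
      have hnm : n ≤ n * m := Nat.le_mul_of_pos_right _ hm1
      have hmn : m ≤ n * m := Nat.le_mul_of_pos_left _ hn1
      -- As `n` and `m` are positive, each of `n`, `m` and `1` is at most `n * m`; this is where the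
      -- case of no edges has to be separate.
      have e1 : n + 2 * m + 1 ≤ 4 * (n * m) := by omega
      have e2 : 2 * m * (n + 1) + n * (2 * m) + n + 1 ≤ 8 * (n * m) := by
        have : 2 * m * (n + 1) + n * (2 * m) + n + 1 = 4 * (n * m) + 2 * m + n + 1 := by ring
        omega
      have e3 := Nat.mul_le_mul_left (seqCost prepare) e1
      have e4 := Nat.mul_le_mul_left (seqCost block + seqCost save + 30) e2
      nlinarith
end
end WED

open WED in
theorem mainTheorem2 :
    (∃ (p : RAM.Prog) (C : ℕ),
      SolvesWEDRobustly p P2P4 (fun n m => if m = 0 then C * (n + 1) else C * (n * m))) ∧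
    (∃ (p : RAM.Prog) (q : Polynomial ℕ),
      SolvesWED p P2P3 (fun n m => q.eval (n + m))) := by
  set C := max (RAM.seqCost allVertices + 5)
    (3 + 25 * 4 + RAM.seqCost prepare * 4 +
      (RAM.seqCost block + RAM.seqCost save + 30) * 8 + 20) with hC
  have key : SolvesWEDRobustly solver P2P4
      (fun n m => if m = 0 then C * (n + 1) else C * (n * m)) := by
    intro n G ω L hL
    refine (ensures_solver hL).mono ?_ fun _ h => h
    beta_reduce
    split_ifs
    · exact Nat.mul_le_mul_right _ (le_max_left _ _)
    · exact Nat.mul_le_mul_right _ (le_max_right _ _)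
  -- The square of `n + m + 1` bounds both `n + 1` and `n * m`.
  refine ⟨⟨solver, C, key⟩, solver, Polynomial.C C * (Polynomial.X + 1) ^ 2, ?_⟩
  intro n G ω L hL hG
  obtain ⟨t, s, hr, ht, hs⟩ := key n G ω L hL
  refine ⟨t, s, hr, ht.trans ?_, hs.resolve_right fun h => h.2 hG.of_P2P3⟩
  simp only [Polynomial.eval_mul, Polynomial.eval_C, Polynomial.eval_pow, Polynomial.eval_add,
    Polynomial.eval_X, Polynomial.eval_one]
  split_ifs
  · exact Nat.mul_le_mul_left _ (by nlinarith)
  · exact Nat.mul_le_mul_left _ (by nlinarith)
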